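/- **Theorem (uniform diameter bound).** Consider smooth Riemannian metrics on $\mathbb S^2\times\mathbb S^1$ of the form $$g=\varphi^{-2}h+\varphi^{2}\,d\xi^2,\quad \xi\in[0,2\pi],\qquad h=dr^2+u(r)^2\,d\theta^2,\quad r\in[0,a],\ \theta\in[0,2\pi],$$ where $a>0$, $\varphi\in C^\infty(\mathbb S^2)$ is positive, $h$ is a smooth rotationally symmetric Riemannian metric on $\mathbb S^2$ in polar coordinates $(r,\theta)$, and $u\in C^\infty([0,a])$ satisfies $u>0$ on $(0,a)$, $u(0)=u(a)=0$, $u'(0)=1$, $u'(a)=-1$. Let $$\mathrm{MinA}(g)=\inf\{\mathrm{Area}_g(\Sigma) : \Sigma \text{ a (nonempty) closed embedded minimal surface in } (\mathbb S^2\times\mathbb S^1,g)\}.$$ For all real numbers $V_0$ and $A_0>0$ there is a constant $C>0$, depending only on $V_0$ and $A_0$, such that the following holds. Let $(g_i)_{i\in\mathbb N}$ be a sequence of metrics of the above form, with data $a_i,u_i,h_i,\varphi_i$, satisfying for every $i$ $$\mathrm{Scal}_{g_i}\ge 0,\qquad \mathrm{Vol}_{g_i}(\mathbb S^2\times\mathbb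 S^1)\le V_0,\qquad \mathrm{MinA}(g_i)\ge A_0 .$$ Then $$C^{-1}\le \mathrm{Diam}_{h_i}(\mathbb S^2)=a_i\le C\qquad\text{for all } i\in\mathbb N .$$ -/

import Mathlib

open MeasureTheory Set Manifold Bundle
open scoped ContDiff ENNReal

noncomputable section

namespace WarpedMinA

/-! ### Riemannian metrics in coordinates -/

/-- A smooth Riemannian metric on the manifold `M`. -/
abbrev SmoothMetric {E H : Type} [NormedAddCommGroup E] [NormedSpace ℝ E] [TopologicalSpace H]
    (I : ModelWithCorners ℝ E H) (M : Type) [TopologicalSpace M] [ChartedSpace H M]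
    [IsManifold I ∞ M] : Type :=
  ContMDiffRiemannianMetric I ∞ E (fun x : M => TangentSpace I x)

section General

variable {E H : Type} [NormedAddCommGroup E] [NormedSpace ℝ E] [TopologicalSpace H]
  {I : ModelWithCorners ℝ E H} {M : Type} [TopologicalSpace M] [ChartedSpace H M]
  [IsManifold I ∞ M]

/-- `F` is a smooth immersion of the open set `U ⊆ ℝᵏ` into `M`. -/
structure IsImmersedPatch (I : ModelWithCorners ℝ E H) {k : ℕ}
    (U : Set (EuclideanSpace ℝ (Fin k))) (F : EuclideanSpace ℝ (Fin k) → M) : Prop where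
  isOpen : IsOpen U
  contMDiffOn : ContMDiffOn (𝓡 k) I ∞ F U
  immersion : ∀ x ∈ U, Function.Injective (mfderiv (𝓡 k) I F x)

/-- `F` is an injective smooth immersion of the open set `U ⊆ ℝᵏ` into `M`.  When `k` is the
dimension of `M` these are exactly the inverses of the smooth charts of `M`. -/
structure IsLocalParam (I : ModelWithCorners ℝ E H) {k : ℕ}
    (U : Set (EuclideanSpace ℝ (Fin k))) (F : EuclideanSpace ℝ (Fin k) → M) : Prop extends
    IsImmersedPatch I U F where
  injOn : InjOn F U

/-- The matrix of the pulled back metric `F^* g` at the point `x` of `ℝᵏ`. -/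
def gram (g : SmoothMetric I M) {k : ℕ} (F : EuclideanSpace ℝ (Fin k) → M)
    (x : EuclideanSpace ℝ (Fin k)) : Matrix (Fin k) (Fin k) ℝ :=
  Matrix.of fun i j => g.inner (F x)
    (mfderiv (𝓡 k) I F x (EuclideanSpace.single i (1 : ℝ)))
    (mfderiv (𝓡 k) I F x (EuclideanSpace.single j (1 : ℝ)))

end General

/-- The partial derivative `∂ᵢ f`. -/
def pd {k : ℕ} (i : Fin k) (f : EuclideanSpace ℝ (Fin k) → ℝ) (x : EuclideanSpace ℝ (Fin k)) : ℝ :=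
  fderiv ℝ f x (EuclideanSpace.single i (1 : ℝ))

/-- The Christoffel symbol `Γ^m_{ij}` of the metric with coefficient matrix `G`. -/
def christoffel {k : ℕ} (G : EuclideanSpace ℝ (Fin k) → Matrix (Fin k) (Fin k) ℝ) (m i j : Fin k)
    (x : EuclideanSpace ℝ (Fin k)) : ℝ :=
  (1 / 2) * ∑ l, (G x)⁻¹ m l *
    (pd i (fun y => G y j l) x + pd j (fun y => G y i l) x - pd l (fun y => G y i j) x)

/-- The Ricci tensor `Ric_{ij}` of the metric with coefficient matrix `G`. -/
def ricci {k : ℕ} (G : EuclideanSpace ℝ (Fin k) → Matrix (Fin k) (Fin k) ℝ) (i j : Fin k)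
    (x : EuclideanSpace ℝ (Fin k)) : ℝ :=
  ∑ m, (pd m (christoffel G m i j) x - pd j (christoffel G m i m) x
    + ∑ l, (christoffel G m m l x * christoffel G l i j x
      - christoffel G m j l x * christoffel G l i m x))

/-- The scalar curvature of the metric with coefficient matrix `G`. -/
def scalarCurv {k : ℕ} (G : EuclideanSpace ℝ (Fin k) → Matrix (Fin k) (Fin k) ℝ)
    (x : EuclideanSpace ℝ (Fin k)) : ℝ :=
  ∑ i, ∑ j, (G x)⁻¹ i j * ricci G i j x

/-- The mean curvature, at a point `x` with `x₃ = 0`, of the coordinate surface `{x₃ = 0}` for the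
metric with coefficient matrix `G` on a subset of `ℝ³`.  With `γ` the induced metric on the surface
and the unit normal covector `dx₃ / |dx₃|`, the second fundamental form is
`II(∂ᵢ, ∂ⱼ) = Γ³ᵢⱼ / |dx₃|`, and the mean curvature is its trace with respect to `γ`. -/
def sliceMeanCurv (G : EuclideanSpace ℝ (Fin 3) → Matrix (Fin 3) (Fin 3) ℝ)
    (x : EuclideanSpace ℝ (Fin 3)) : ℝ :=
  (∑ i : Fin 2, ∑ j : Fin 2, ((G x).submatrix Fin.castSucc Fin.castSucc)⁻¹ i j *
    christoffel G (Fin.last 2) (Fin.castSucc i) (Fin.castSucc j) x)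
    / √((G x)⁻¹ (Fin.last 2) (Fin.last 2))

/-! ### Curvature, volume, minimal surfaces and diameter on manifolds -/

section General

variable {E H : Type} [NormedAddCommGroup E] [NormedSpace ℝ E] [TopologicalSpace H]
  {I : ModelWithCorners ℝ E H} {M : Type} [TopologicalSpace M] [ChartedSpace H M]
  [IsManifold I ∞ M]

/-- The scalar curvature of the metric `g` on the `n`-manifold `M` is nonnegative: its expression in
every smooth local coordinate system is nonnegative. -/
def ScalarNonneg (n : ℕ) (g : SmoothMetric I M) : Prop :=
  ∀ (U : Set (EuclideanSpace ℝ (Fin n))) (F : EuclideanSpace ℝ (Fin n) → M),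
    IsLocalParam I U F → ∀ x ∈ U, 0 ≤ scalarCurv (gram g F) x

/-- A parametrized `k`-dimensional piece of `M`: the image of a measurable set `carrier`, on which
the immersion `toFun` of the open set `dom` is injective. -/
structure Piece (I : ModelWithCorners ℝ E H) (M : Type) [TopologicalSpace M] [ChartedSpace H M]
    (k : ℕ) where
  dom : Set (EuclideanSpace ℝ (Fin k))
  carrier : Set (EuclideanSpace ℝ (Fin k))
  toFun : EuclideanSpace ℝ (Fin k) → M
  isImmersedPatch : IsImmersedPatch I dom toFun
  measurableSet_carrier : MeasurableSet carrier
  carrier_subset : carrier ⊆ dom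
  injOn : InjOn toFun carrier

/-- The `k`-dimensional volume of a parametrized piece, `∫ √(det F^* g)`. -/
def Piece.vol {k : ℕ} (P : Piece I M k) (g : SmoothMetric I M) : ℝ≥0∞ :=
  ∫⁻ x in P.carrier, ENNReal.ofReal (√((gram g P.toFun x).det))

/-- The `k`-dimensional Riemannian volume of a subset of `M`: the infimum of the total volume of the
countable families of parametrized pieces that cover it.  On `k`-dimensional
submanifolds this is the integral of the Riemannian volume element: the infimum is
attained by cutting the submanifold into disjoint parametrized pieces. -/
def riemVol (k : ℕ) (g : SmoothMetric I M) (S : Set M) : ℝ≥0∞ :=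
  ⨅ (P : ℕ → Piece I M k) (_ : S ⊆ ⋃ i, (P i).toFun '' (P i).carrier), ∑' i, (P i).vol g

/-- `S` is a closed (compact, without boundary, nonempty) embedded minimal surface in the Riemannian
`3`-manifold `(M, g)`: around each of its points there are local coordinates of `M` in which `S`
is the slice `{x₃ = 0}`, and the mean curvature of this slice vanishes. -/
structure IsClosedMinimalSurface (g : SmoothMetric I M) (S : Set M) : Prop where
  nonempty : S.Nonempty
  isCompact : IsCompact S
  minimal : ∀ p ∈ S, ∃ (U : Set (EuclideanSpace ℝ (Fin 3))) (F : EuclideanSpace ℝ (Fin 3) → M),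
    IsLocalParam I U F ∧ p ∈ F '' U ∧
      ∀ x ∈ U, (F x ∈ S ↔ x 2 = 0) ∧ (x 2 = 0 → sliceMeanCurv (gram g F) x = 0)

/-- `MinA(M, g)`: the infimum of the areas of the closed minimal surfaces. -/
def minA (g : SmoothMetric I M) : ℝ≥0∞ :=
  ⨅ (S : Set M) (_ : IsClosedMinimalSurface g S), riemVol 2 g S

/-- The diameter of `(M, g)` for the Riemannian distance (the infimum of the lengths of `C¹`
paths). -/
def diam (g : SmoothMetric I M) : ℝ≥0∞ :=
  letI : RiemannianBundle (fun x : M => TangentSpace I x) := ⟨g.toRiemannianMetric⟩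
  ⨆ (x : M) (y : M), riemannianEDist I x y

end General

/-! ### Warped products on `S² × S¹` -/

instance : Fact (Module.finrank ℝ (EuclideanSpace ℝ (Fin 3)) = 2 + 1) := ⟨by simp⟩

/-- The unit sphere in `ℝ³`. -/
abbrev S2 : Type := Metric.sphere (0 : EuclideanSpace ℝ (Fin 3)) 1

/-- The standard polar map `(r, θ) ↦ (sin (π r / a) cos θ, sin (π r / a) sin θ, cos (π r / a))`,
which identifies the quotient of `[0, a] × ℝ / 2πℤ` that collapses `{0} × ℝ / 2πℤ` and
`{a} × ℝ / 2πℤ` to points with the unit sphere. -/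
def polarMap (a : ℝ) (x : EuclideanSpace ℝ (Fin 2)) : S2 :=
  ⟨!₂[Real.sin (Real.pi * x 0 / a) * Real.cos (x 1), Real.sin (Real.pi * x 0 / a) * Real.sin (x 1),
      Real.cos (Real.pi * x 0 / a)], by
    simp only [mem_sphere_iff_norm, sub_zero, EuclideanSpace.norm_eq, Real.sqrt_eq_one,
      Real.norm_eq_abs, sq_abs, Fin.sum_univ_three]
    simp
    nlinarith [Real.sin_sq_add_cos_sq (Real.pi * x 0 / a), Real.sin_sq_add_cos_sq (x 1)]⟩

/-- A smooth rotationally symmetric metric `h = dr² + u(r)² dθ²` on `S²`, where `0 ≤ r ≤ a` and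
`θ` has period `2π`.  The polar coordinates `(r, θ)` are the standard ones up to an arbitrary
diffeomorphism of `S²`. -/
structure RotSymMetric where
  a : ℝ
  a_pos : 0 < a
  u : ℝ → ℝ
  u_smooth : ContDiffOn ℝ ∞ u (Icc 0 a)
  u_zero : u 0 = 0
  u_a : u a = 0
  deriv_u_zero : derivWithin u (Icc 0 a) 0 = 1
  deriv_u_a : derivWithin u (Icc 0 a) a = -1
  u_pos : ∀ r ∈ Ioo 0 a, 0 < u r
  /-- the diffeomorphism of `S²` -/
  Ψ : S2 ≃ₘ⟮𝓡 2, 𝓡 2⟯ S2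
  /-- the metric on `S²` -/
  h : SmoothMetric (𝓡 2) S2
  h_eq : ∀ x : EuclideanSpace ℝ (Fin 2), x 0 ∈ Ioo 0 a →
    gram h (fun y => Ψ (polarMap a y)) x = !![1, 0; 0, u (x 0) ^ 2]

/-- The metric `dξ²` of the unit circle, pulled back to `S² × S¹`. -/
def dxiSq (p : S2 × Circle) (v w : TangentSpace ((𝓡 2).prod (𝓡 1)) p) : ℝ :=
  inner ℝ (mfderiv ((𝓡 2).prod (𝓡 1)) 𝓘(ℝ, ℂ) (fun q : S2 × Circle => (q.2 : ℂ)) p v : ℂ)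
    (mfderiv ((𝓡 2).prod (𝓡 1)) 𝓘(ℝ, ℂ) (fun q : S2 × Circle => (q.2 : ℂ)) p w : ℂ)

/-- A smooth metric `g = φ⁻² h + φ² dξ²` on `S² × S¹`, with `φ` a positive smooth function on `S²`
and `h = dr² + u² dθ²` a smooth rotationally symmetric metric on `S²`. -/
structure WarpedMetric extends RotSymMetric where
  φ : S2 → ℝ
  φ_smooth : ContMDiff (𝓡 2) 𝓘(ℝ, ℝ) ∞ φ
  φ_pos : ∀ p, 0 < φ p
  /-- the metric on `S² × S¹` -/
  g : SmoothMetric ((𝓡 2).prod (𝓡 1)) (S2 × Circle)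
  g_eq : ∀ (p : S2 × Circle) (v w : TangentSpace ((𝓡 2).prod (𝓡 1)) p),
    g.inner p v w = (φ p.1 ^ 2)⁻¹ *
        h.inner p.1 (mfderiv ((𝓡 2).prod (𝓡 1)) (𝓡 2) Prod.fst p v)
          (mfderiv ((𝓡 2).prod (𝓡 1)) (𝓡 2) Prod.fst p w)
      + φ p.1 ^ 2 * dxiSq p v w

/-- The condition `Λ`: nonnegative scalar curvature, volume at most `V₀` and `MinA` at least
`A₀`. -/
structure ConditionΛ (V₀ A₀ : ℝ) (W : WarpedMetric) : Prop where
  scalar_nonneg : ScalarNonneg 3 W.g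
  vol_le : riemVol 3 W.g univ ≤ ENNReal.ofReal V₀
  le_minA : ENNReal.ofReal A₀ ≤ minA W.g

end WarpedMinA

end

noncomputable section

namespace WarpedMinA

open scoped Topology

/-! Put p = -log φ, so that g = e^{2p}(dr² + u² dθ²) + e^{-2p} dξ². The second derivatives of p
cancel in the scalar curvature, which equals 2e^{-2p}(-u''/u - p_r² - p_θ²/u²). Hence nonnegative
scalar curvature is the pointwise inequality p_r² u² + p_θ² ≤ -u u'' (`curvature_inequality`). In
particular u is concave and lies below r and a - r.

Two kinds of minimal surfaces are enough. Over a critical point r₀ of u the torus r = r₀ is minimal;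
φ cancels in its area, which is at most 4π² u(r₀) ≤ 4π² a (`minA_le_torus`). This is already the
lower bound for a. The spheres S² × {ξ} are minimal as well, with area at most the integral of
e^{2p} u dr dθ (`minA_le_sphere`). The volume is at least the integral of e^p u dr dθ dξ.

If p were a constant L and u comparable to a number v, these facts would read A₀ ≲ v, A₀ ≲ e^{2L} v
a and a v e^L ≲ V₀. Multiplying the first two and squaring the third gives A₀² a ≲ V₀², a bound for
a in which v and L have disappeared (`le_of_area_volume_bounds`).

The analytic point is therefore to compare p with one constant, and this is `exists_circle`. The
mean value theorem for u' gives a circle r = s in the middle of the sphere where -u'' ≤ 8/a, so p_θ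
is bounded there and p oscillates by a bounded amount on that circle. In the r direction the
curvature inequality makes 2p + log u - 2r u'/u + (5/8) log r nondecreasing (`monotoneOn_energy`).
So e^{2p} u grows towards a pole at most like (a/r)^{5/8}, which is integrable because 5/8 < 1. The
same monotonicity bounds e^p u from below on an interval of length a/4, which gives the volume
estimate.

The rest justifies the geometry: curvature of diagonal metrics, minimality of the tori and spheres,
covers by parametrized pieces for areas, the change of variables for the volume, and the identity
between the diameter of h and a (`diam_eq_ofReal`). -/

/-! ### Concave profiles and the curvature inequality -/

/-- A concave profile on `[0, a]` with first and second derivatives `u₁`, `u₂`, vanishing at the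
end points and lying below the lines of slope `±1` through them. -/
structure IsProfile (a : ℝ) (u u₁ u₂ : ℝ → ℝ) : Prop where
  a_pos : 0 < a
  continuousOn : ContinuousOn u (Icc 0 a)
  zero : u 0 = 0
  right : u a = 0
  pos : ∀ r ∈ Ioo 0 a, 0 < u r
  hasDerivAt : ∀ r ∈ Ioo 0 a, HasDerivAt u (u₁ r) r
  hasDerivAt' : ∀ r ∈ Ioo 0 a, HasDerivAt u₁ (u₂ r) r
  nonpos : ∀ r ∈ Ioo 0 a, u₂ r ≤ 0
  le_left : ∀ r ∈ Icc 0 a, u r ≤ r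
  le_right : ∀ r ∈ Icc 0 a, u r ≤ a - r

namespace IsProfile

variable {a : ℝ} {u u₁ u₂ : ℝ → ℝ}

/-- The symmetry r ↦ a - r exchanges the poles, so estimates anchored at r = 0 need only one proof.
-/
lemma reflect (h : IsProfile a u u₁ u₂) :
    IsProfile a (fun r => u (a - r)) (fun r => -u₁ (a - r)) (fun r => u₂ (a - r)) where
  a_pos := h.a_pos
  continuousOn := h.continuousOn.comp (by fun_prop) fun r hr =>
    ⟨by linarith [hr.2], by linarith [hr.1]⟩
  zero := by simpa using h.right
  right := by simpa using h.zero
  pos r hr := h.pos _ ⟨by linarith [hr.2], by linarith [hr.1]⟩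
  hasDerivAt r hr := by
    exact (h.hasDerivAt (a - r) ⟨by linarith [hr.2], by linarith [hr.1]⟩).comp_const_sub a r
  hasDerivAt' r hr := by
    simpa using
      ((h.hasDerivAt' (a - r) ⟨by linarith [hr.2], by linarith [hr.1]⟩).comp_const_sub a r).fun_neg
  nonpos r hr := h.nonpos _ ⟨by linarith [hr.2], by linarith [hr.1]⟩
  le_left r hr := by
    have := h.le_right (a - r) ⟨by linarith [hr.2], by linarith [hr.1]⟩
    linarith
  le_right r hr := h.le_left (a - r) ⟨by linarith [hr.2], by linarith [hr.1]⟩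

lemma concaveOn (h : IsProfile a u u₁ u₂) : ConcaveOn ℝ (Icc 0 a) u := by
  refine concaveOn_of_hasDerivWithinAt2_nonpos (convex_Icc 0 a) h.continuousOn (f' := u₁)
    (f'' := u₂) ?_ ?_ ?_ <;> rw [interior_Icc]
  · exact fun r hr => (h.hasDerivAt r hr).hasDerivWithinAt
  · exact fun r hr => (h.hasDerivAt' r hr).hasDerivWithinAt
  · exact h.nonpos

lemma mul_deriv_le (h : IsProfile a u u₁ u₂) {r : ℝ} (hr : r ∈ Ioo 0 a) : r * u₁ r ≤ u r := by
  have h1 := h.concaveOn.le_slope_of_hasDerivAt (x := 0) (y := r) ⟨le_rfl, h.a_pos.le⟩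
    ⟨hr.1.le, hr.2.le⟩ hr.1 (h.hasDerivAt r hr)
  rw [slope_def_field, h.zero, le_div_iff₀ (by linarith [hr.1])] at h1
  linarith

lemma mul_neg_deriv_le (h : IsProfile a u u₁ u₂) {r : ℝ} (hr : r ∈ Ioo 0 a) :
    (a - r) * -u₁ r ≤ u r := by
  simpa using h.reflect.mul_deriv_le (r := a - r) ⟨by linarith [hr.2], by linarith [hr.1]⟩

/-- Concavity: the chord from a point of the graph to the left end point. -/
lemma mul_le_of_le (h : IsProfile a u u₁ u₂) {r s : ℝ} (hr : 0 ≤ r) (hrs : r ≤ s) (hs : s ≤ a) :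
    r * u s ≤ s * u r := by
  rcases hr.eq_or_lt with rfl | hr
  · simp [h.zero]
  have hs0 : 0 < s := hr.trans_le hrs
  have := h.concaveOn.2 (show (0 : ℝ) ∈ Icc 0 a from ⟨le_rfl, h.a_pos.le⟩)
    (show s ∈ Icc 0 a from ⟨hs0.le, hs⟩) (show 0 ≤ 1 - r / s by
      rw [sub_nonneg, div_le_one hs0]; exact hrs) (show 0 ≤ r / s by positivity) (by ring)
  simp only [h.zero, smul_eq_mul, mul_zero, zero_add, div_mul_cancel₀ r hs0.ne'] at this
  calc r * u s = s * (r / s * u s) := by field_simp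
    _ ≤ _ := by gcongr

lemma mul_le_of_ge (h : IsProfile a u u₁ u₂) {r s : ℝ} (hs : 0 ≤ s) (hsr : s ≤ r) (hr : r ≤ a) :
    (a - r) * u s ≤ (a - s) * u r := by
  simpa using h.reflect.mul_le_of_le (r := a - r) (s := a - s) (by linarith) (by linarith)
    (by linarith)

/-- The curvature inequality `p'² ≤ -u''/u` makes `2 p + log u - 2 r u'/u + (5/8) log r`
nondecreasing. -/
lemma monotoneOn_energy (h : IsProfile a u u₁ u₂) {p p₁ : ℝ → ℝ}
    (hp : ∀ r ∈ Ioo 0 a, HasDerivAt p (p₁ r) r)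
    (hc : ∀ r ∈ Ioo 0 a, p₁ r ^ 2 * u r ≤ -u₂ r) :
    MonotoneOn (fun r => 2 * p r + Real.log (u r) - 2 * (r * (u₁ r / u r)) + 5 / 8 * Real.log r)
      (Ioo 0 a) := by
  have key : ∀ r ∈ Ioo 0 a, HasDerivAt
      (fun r => 2 * p r + Real.log (u r) - 2 * (r * (u₁ r / u r)) + 5 / 8 * Real.log r)
      (2 * p₁ r + u₁ r / u r - 2 * (1 * (u₁ r / u r) + r * ((u₂ r * u r - u₁ r * u₁ r) / u r ^ 2))
        + 5 / 8 * r⁻¹) r := fun r hr => by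
    have hu := (h.pos r hr).ne'
    exact ((((hp r hr).const_mul 2).add ((h.hasDerivAt r hr).log hu)).sub
      (((hasDerivAt_id r).mul ((h.hasDerivAt' r hr).div (h.hasDerivAt r hr) hu)).const_mul 2)).add
      ((Real.hasDerivAt_log hr.1.ne').const_mul _)
  refine monotoneOn_of_deriv_nonneg (convex_Ioo 0 a)
    (fun r hr => (key r hr).continuousAt.continuousWithinAt)
    (fun r hr => ?_) fun r hr => ?_ <;> rw [interior_Ioo] at hr
  · exact (key r hr).differentiableAt.differentiableWithinAt
  rw [(key r hr).deriv]
  have hu := h.pos r hr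
  have hr0 := hr.1
  have hk : p₁ r ^ 2 ≤ -u₂ r / u r := by rw [le_div_iff₀ hu]; exact hc r hr
  -- Completing the squares in p' and in u'/u costs 1/(2r) and 1/(8r). Their sum is the derivative
  -- of the term (5/8) log r.
  have e : (2 * p₁ r + u₁ r / u r
      - 2 * (1 * (u₁ r / u r) + r * ((u₂ r * u r - u₁ r * u₁ r) / u r ^ 2)) + 5 / 8 * r⁻¹)
      = 2 * r * (p₁ r + 1 / (2 * r)) ^ 2 + 2 * r * (u₁ r / u r - 1 / (4 * r)) ^ 2
        + 2 * r * (-u₂ r / u r - p₁ r ^ 2) := by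
    field_simp
    ring
  rw [e]
  have : 0 ≤ -u₂ r / u r - p₁ r ^ 2 := by linarith
  positivity

/-- The monotone energy is compared at r and s. Concavity gives r u'/u ≤ 1 at r, and u'/u ≥ -1/(a -
s) at s, hence s u'/u ≥ -3 because s ≤ 3a/4. The term -2r u'/u thus costs at most 2 + 6 = 8 in the
exponent. -/
lemma exp_mul_le_of_le (h : IsProfile a u u₁ u₂) {p p₁ : ℝ → ℝ}
    (hp : ∀ r ∈ Ioo 0 a, HasDerivAt p (p₁ r) r)
    (hc : ∀ r ∈ Ioo 0 a, p₁ r ^ 2 * u r ≤ -u₂ r) {r s : ℝ} (hr : 0 < r) (hrs : r ≤ s)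
    (hs : s ≤ 3 / 4 * a) :
    Real.exp (2 * p r) * u r ≤
      Real.exp 8 * (s / r) ^ (5 / 8 : ℝ) * (Real.exp (2 * p s) * u s) := by
  have ha := h.a_pos
  have hs0 : 0 < s := hr.trans_le hrs
  have hra : r ∈ Ioo 0 a := ⟨hr, by linarith⟩
  have hsa : s ∈ Ioo 0 a := ⟨hs0, by linarith⟩
  have hm := h.monotoneOn_energy hp hc hra hsa hrs
  have h1 : r * (u₁ r / u r) ≤ 1 := by
    rw [← mul_div_assoc, div_le_one (h.pos r hra)]; exact h.mul_deriv_le hra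
  have h2 : -3 ≤ s * (u₁ s / u s) := by
    rw [← mul_div_assoc, le_div_iff₀ (h.pos s hsa)]
    have := h.mul_neg_deriv_le hsa
    have := h.pos s hsa
    rcases le_total 0 (u₁ s) with h3 | h3 <;> nlinarith
  have hl : 2 * p r + Real.log (u r) ≤
      8 + 5 / 8 * Real.log (s / r) + (2 * p s + Real.log (u s)) := by
    rw [Real.log_div hs0.ne' hr.ne']
    simp only at hm
    linarith
  have := Real.exp_le_exp.2 hl
  rw [Real.exp_add, Real.exp_log (h.pos r hra), Real.exp_add, Real.exp_add, Real.exp_add,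
    Real.exp_log (h.pos s hsa)] at this
  rwa [Real.rpow_def_of_pos (div_pos hs0 hr), mul_comm (Real.log _)]

/-- The main estimate: under the curvature inequality `p'ᵣ² + p'_θ² / u² ≤ -u''/u`, the function
`exp p` is controlled from both sides by its size on one well chosen circle. -/
theorem exists_circle (h : IsProfile a u u₁ u₂) {p pr pt : ℝ → ℝ → ℝ}
    (hpr : ∀ r ∈ Ioo 0 a, ∀ t, HasDerivAt (fun r => p r t) (pr r t) r)
    (hpt : ∀ r ∈ Ioo 0 a, ∀ t, HasDerivAt (fun t => p r t) (pt r t) t)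
    (hc : ∀ r ∈ Ioo 0 a, ∀ t, pr r t ^ 2 * u r ^ 2 + pt r t ^ 2 ≤ -u r * u₂ r) :
    ∃ s ∈ Ioo (a / 4) (a / 2), ∃ L : ℝ,
      (∀ r ∈ Icc 0 a, u r ≤ 4 * u s) ∧
      (∀ r ∈ Ioo 0 a, ∀ t ∈ Icc (-Real.pi) Real.pi, Real.exp (2 * p r t) * u r ≤
        Real.exp 22 * (Real.exp (2 * L) * u s) *
          ((a / r) ^ (5 / 8 : ℝ) + (a / (a - r)) ^ (5 / 8 : ℝ))) ∧
      ∀ r ∈ Icc s (s + a / 4), ∀ t ∈ Icc (-Real.pi) Real.pi,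
        Real.exp (-12) * (Real.exp L * u s) ≤ Real.exp (p r t) * u r := by
  have ha := h.a_pos
  have hpi := Real.pi_lt_d2
  have hsub : ∀ r ∈ Icc (a / 4) (a / 2), r ∈ Ioo 0 a := fun r hr =>
    ⟨by linarith [hr.1], by linarith [hr.2]⟩
  -- The circle comes from the mean value theorem for u' on [a/4, a/2]. The drop of u' there is at
  -- most 2, because u'(a/4) ≤ 1 and u'(a/2) ≥ -1, so -u''(s) ≤ 2/(a/4) = 8/a.
  obtain ⟨s, hs, hse⟩ := exists_hasDerivAt_eq_slope u₁ u₂ (a := a / 4) (b := a / 2) (by linarith)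
    (fun r hr => (h.hasDerivAt' r (hsub r hr)).continuousAt.continuousWithinAt)
    (fun r hr => h.hasDerivAt' r (hsub r (Ioo_subset_Icc_self hr)))
  have hsa : s ∈ Ioo 0 a := hsub s (Ioo_subset_Icc_self hs)
  have hus := h.pos s hsa
  have hslope : -u₂ s ≤ 8 / a := by
    have m1 : a / 4 ∈ Ioo 0 a := ⟨by linarith, by linarith⟩
    have m2 : a / 2 ∈ Ioo 0 a := ⟨by linarith, by linarith⟩
    have h1 : u₁ (a / 4) ≤ 1 := by
      have := h.mul_deriv_le m1
      have := h.le_left _ (Ioo_subset_Icc_self m1)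
      nlinarith
    have h2 : -1 ≤ u₁ (a / 2) := by
      have := h.mul_neg_deriv_le m2
      have := h.le_right _ (Ioo_subset_Icc_self m2)
      nlinarith
    rw [hse, ← neg_div, show a / 2 - a / 4 = a / 4 by ring, div_le_div_iff₀ (by linarith) ha]
    nlinarith
  -- On this circle p_θ² ≤ u · (-u'') ≤ (a/2)(8/a) = 4.
  have hptb : ∀ t, |pt s t| ≤ 2 := fun t => by
    refine abs_le_of_sq_le_sq ?_ (by norm_num)
    have h1 := hc s hsa t
    have h2 : u s ≤ a / 2 := (h.le_left s (Ioo_subset_Icc_self hsa)).trans hs.2.le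
    have h3 : u s * -u₂ s ≤ a / 2 * (8 / a) :=
      mul_le_mul h2 hslope (by linarith [h.nonpos s hsa]) (by linarith)
    have h4 : a / 2 * (8 / a) = 4 := by field_simp; norm_num
    nlinarith [mul_nonneg (sq_nonneg (pr s t)) (sq_nonneg (u s))]
  -- With slope at most 2 and |t| ≤ π, the oscillation about t = 0 is at most 2π < 7.
  have hL : ∀ t ∈ Icc (-Real.pi) Real.pi, |p s t - p s 0| ≤ 7 := fun t ht => by
    have := (convex_univ (𝕜 := ℝ) (E := ℝ)).norm_image_sub_le_of_norm_hasDerivWithin_le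
      (f := fun t => p s t) (f' := pt s) (C := 2) (x := 0) (y := t)
      (fun t _ => (hpt s hsa t).hasDerivWithinAt) (fun t _ => hptb t) trivial trivial
    rw [Real.norm_eq_abs, Real.norm_eq_abs, sub_zero] at this
    have : |t| ≤ Real.pi := abs_le.2 ⟨ht.1, ht.2⟩
    linarith
  have hc' : ∀ t, ∀ r ∈ Ioo 0 a, pr r t ^ 2 * u r ≤ -u₂ r := fun t r hr => by
    have := hc r hr t
    have hu := h.pos r hr
    refine le_of_mul_le_mul_right ?_ hu
    nlinarith [sq_nonneg (pt r t)]
  have hmid : ∀ t ∈ Icc (-Real.pi) Real.pi,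
      Real.exp (2 * p s t) ≤ Real.exp 14 * Real.exp (2 * p s 0) := fun t ht => by
    rw [← Real.exp_add]
    exact Real.exp_le_exp.2 (by linarith [(abs_le.1 (hL t ht)).2])
  refine ⟨s, hs, p s 0, fun r hr => ?_, fun r hr t ht => ?_, fun r hr t ht => ?_⟩
  -- Concavity with the far end point gives the ratio (a - r)/(a - s) ≤ 2 on the left of s, and r/s
  -- ≤ 4 on the right.
  · rcases le_total r s with hrs | hrs
    · have := h.mul_le_of_ge hr.1 hrs hsa.2.le
      have h0 : 0 ≤ u r := by
        rcases hr.1.eq_or_lt with rfl | h0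
        · rw [h.zero]
        · exact (h.pos r ⟨h0, hrs.trans_lt hsa.2⟩).le
      nlinarith [hs.1, hs.2, hr.1, hr.2]
    · have := h.mul_le_of_le hsa.1.le hrs hr.2
      have h0 : 0 ≤ u r := by
        rcases hr.2.eq_or_lt with rfl | h0
        · rw [h.right]
        · exact (h.pos r ⟨hsa.1.trans_le hrs, h0⟩).le
      nlinarith [hs.1, hs.2, hr.1, hr.2]
  · have hr0 := hr.1
    have hr1 : 0 < a - r := by linarith [hr.2]
    -- The 8 comes from the energy in the r direction and the 14 = 2 · 7 from the oscillation of 2p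
    -- along the circle.
    have e22 : Real.exp 22 = Real.exp 8 * Real.exp 14 := by rw [← Real.exp_add]; norm_num
    have hA : 0 ≤ (a / r) ^ (5 / 8 : ℝ) := by positivity
    have hB : 0 ≤ (a / (a - r)) ^ (5 / 8 : ℝ) := by positivity
    have fin : ∀ x ≤ (a / r) ^ (5 / 8 : ℝ) + (a / (a - r)) ^ (5 / 8 : ℝ), 0 ≤ x →
        Real.exp 8 * x * (Real.exp (2 * p s t) * u s) ≤
          Real.exp 22 * (Real.exp (2 * p s 0) * u s) *
          ((a / r) ^ (5 / 8 : ℝ) + (a / (a - r)) ^ (5 / 8 : ℝ)) := fun x hx hx0 => by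
      calc Real.exp 8 * x * (Real.exp (2 * p s t) * u s)
          ≤ Real.exp 8 * ((a / r) ^ (5 / 8 : ℝ) + (a / (a - r)) ^ (5 / 8 : ℝ)) *
            ((Real.exp 14 * Real.exp (2 * p s 0)) * u s) := by
            gcongr
            exact hmid t ht
        _ = _ := by rw [e22]; ring
    rcases le_total r s with hrs | hrs
    · refine (h.exp_mul_le_of_le (fun r hr => hpr r hr t) (hc' t) hr.1 hrs
        (by linarith [hs.2])).trans (fin _ ?_ (by have := hsa.1; positivity))
      have : (s / r) ^ (5 / 8 : ℝ) ≤ (a / r) ^ (5 / 8 : ℝ) := by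
        have := hsa.1
        gcongr
        exact hsa.2.le
      linarith
    -- The right half is the left half for the reflected profile; a - s ≤ 3a/4 holds because s >
    -- a/4.
    · have := h.reflect.exp_mul_le_of_le (p := fun r => p (a - r) t)
        (p₁ := fun r => -pr (a - r) t) (r := a - r) (s := a - s)
        (fun r hr => by
          exact (hpr (a - r) ⟨by linarith [hr.2], by linarith [hr.1]⟩ t).comp_const_sub a r)
        (fun r hr => by
          simpa using hc' t (a - r) ⟨by linarith [hr.2], by linarith [hr.1]⟩)
        (by linarith [hr.2]) (by linarith) (by linarith [hs.1])
      simp only [sub_sub_cancel] at this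
      have has : 0 < a - s := by linarith [hsa.2]
      refine this.trans (fin _ ?_ (by positivity))
      have : ((a - s) / (a - r)) ^ (5 / 8 : ℝ) ≤ (a / (a - r)) ^ (5 / 8 : ℝ) := by
        gcongr
        linarith [hsa.1]
      linarith
  · have hr0 : 0 < r := hsa.1.trans_le hr.1
    have hra : r ∈ Ioo 0 a := ⟨hr0, by linarith [hr.2, hs.2]⟩
    have hur := h.pos r hra
    have h1 := h.exp_mul_le_of_le (fun r hr => hpr r hr t) (hc' t) hsa.1 hr.1
      (by linarith [hr.2, hs.2])
    have h2 : (r / s) ^ (5 / 8 : ℝ) ≤ 2 := by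
      have h3 : r / s ≤ 2 := by
        rw [div_le_iff₀ hsa.1]
        linarith [hr.2, hs.1]
      have h4 : 1 ≤ r / s := by rw [one_le_div hsa.1]; exact hr.1
      calc (r / s) ^ (5 / 8 : ℝ) ≤ (r / s) ^ (1 : ℝ) :=
            Real.rpow_le_rpow_of_exponent_le h4 (by norm_num)
        _ ≤ 2 := by rwa [Real.rpow_one]
    have h3 : u s ≤ 3 * u r := by
      have := h.mul_le_of_ge hsa.1.le hr.1 hra.2.le
      nlinarith [hs.1, hs.2, hr.1, hr.2]
    -- The energy controls e^{2p} u, whereas the volume needs e^p u. A further factor u(s) ≤ 3 u(r)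
    -- makes both sides squares, and the constants combine as 2 · 3 = 6 ≤ e².
    have h4 : Real.exp (2 * p s t) * u s ^ 2 ≤ Real.exp 10 * (Real.exp (2 * p r t) * u r ^ 2) := by
      have e2 : (6 : ℝ) ≤ Real.exp 2 := by
        have := Real.exp_one_gt_d9
        have e : Real.exp 2 = Real.exp 1 * Real.exp 1 := by rw [← Real.exp_add]; norm_num
        nlinarith
      calc Real.exp (2 * p s t) * u s ^ 2 = (Real.exp (2 * p s t) * u s) * u s := by ring
        _ ≤ (Real.exp 8 * 2 * (Real.exp (2 * p r t) * u r)) * (3 * u r) := by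
            have : Real.exp (2 * p s t) * u s ≤ Real.exp 8 * 2 * (Real.exp (2 * p r t) * u r) :=
              h1.trans (by gcongr)
            gcongr
        _ = Real.exp 8 * 6 * (Real.exp (2 * p r t) * u r ^ 2) := by ring
        _ ≤ Real.exp 8 * Real.exp 2 * (Real.exp (2 * p r t) * u r ^ 2) := by gcongr
        _ = _ := by rw [← Real.exp_add]; norm_num
    have h5 : Real.exp (p s t) * u s ≤ Real.exp 5 * (Real.exp (p r t) * u r) := by
      refine le_of_sq_le_sq ?_ (by positivity)
      have sq : ∀ x : ℝ, Real.exp (2 * x) = Real.exp x ^ 2 := fun x => by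
        rw [← Real.exp_nat_mul]; norm_num
      have e10 : Real.exp 10 = Real.exp 5 ^ 2 := by rw [← Real.exp_nat_mul]; norm_num
      rw [sq, sq, e10] at h4
      nlinarith
    have h6 : Real.exp (p s 0) ≤ Real.exp 7 * Real.exp (p s t) := by
      rw [← Real.exp_add]
      exact Real.exp_le_exp.2 (by linarith [(abs_le.1 (hL t ht)).1])
    -- The exponent 12 is 7 for the oscillation on the circle plus 5, half of the 10 above.
    calc Real.exp (-12) * (Real.exp (p s 0) * u s)
        ≤ Real.exp (-12) * (Real.exp 7 * Real.exp (p s t) * u s) := by gcongr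
      _ = Real.exp (-12) * Real.exp 7 * (Real.exp (p s t) * u s) := by ring
      _ ≤ Real.exp (-12) * Real.exp 7 * (Real.exp 5 * (Real.exp (p r t) * u r)) := by gcongr
      _ = (Real.exp (-12) * Real.exp 7 * Real.exp 5) * (Real.exp (p r t) * u r) := by ring
      _ = Real.exp (p r t) * u r := by
          rw [← Real.exp_add, ← Real.exp_add]; norm_num

end IsProfile

/-! ### Curvature of diagonal metrics -/


lemma pd_congr {k : ℕ} {f g : EuclideanSpace ℝ (Fin k) → ℝ} {x : EuclideanSpace ℝ (Fin k)}
    (h : f =ᶠ[𝓝 x] g) (i : Fin k) : pd i f x = pd i g x := by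
  rw [pd, pd, h.fderiv_eq]

/-- The Christoffel symbols of the diagonal metric with entries `exp (2 aᵢ)`. -/
def diagChristoffel {k : ℕ} (a : Fin k → EuclideanSpace ℝ (Fin k) → ℝ) (m i j : Fin k)
    (x : EuclideanSpace ℝ (Fin k)) : ℝ :=
  if i = j then
    if m = i then pd i (a i) x else -(Real.exp (2 * a i x - 2 * a m x) * pd m (a i) x)
  else if m = i then pd j (a i) x else if m = j then pd i (a j) x else 0

lemma pd_exp {k : ℕ} {f : EuclideanSpace ℝ (Fin k) → ℝ} {x : EuclideanSpace ℝ (Fin k)}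
    (hf : DifferentiableAt ℝ f x) (i : Fin k) :
    pd i (fun y => Real.exp (f y)) x = Real.exp (f x) * pd i f x := by
  simp [pd, fderiv_exp hf]

lemma pd_mul {k : ℕ} {f g : EuclideanSpace ℝ (Fin k) → ℝ} {x : EuclideanSpace ℝ (Fin k)}
    (hf : DifferentiableAt ℝ f x) (hg : DifferentiableAt ℝ g x) (i : Fin k) :
    pd i (fun y => f y * g y) x = f x * pd i g x + g x * pd i f x := by
  simp [pd, fderiv_fun_mul hf hg]

lemma pd_sub {k : ℕ} {f g : EuclideanSpace ℝ (Fin k) → ℝ} {x : EuclideanSpace ℝ (Fin k)}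
    (hf : DifferentiableAt ℝ f x) (hg : DifferentiableAt ℝ g x) (i : Fin k) :
    pd i (fun y => f y - g y) x = pd i f x - pd i g x := by
  simp [pd, fderiv_fun_sub hf hg]

lemma pd_add {k : ℕ} {f g : EuclideanSpace ℝ (Fin k) → ℝ} {x : EuclideanSpace ℝ (Fin k)}
    (hf : DifferentiableAt ℝ f x) (hg : DifferentiableAt ℝ g x) (i : Fin k) :
    pd i (fun y => f y + g y) x = pd i f x + pd i g x := by
  simp [pd, fderiv_fun_add hf hg]

lemma pd_const_mul {k : ℕ} {f : EuclideanSpace ℝ (Fin k) → ℝ} {x : EuclideanSpace ℝ (Fin k)}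
    (hf : DifferentiableAt ℝ f x) (c : ℝ) (i : Fin k) :
    pd i (fun y => c * f y) x = c * pd i f x := by
  simp [pd, fderiv_const_mul hf]

lemma pd_neg {k : ℕ} {f : EuclideanSpace ℝ (Fin k) → ℝ} {x : EuclideanSpace ℝ (Fin k)}
    (i : Fin k) : pd i (fun y => -f y) x = -pd i f x := by
  simp [pd, fderiv_fun_neg]

lemma pd_zero {k : ℕ} {x : EuclideanSpace ℝ (Fin k)} (i : Fin k) :
    pd i (fun _ => (0 : ℝ)) x = 0 := by
  simp [pd]

lemma inv_diagonal_exp {k : ℕ} (b : Fin k → ℝ) :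
    (Matrix.diagonal fun i => Real.exp (b i))⁻¹ = Matrix.diagonal fun i => Real.exp (-b i) := by
  refine Matrix.inv_eq_right_inv ?_
  rw [Matrix.diagonal_mul_diagonal]
  simp [← Real.exp_add]

/-- The inverse of a diagonal matrix keeps only the summand l = m, and its exponential cancels the
one produced by differentiating. The diagonal form is needed near `x`, not only at `x`, because
entries are differentiated. -/
lemma christoffel_of_diagonal {k : ℕ} {G : EuclideanSpace ℝ (Fin k) → Matrix (Fin k) (Fin k) ℝ}
    {a : Fin k → EuclideanSpace ℝ (Fin k) → ℝ} {x : EuclideanSpace ℝ (Fin k)}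
    (hG : ∀ᶠ y in 𝓝 x, G y = Matrix.diagonal fun i => Real.exp (2 * a i y))
    (ha : ∀ i, DifferentiableAt ℝ (a i) x) (m i j : Fin k) :
    christoffel G m i j x = diagChristoffel a m i j x := by
  have hpd : ∀ l i j : Fin k, pd l (fun y => G y i j) x =
      if i = j then Real.exp (2 * a i x) * (2 * pd l (a i) x) else 0 := fun l i j => by
    have : (fun y => G y i j) =ᶠ[𝓝 x] fun y => if i = j then Real.exp (2 * a i y) else 0 := by
      filter_upwards [hG] with y hy
      rw [hy, Matrix.diagonal_apply]
    rw [pd_congr this]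
    split_ifs
    · rw [pd_exp ((ha i).const_mul 2), pd_const_mul (ha i)]
    · exact pd_zero l
  rw [christoffel, hG.self_of_nhds, inv_diagonal_exp, Finset.sum_eq_single m
    (fun l _ hl => by rw [Matrix.diagonal_apply_ne _ hl.symm, zero_mul]) (by simp),
    Matrix.diagonal_apply_eq, hpd, hpd, hpd, diagChristoffel]
  have e : Real.exp (-(2 * a m x)) * Real.exp (2 * a m x) = 1 := by simp [← Real.exp_add]
  by_cases hij : i = j
  · subst hij
    by_cases hm : m = i
    · subst hm
      simp only [if_true]
      linear_combination (pd m (a m) x) * e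
    · simp only [if_true, if_neg hm, if_neg (Ne.symm hm)]
      rw [sub_eq_add_neg (2 * a i x), Real.exp_add]
      ring
  · rw [if_neg hij, if_neg hij]
    by_cases hmi : m = i
    · subst hmi
      rw [if_neg (Ne.symm hij), if_pos rfl, if_pos rfl]
      linear_combination (pd j (a m) x) * e
    · rw [if_neg hmi, if_neg (Ne.symm hmi)]
      by_cases hmj : m = j
      · subst hmj
        rw [if_pos rfl, if_pos rfl]
        linear_combination (pd i (a m) x) * e
      · rw [if_neg hmj, if_neg (Ne.symm hmj)]
        ring

lemma pd_differentiableAt {k : ℕ} {f : EuclideanSpace ℝ (Fin k) → ℝ}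
    {x : EuclideanSpace ℝ (Fin k)} (hf : ContDiffAt ℝ 2 f x) (i : Fin k) :
    DifferentiableAt ℝ (pd i f) x :=
  ((hf.fderiv_right (m := 1) (by norm_num)).differentiableAt (by norm_num)).clm_apply
    (differentiableAt_const _)

lemma pd_diagChristoffel {k : ℕ} {a : Fin k → EuclideanSpace ℝ (Fin k) → ℝ}
    {x : EuclideanSpace ℝ (Fin k)} (ha : ∀ i, ContDiffAt ℝ 2 (a i) x) (n m i j : Fin k) :
    pd n (diagChristoffel a m i j) x =
      if i = j then
        if m = i then pd n (pd i (a i)) x else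
          -(Real.exp (2 * a i x - 2 * a m x) * (pd n (pd m (a i)) x +
            (2 * pd n (a i) x - 2 * pd n (a m) x) * pd m (a i) x))
      else if m = i then pd n (pd j (a i)) x else if m = j then pd n (pd i (a j)) x else 0 := by
  have hd : ∀ i, DifferentiableAt ℝ (a i) x := fun i => (ha i).differentiableAt (by norm_num)
  have hd2 : ∀ i j, DifferentiableAt ℝ (pd j (a i)) x := fun i j => pd_differentiableAt (ha i) j
  unfold diagChristoffel
  split_ifs
  · rfl
  · have h1 : DifferentiableAt ℝ (fun y => 2 * a i y - 2 * a m y) x :=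
      ((hd i).const_mul 2).sub ((hd m).const_mul 2)
    rw [pd_neg, pd_mul h1.exp (hd2 i m), pd_exp h1, pd_sub ((hd i).const_mul 2)
      ((hd m).const_mul 2), pd_const_mul (hd i), pd_const_mul (hd m)]
    ring
  · rfl
  · rfl
  · exact pd_zero n

/-- Contraction with a diagonal inverse sees only the diagonal Ricci entries. The Christoffel
formula is used on a neighbourhood so that it can be differentiated once more. -/
lemma scalarCurv_of_diagonal {k : ℕ} {G : EuclideanSpace ℝ (Fin k) → Matrix (Fin k) (Fin k) ℝ}
    {a : Fin k → EuclideanSpace ℝ (Fin k) → ℝ} {x : EuclideanSpace ℝ (Fin k)}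
    (hG : ∀ᶠ y in 𝓝 x, G y = Matrix.diagonal fun i => Real.exp (2 * a i y))
    (ha : ∀ i, ContDiffAt ℝ 2 (a i) x) :
    scalarCurv G x = ∑ i, Real.exp (-(2 * a i x)) *
      ∑ m, (pd m (diagChristoffel a m i i) x - pd i (diagChristoffel a m i m) x
        + ∑ l, (diagChristoffel a m m l x * diagChristoffel a l i i x
          - diagChristoffel a m i l x * diagChristoffel a l i m x)) := by
  have hc : ∀ m i j, christoffel G m i j =ᶠ[𝓝 x] diagChristoffel a m i j := fun m i j => by
    filter_upwards [hG.eventually_nhds, Filter.eventually_all.2 fun i => (ha i).eventually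
      (by norm_num)] with y hy hay
    exact christoffel_of_diagonal hy (fun i => (hay i).differentiableAt (by norm_num)) m i j
  rw [scalarCurv, hG.self_of_nhds, inv_diagonal_exp]
  refine Finset.sum_congr rfl fun i _ => ?_
  rw [Finset.sum_eq_single i (fun l _ hl => by rw [Matrix.diagonal_apply_ne _ hl.symm, zero_mul])
    (by simp), Matrix.diagonal_apply_eq]
  simp only [ricci, pd_congr (hc _ _ _), (hc _ _ _).eq_of_nhds]

/-- The scalar curvature of `e^{2f} (dx₀² + e^{2ℓ} dx₁²) + e^{-2f} dx₂²`, where `f` and `ℓ` do not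
depend on `x₂` and `ℓ` does not depend on `x₁`. -/
lemma scalarCurv_warped {G : EuclideanSpace ℝ (Fin 3) → Matrix (Fin 3) (Fin 3) ℝ}
    {f l : EuclideanSpace ℝ (Fin 3) → ℝ} {x : EuclideanSpace ℝ (Fin 3)}
    (hG : ∀ᶠ y in 𝓝 x, G y = Matrix.diagonal
      ![Real.exp (2 * f y), Real.exp (2 * (f y + l y)), Real.exp (2 * -f y)])
    (hf : ContDiffAt ℝ 2 f x) (hl : ContDiffAt ℝ 2 l x)
    (hf2 : ∀ᶠ y in 𝓝 x, pd 2 f y = 0) (hl2 : ∀ᶠ y in 𝓝 x, pd 2 l y = 0)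
    (hl1 : ∀ᶠ y in 𝓝 x, pd 1 l y = 0) :
    scalarCurv G x = 2 * Real.exp (-(2 * f x)) * (-(pd 0 (pd 0 l) x + pd 0 l x ^ 2)
      - pd 0 f x ^ 2 - pd 1 f x ^ 2 * Real.exp (-(2 * l x))) := by
  set a : Fin 3 → EuclideanSpace ℝ (Fin 3) → ℝ := ![f, fun y => f y + l y, fun y => -f y] with ha
  have hG' : ∀ᶠ y in 𝓝 x, G y = Matrix.diagonal fun i => Real.exp (2 * a i y) := by
    filter_upwards [hG] with y hy
    rw [hy]
    congr 1
    ext i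
    fin_cases i <;> rfl
  have hac : ∀ i, ContDiffAt ℝ 2 (a i) x := by
    intro i
    fin_cases i
    · exact hf
    · exact hf.add hl
    · exact hf.neg
  have hd : ∀ᶠ y in 𝓝 x, DifferentiableAt ℝ f y ∧ DifferentiableAt ℝ l y := by
    filter_upwards [hf.eventually (by norm_num), hl.eventually (by norm_num)] with y h1 h2
    exact ⟨h1.differentiableAt (by norm_num), h2.differentiableAt (by norm_num)⟩
  have e1 : ∀ j, pd j (fun y => f y + l y) =ᶠ[𝓝 x] fun y => pd j f y + pd j l y := fun j => by
    filter_upwards [hd] with y hy using pd_add hy.1 hy.2 j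
  have e2 : ∀ j, pd j (fun y => -f y) = fun y => -pd j f y := fun j => funext fun y => pd_neg j
  have z1 : ∀ n, pd n (pd 2 f) x = 0 := fun n => (pd_congr hf2 n).trans (pd_zero n)
  have z2 : ∀ n, pd n (pd 2 l) x = 0 := fun n => (pd_congr hl2 n).trans (pd_zero n)
  have z3 : ∀ n, pd n (pd 1 l) x = 0 := fun n => (pd_congr hl1 n).trans (pd_zero n)
  have w1 : ∀ i j, pd i (pd j (fun y => f y + l y)) x = pd i (pd j f) x + pd i (pd j l) x :=
    fun i j => (pd_congr (e1 j) i).trans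
      (pd_add (pd_differentiableAt hf j) (pd_differentiableAt hl j) i)
  have w2 : ∀ i j, pd i (pd j (fun y => -f y)) x = -pd i (pd j f) x := fun i j => by
    rw [e2, pd_neg]
  have v1 : ∀ j, pd j (fun y => f y + l y) x = pd j f x + pd j l x := fun j =>
    (e1 j).eq_of_nhds
  have v2 : ∀ j, pd j (fun y => -f y) x = -pd j f x := fun j => pd_neg j
  rw [scalarCurv_of_diagonal hG' hac]
  simp only [pd_diagChristoffel hac, Fin.sum_univ_three]
  simp only [diagChristoffel]
  simp [ha, w1, w2, v1, v2, z1, z2, z3, hf2.self_of_nhds, hl2.self_of_nhds, hl1.self_of_nhds]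
  have x1 : Real.exp (-(2 * l x)) = (Real.exp (2 * l x))⁻¹ := Real.exp_neg _
  have x2 : Real.exp (-(2 * f x)) = (Real.exp (2 * f x))⁻¹ := Real.exp_neg _
  have x3 : Real.exp (2 * f x - 2 * (f x + l x)) = (Real.exp (2 * l x))⁻¹ := by
    rw [← x1]; congr 1; ring
  have x4 : Real.exp (2 * (f x + l x) - 2 * f x) = Real.exp (2 * l x) := by
    congr 1; ring
  have x5 : Real.exp (-(2 * f x) - 2 * f x) = (Real.exp (2 * f x))⁻¹ * (Real.exp (2 * f x))⁻¹ := by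
    rw [← x2, ← Real.exp_add]; congr 1
  have x6 : Real.exp (-(2 * f x) - 2 * (f x + l x)) =
      (Real.exp (2 * f x))⁻¹ * (Real.exp (2 * f x))⁻¹ * (Real.exp (2 * l x))⁻¹ := by
    rw [← x1, ← x2, ← Real.exp_add, ← Real.exp_add]; congr 1; ring
  have x7 : Real.exp (-(2 * (f x + l x))) = (Real.exp (2 * f x))⁻¹ * (Real.exp (2 * l x))⁻¹ := by
    rw [← x1, ← x2, ← Real.exp_add]; congr 1; ring
  rw [x1, x2, x3, x4, x5, x6, x7]
  have p1 := (Real.exp_pos (2 * f x)).ne'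
  have p2 := (Real.exp_pos (2 * l x)).ne'
  -- All second derivatives of `f` cancel here: the opposite exponents on the base and on the fibre
  -- are chosen for this.
  field_simp
  ring

/-! ### Mean curvature of coordinate slices -/

/-- The area element of the slice is e^{a₀ + a₁}, and the mean curvature is a multiple of its
logarithmic derivative in the normal direction. -/
lemma sliceMeanCurv_of_diagonal {G : EuclideanSpace ℝ (Fin 3) → Matrix (Fin 3) (Fin 3) ℝ}
    {a : Fin 3 → EuclideanSpace ℝ (Fin 3) → ℝ} {x : EuclideanSpace ℝ (Fin 3)}
    (hG : ∀ᶠ y in 𝓝 x, G y = Matrix.diagonal fun i => Real.exp (2 * a i y))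
    (ha : ∀ i, DifferentiableAt ℝ (a i) x) (h : pd 2 (a 0) x + pd 2 (a 1) x = 0) :
    sliceMeanCurv G x = 0 := by
  have e : (Matrix.diagonal fun i => Real.exp (2 * a i x)).submatrix
      (Fin.castSucc : Fin 2 → Fin 3) Fin.castSucc =
      Matrix.diagonal fun i : Fin 2 => Real.exp (2 * a (Fin.castSucc i) x) := by
    rw [Matrix.submatrix_diagonal _ _ (Fin.castSucc_injective 2)]
    rfl
  rw [sliceMeanCurv, hG.self_of_nhds, e, inv_diagonal_exp]
  simp only [christoffel_of_diagonal hG ha, Fin.sum_univ_two, diagChristoffel]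
  simp
  left
  rw [← mul_assoc, ← mul_assoc, ← Real.exp_add, ← Real.exp_add]
  ring_nf
  linear_combination (-Real.exp (-(a 2 x * 2))) * h

/-- For a block metric whose tangential block has no normal derivative, every Γ³ᵢⱼ with tangential
indices vanishes: the slice is totally geodesic. The adjugate formula gives the zeros of the inverse
without any invertibility assumption. -/
lemma sliceMeanCurv_of_product {G : EuclideanSpace ℝ (Fin 3) → Matrix (Fin 3) (Fin 3) ℝ}
    {x : EuclideanSpace ℝ (Fin 3)}
    (hG : ∀ i : Fin 2, ∀ᶠ y in 𝓝 x, G y (Fin.castSucc i) 2 = 0 ∧ G y 2 (Fin.castSucc i) = 0)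
    (h : ∀ i j : Fin 2, pd 2 (fun y => G y (Fin.castSucc i) (Fin.castSucc j)) x = 0) :
    sliceMeanCurv G x = 0 := by
  have z : ∀ (i : Fin 2) k, pd k (fun y => G y (Fin.castSucc i) 2) x = 0 := fun i k =>
    (pd_congr ((hG i).mono fun y hy => hy.1) k).trans (pd_zero k)
  have g0 := (hG 0).self_of_nhds
  have g1 := (hG 1).self_of_nhds
  have inv : ∀ i : Fin 2, (G x)⁻¹ 2 (Fin.castSucc i) = 0 := fun i => by
    simp only [Fin.castSucc_zero, Fin.castSucc_one, Fin.isValue] at g0 g1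
    rw [Matrix.inv_def, Matrix.adjugate_fin_three]
    fin_cases i <;> simp [g0, g1]
  have hc : ∀ i j : Fin 2,
      christoffel G (Fin.last 2) (Fin.castSucc i) (Fin.castSucc j) x = 0 := fun i j => by
    rw [christoffel, Fin.sum_univ_castSucc]
    have e : Fin.last 2 = 2 := rfl
    simp [e, inv, z, h]
  simp only [sliceMeanCurv, hc, mul_zero, Finset.sum_const_zero, zero_div]

/-! ### Smooth maps into the product -/

lemma mfderiv_prodMk_fst_snd {k : ℕ} {F₁ : EuclideanSpace ℝ (Fin k) → S2}
    {F₂ : EuclideanSpace ℝ (Fin k) → Circle} {x : EuclideanSpace ℝ (Fin k)}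
    (h₁ : MDifferentiableAt (𝓡 k) (𝓡 2) F₁ x) (h₂ : MDifferentiableAt (𝓡 k) (𝓡 1) F₂ x)
    (v : EuclideanSpace ℝ (Fin k)) :
    mfderiv ((𝓡 2).prod (𝓡 1)) (𝓡 2) Prod.fst (F₁ x, F₂ x)
      (mfderiv (𝓡 k) ((𝓡 2).prod (𝓡 1)) (fun y => (F₁ y, F₂ y)) x v) =
        mfderiv (𝓡 k) (𝓡 2) F₁ x v := by
  rw [mfderiv_fst, mfderiv_prodMk h₁ h₂]
  rfl

lemma contMDiff_coe_circle : ContMDiff (𝓡 1) 𝓘(ℝ, ℂ) ∞ (fun z : Circle => (z : ℂ)) :=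
  @contMDiff_coe_sphere ℂ _ _ ∞ 1 finrank_real_complex_fact'

lemma dxi_apply {k : ℕ} {F₁ : EuclideanSpace ℝ (Fin k) → S2}
    {s : EuclideanSpace ℝ (Fin k) → ℝ} {x : EuclideanSpace ℝ (Fin k)}
    (h₁ : MDifferentiableAt (𝓡 k) (𝓡 2) F₁ x) (hs : DifferentiableAt ℝ s x)
    (v : EuclideanSpace ℝ (Fin k)) :
    mfderiv ((𝓡 2).prod (𝓡 1)) 𝓘(ℝ, ℂ) (fun q : S2 × Circle => (q.2 : ℂ)) (F₁ x, Circle.exp (s x))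
      (mfderiv (𝓡 k) ((𝓡 2).prod (𝓡 1)) (fun y => (F₁ y, Circle.exp (s y))) x v) =
        (Complex.exp (s x * Complex.I) * (fderiv ℝ s x v * Complex.I) : ℂ) := by
  have hs' : MDifferentiableAt (𝓡 k) (𝓡 1) (fun y => Circle.exp (s y)) x :=
    (contMDiff_circleExp (m := 1)).mdifferentiableAt (by norm_num) |>.comp x
      hs.mdifferentiableAt
  have hq : MDifferentiableAt ((𝓡 2).prod (𝓡 1)) 𝓘(ℝ, ℂ) (fun q : S2 × Circle => (q.2 : ℂ))
      (F₁ x, Circle.exp (s x)) := by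
    exact (contMDiff_coe_circle.mdifferentiableAt (by norm_num)
      (x := Circle.exp (s x))).comp (F₁ x, Circle.exp (s x)) mdifferentiableAt_snd
  have := mfderiv_comp_apply x hq (h₁.prodMk hs') v
  refine this.symm.trans ?_
  have e : (fun q : S2 × Circle => (q.2 : ℂ)) ∘ (fun y => (F₁ y, Circle.exp (s y))) =
      fun y => Complex.exp (s y * Complex.I) := by
    ext y; simp
  rw [e, mfderiv_eq_fderiv]
  have : HasFDerivAt (fun y => Complex.exp (s y * Complex.I)) _ x :=
    ((Complex.ofRealCLM.hasFDerivAt.comp x hs.hasFDerivAt).mul_const Complex.I).cexp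
  rw [this.fderiv]
  change Complex.exp (s x * Complex.I) • (Complex.I • ((fderiv ℝ s x v : ℝ) : ℂ)) = _
  simp only [smul_eq_mul]
  ring

lemma dxiSq_apply {k : ℕ} {F₁ : EuclideanSpace ℝ (Fin k) → S2}
    {s : EuclideanSpace ℝ (Fin k) → ℝ} {x : EuclideanSpace ℝ (Fin k)}
    (h₁ : MDifferentiableAt (𝓡 k) (𝓡 2) F₁ x) (hs : DifferentiableAt ℝ s x)
    (v w : EuclideanSpace ℝ (Fin k)) :
    dxiSq (F₁ x, Circle.exp (s x))
      (mfderiv (𝓡 k) ((𝓡 2).prod (𝓡 1)) (fun y => (F₁ y, Circle.exp (s y))) x v)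
      (mfderiv (𝓡 k) ((𝓡 2).prod (𝓡 1)) (fun y => (F₁ y, Circle.exp (s y))) x w) =
        fderiv ℝ s x v * fderiv ℝ s x w := by
  -- Multiplication by the unit complex number e^{is} is an isometry of ℂ.
  have e : ∀ α β : ℝ, inner ℝ (Complex.exp (s x * Complex.I) * (α * Complex.I))
      (Complex.exp (s x * Complex.I) * (β * Complex.I)) = α * β := fun α β => by
    simp only [Complex.inner, Complex.mul_re, Complex.mul_im, Complex.conj_re, Complex.conj_im,
      Complex.exp_ofReal_mul_I_re, Complex.exp_ofReal_mul_I_im, Complex.ofReal_re,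
      Complex.ofReal_im, Complex.I_re, Complex.I_im]
    linear_combination (α * β) * Real.sin_sq_add_cos_sq (s x)
  rw [dxiSq, dxi_apply h₁ hs, dxi_apply h₁ hs]
  exact e _ _

/-- The metric `φ⁻² h + φ² dξ²` in the product of a patch of `S²` and an angular coordinate. -/
lemma WarpedMetric.inner_mfderiv (W : WarpedMetric) {k : ℕ} {F₁ : EuclideanSpace ℝ (Fin k) → S2}
    {s : EuclideanSpace ℝ (Fin k) → ℝ} {x : EuclideanSpace ℝ (Fin k)}
    (h₁ : MDifferentiableAt (𝓡 k) (𝓡 2) F₁ x) (hs : DifferentiableAt ℝ s x)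
    (v w : EuclideanSpace ℝ (Fin k)) :
    W.g.inner (F₁ x, Circle.exp (s x))
      (mfderiv (𝓡 k) ((𝓡 2).prod (𝓡 1)) (fun y => (F₁ y, Circle.exp (s y))) x v)
      (mfderiv (𝓡 k) ((𝓡 2).prod (𝓡 1)) (fun y => (F₁ y, Circle.exp (s y))) x w) =
    (W.φ (F₁ x) ^ 2)⁻¹ * W.h.inner (F₁ x) (mfderiv (𝓡 k) (𝓡 2) F₁ x v)
        (mfderiv (𝓡 k) (𝓡 2) F₁ x w) +
      W.φ (F₁ x) ^ 2 * (fderiv ℝ s x v * fderiv ℝ s x w) := by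
  have hs' : MDifferentiableAt (𝓡 k) (𝓡 1) (fun y => Circle.exp (s y)) x :=
    (contMDiff_circleExp (m := 1)).mdifferentiableAt (by norm_num) |>.comp x
      hs.mdifferentiableAt
  rw [W.g_eq, dxiSq_apply h₁ hs, mfderiv_prodMk_fst_snd h₁ hs', mfderiv_prodMk_fst_snd h₁ hs']

lemma gram_apply {E H : Type} [NormedAddCommGroup E] [NormedSpace ℝ E] [TopologicalSpace H]
    {I : ModelWithCorners ℝ E H} {M : Type} [TopologicalSpace M] [ChartedSpace H M]
    [IsManifold I ∞ M] (g : SmoothMetric I M) {k : ℕ} (F : EuclideanSpace ℝ (Fin k) → M)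
    (x v w : EuclideanSpace ℝ (Fin k)) :
    g.inner (F x) (mfderiv (𝓡 k) I F x v) (mfderiv (𝓡 k) I F x w) =
      ∑ i, ∑ j, v i * w j * gram g F x i j := by
  have hv : v = ∑ i, v i • EuclideanSpace.single i (1 : ℝ) := by
    ext j; simp [Pi.single_apply]
  have hw : w = ∑ i, w i • EuclideanSpace.single i (1 : ℝ) := by
    ext j; simp [Pi.single_apply]
  have e : ∀ z : EuclideanSpace ℝ (Fin k), mfderiv (𝓡 k) I F x z =
      ∑ i, z i • mfderiv (𝓡 k) I F x (EuclideanSpace.single i (1 : ℝ)) := fun z => by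
    have hz : z = ∑ i, z i • EuclideanSpace.single i (1 : ℝ) := by
      ext j; simp [Pi.single_apply]
    conv_lhs => rw [hz]
    exact (map_sum (mfderiv (𝓡 k) I F x) _ _).trans
      (Finset.sum_congr rfl fun i _ => map_smul (mfderiv (𝓡 k) I F x) _ _)
  rw [e v, e w]
  simp only [map_sum, map_smul, sum_apply, smul_apply, smul_eq_mul, gram,
    Matrix.of_apply, Finset.mul_sum, mul_assoc]
  rw [Finset.sum_comm]
  exact Finset.sum_congr rfl fun i _ => Finset.sum_congr rfl fun j _ => by ring

/-- A smooth map is an immersion where its Gram matrix is nonsingular. -/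
lemma injective_of_gram_det_ne_zero {E H : Type} [NormedAddCommGroup E] [NormedSpace ℝ E]
    [TopologicalSpace H] {I : ModelWithCorners ℝ E H} {M : Type} [TopologicalSpace M]
    [ChartedSpace H M] [IsManifold I ∞ M] (g : SmoothMetric I M) {k : ℕ}
    {F : EuclideanSpace ℝ (Fin k) → M} {x : EuclideanSpace ℝ (Fin k)}
    (h : (gram g F x).det ≠ 0) : Function.Injective (mfderiv (𝓡 k) I F x) := by
  refine (injective_iff_map_eq_zero (mfderiv (𝓡 k) I F x)).2 fun (v : EuclideanSpace ℝ (Fin k)) hv => ?_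
  have key : Matrix.vecMul (fun i => v i) (gram g F x) = 0 := by
    ext j
    have := gram_apply g F x v (EuclideanSpace.single j (1 : ℝ))
    erw [hv] at this
    simp [Matrix.vecMul, dotProduct] at this ⊢
    exact this.symm
  have := Matrix.eq_zero_of_vecMul_eq_zero h key
  exact PiLp.ext fun i => congrFun this i

/-! ### Polar coordinates -/

lemma fderiv_euclidean_apply {k n : ℕ}
    {Q : EuclideanSpace ℝ (Fin k) → EuclideanSpace ℝ (Fin n)} {x : EuclideanSpace ℝ (Fin k)}
    (hQ : DifferentiableAt ℝ Q x) (v : EuclideanSpace ℝ (Fin k)) (i : Fin n) :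
    (fderiv ℝ Q x v) i = fderiv ℝ (fun y => Q y i) x v := by
  have : HasFDerivAt (fun y => Q y i) _ x :=
    (EuclideanSpace.proj i : EuclideanSpace ℝ (Fin n) →L[ℝ] ℝ).hasFDerivAt.comp x hQ.hasFDerivAt
  rw [this.fderiv]
  rfl

lemma contMDiff_polarMap (a : ℝ) : ContMDiff (𝓡 2) (𝓡 2) ∞ (polarMap a) := by
  refine ContMDiff.codRestrict_sphere (n := 2) (E := EuclideanSpace ℝ (Fin 3)) ?_ _
  refine ContDiff.contMDiff ?_
  rw [contDiff_euclidean]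
  have h0 : ContDiff ℝ ∞ fun x : EuclideanSpace ℝ (Fin 2) => Real.pi * x 0 / a := by fun_prop
  intro i
  fin_cases i
  · exact (Real.contDiff_sin.comp h0).mul (Real.contDiff_cos.comp (by fun_prop))
  · exact (Real.contDiff_sin.comp h0).mul (Real.contDiff_sin.comp (by fun_prop))
  · exact Real.contDiff_cos.comp h0

lemma angle_eq_of_cos_sin {s t : ℝ} (hc : Real.cos s = Real.cos t) (hs : Real.sin s = Real.sin t) :
    ∃ m : ℤ, s = t + m * (2 * Real.pi) := by
  rw [← Circle.exp_eq_exp]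
  ext
  rw [Circle.coe_exp, Circle.coe_exp, Complex.exp_mul_I, Complex.exp_mul_I, ← Complex.ofReal_cos,
    ← Complex.ofReal_sin, ← Complex.ofReal_cos, ← Complex.ofReal_sin, hc, hs]

lemma eq_of_abs_sub_lt_of_eq_add {s t : ℝ} (hst : |s - t| < 2 * Real.pi)
    (h : ∃ m : ℤ, s = t + m * (2 * Real.pi)) : s = t := by
  obtain ⟨m, hm⟩ := h
  have hpi := Real.pi_pos
  obtain ⟨ha, hb⟩ := abs_lt.1 hst
  have h1 : (m : ℝ) < 1 := by nlinarith
  have h2 : (-1 : ℝ) < m := by nlinarith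
  have : m = 0 := by
    have h3 : m < 1 := by exact_mod_cast h1
    have h4 : -1 < m := by exact_mod_cast h2
    omega
  simpa [this] using hm

lemma eq_of_mem_Ioo_of_eq_add {s t c : ℝ} (hs : s ∈ Ioo (c - Real.pi) (c + Real.pi))
    (ht : t ∈ Ioo (c - Real.pi) (c + Real.pi)) (h : ∃ m : ℤ, s = t + m * (2 * Real.pi)) :
    s = t :=
  eq_of_abs_sub_lt_of_eq_add
    (abs_lt.2 ⟨by linarith [hs.1, ht.2], by linarith [hs.2, ht.1]⟩) h

lemma eq_of_mem_Ioc_of_eq_add {s t : ℝ} (hs : s ∈ Ioc (-Real.pi) Real.pi)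
    (ht : t ∈ Ioc (-Real.pi) Real.pi) (h : ∃ m : ℤ, s = t + m * (2 * Real.pi)) : s = t :=
  eq_of_abs_sub_lt_of_eq_add
    (abs_lt.2 ⟨by linarith [hs.1, ht.2], by linarith [hs.2, ht.1]⟩) h

lemma sin_pos_of_mem {a r : ℝ} (ha : 0 < a) (hr : r ∈ Ioo 0 a) : 0 < Real.sin (Real.pi * r / a) := by
  apply Real.sin_pos_of_pos_of_lt_pi
  · have := hr.1; have := Real.pi_pos; positivity
  · rw [div_lt_iff₀ ha]; have := Real.pi_pos; have := hr.2; gcongr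

/-- The height determines r, as cos is injective on [0, π]. Away from the poles the sine factor can
then be cancelled, which leaves the angle modulo 2π. -/
lemma polarMap_eq {a : ℝ} (ha : 0 < a) {x y : EuclideanSpace ℝ (Fin 2)} (hx : x 0 ∈ Ioo 0 a)
    (hy : y 0 ∈ Ioo 0 a) (h : polarMap a x = polarMap a y) :
    x 0 = y 0 ∧ ∃ m : ℤ, x 1 = y 1 + m * (2 * Real.pi) := by
  have hv := congrArg Subtype.val h
  have h0 := congrArg (fun v : EuclideanSpace ℝ (Fin 3) => v 0) hv
  have h1 := congrArg (fun v : EuclideanSpace ℝ (Fin 3) => v 1) hv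
  have h2 := congrArg (fun v : EuclideanSpace ℝ (Fin 3) => v 2) hv
  simp only [polarMap, PiLp.toLp_apply, Matrix.cons_val] at h0 h1 h2
  have hpi := Real.pi_pos
  have hm : ∀ r ∈ Ioo 0 a, Real.pi * r / a ∈ Icc 0 Real.pi := fun r hr => by
    have := hr.1
    refine ⟨by positivity, ?_⟩
    rw [div_le_iff₀ ha]; have := hr.2.le; gcongr
  have e := Real.injOn_cos (hm _ hx) (hm _ hy) h2
  have e0 : x 0 = y 0 := by
    field_simp at e
    exact e
  refine ⟨e0, ?_⟩
  have hs := (sin_pos_of_mem ha hy).ne'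
  rw [e0] at h0 h1
  exact angle_eq_of_cos_sin (mul_left_cancel₀ hs h0) (mul_left_cancel₀ hs h1)

namespace RotSymMetric

variable (R : RotSymMetric)

/-- Polar coordinates of a rotationally symmetric metric. -/
def polar (y : EuclideanSpace ℝ (Fin 2)) : S2 := R.Ψ (polarMap R.a y)

lemma contMDiff_polar : ContMDiff (𝓡 2) (𝓡 2) ∞ R.polar :=
  R.Ψ.contMDiff.comp (contMDiff_polarMap R.a)

lemma gram_polar {x : EuclideanSpace ℝ (Fin 2)} (hx : x 0 ∈ Ioo 0 R.a) :
    gram R.h R.polar x = !![1, 0; 0, R.u (x 0) ^ 2] :=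
  R.h_eq x hx

lemma inner_polar {x : EuclideanSpace ℝ (Fin 2)} (hx : x 0 ∈ Ioo 0 R.a)
    (v w : EuclideanSpace ℝ (Fin 2)) :
    R.h.inner (R.polar x) (mfderiv (𝓡 2) (𝓡 2) R.polar x v) (mfderiv (𝓡 2) (𝓡 2) R.polar x w) =
      v 0 * w 0 + R.u (x 0) ^ 2 * (v 1 * w 1) := by
  rw [gram_apply, R.gram_polar hx]
  simp [Fin.sum_univ_two]
  ring

end RotSymMetric

/-! ### Patches combining polar coordinates with an angle -/

namespace WarpedMetric

variable (W : WarpedMetric)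

/-- The product of polar coordinates and an angle, after a change of variables. -/
def patch {k : ℕ} (q₀ q₁ s : EuclideanSpace ℝ (Fin k) → ℝ) (x : EuclideanSpace ℝ (Fin k)) :
    S2 × Circle :=
  (W.polar !₂[q₀ x, q₁ x], Circle.exp (s x))

/-- `-log φ` in polar coordinates. -/
def logPsi (r t : ℝ) : ℝ := -Real.log (W.φ (W.polar !₂[r, t]))

lemma exp_logPsi (r t : ℝ) : Real.exp (2 * W.logPsi r t) = (W.φ (W.polar !₂[r, t]) ^ 2)⁻¹ := by
  have := W.φ_pos (W.polar !₂[r, t])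
  rw [logPsi, mul_neg, Real.exp_neg, mul_comm, Real.exp_mul, Real.exp_log this]
  norm_num

lemma exp_neg_logPsi (r t : ℝ) : Real.exp (2 * -W.logPsi r t) = W.φ (W.polar !₂[r, t]) ^ 2 := by
  rw [mul_neg, Real.exp_neg, exp_logPsi, inv_inv]

lemma contDiff_pair {V : Type*} [NormedAddCommGroup V] [NormedSpace ℝ V] {q₀ q₁ : V → ℝ}
    {n : ℕ∞ω} (h₀ : ContDiff ℝ n q₀) (h₁ : ContDiff ℝ n q₁) :
    ContDiff ℝ n fun x => (!₂[q₀ x, q₁ x] : EuclideanSpace ℝ (Fin 2)) := by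
  rw [contDiff_euclidean]
  intro i
  fin_cases i
  · exact h₀
  · exact h₁

lemma contDiff_logPsi {V : Type*} [NormedAddCommGroup V] [NormedSpace ℝ V] {q₀ q₁ : V → ℝ}
    (h₀ : ContDiff ℝ ∞ q₀) (h₁ : ContDiff ℝ ∞ q₁) :
    ContDiff ℝ ∞ fun x => W.logPsi (q₀ x) (q₁ x) := by
  have h : ContDiff ℝ ∞ fun x => W.φ (W.polar !₂[q₀ x, q₁ x]) :=
    ((W.φ_smooth.comp W.contMDiff_polar).comp (contDiff_pair h₀ h₁).contMDiff).contDiff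
  exact (h.log fun x => (W.φ_pos _).ne').neg

lemma contMDiff_patch {k : ℕ} {q₀ q₁ s : EuclideanSpace ℝ (Fin k) → ℝ} (h₀ : ContDiff ℝ ∞ q₀)
    (h₁ : ContDiff ℝ ∞ q₁) (hs : ContDiff ℝ ∞ s) :
    ContMDiff (𝓡 k) ((𝓡 2).prod (𝓡 1)) ∞ (W.patch q₀ q₁ s) :=
  (W.contMDiff_polar.comp (contDiff_pair h₀ h₁).contMDiff).prodMk
    (contMDiff_circleExp.comp hs.contMDiff)

lemma mfderiv_comp_pair {k : ℕ} {G : EuclideanSpace ℝ (Fin 2) → S2}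
    {q₀ q₁ : EuclideanSpace ℝ (Fin k) → ℝ} {x : EuclideanSpace ℝ (Fin k)}
    (hG : MDifferentiableAt (𝓡 2) (𝓡 2) G !₂[q₀ x, q₁ x]) (h₀ : ContDiff ℝ ∞ q₀)
    (h₁ : ContDiff ℝ ∞ q₁) (v : EuclideanSpace ℝ (Fin k)) :
    mfderiv (𝓡 k) (𝓡 2) (fun x => G !₂[q₀ x, q₁ x]) x v =
      mfderiv (𝓡 2) (𝓡 2) G !₂[q₀ x, q₁ x]
        (!₂[fderiv ℝ q₀ x v, fderiv ℝ q₁ x v] : EuclideanSpace ℝ (Fin 2)) := by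
  have hqd : DifferentiableAt ℝ (fun x => (!₂[q₀ x, q₁ x] : EuclideanSpace ℝ (Fin 2))) x :=
    (contDiff_pair h₀ h₁).differentiable (by norm_num) x
  refine (mfderiv_comp_apply x hG hqd.mdifferentiableAt v).trans ?_
  rw [mfderiv_eq_fderiv]
  congr 1
  refine PiLp.ext fun i => ?_
  refine (fderiv_euclidean_apply hqd v i).trans ?_
  fin_cases i <;> rfl

/-- One pull-back formula for arbitrary functions (r, θ, ξ) = (`q₀`, `q₁`, `s`). The polar
coordinates, the torus coordinates and the parametrizations of tori and spheres are all
specializations of it. -/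
lemma gram_patch {k : ℕ} {q₀ q₁ s : EuclideanSpace ℝ (Fin k) → ℝ} (h₀ : ContDiff ℝ ∞ q₀)
    (h₁ : ContDiff ℝ ∞ q₁) (hs : ContDiff ℝ ∞ s) {x : EuclideanSpace ℝ (Fin k)}
    (hx : q₀ x ∈ Ioo 0 W.a) (i j : Fin k) :
    gram W.g (W.patch q₀ q₁ s) x i j =
      Real.exp (2 * W.logPsi (q₀ x) (q₁ x)) *
        (pd i q₀ x * pd j q₀ x + W.u (q₀ x) ^ 2 * (pd i q₁ x * pd j q₁ x)) +
      Real.exp (2 * -W.logPsi (q₀ x) (q₁ x)) * (pd i s x * pd j s x) := by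
  have hq := contDiff_pair h₀ h₁
  have hF : MDifferentiableAt (𝓡 k) (𝓡 2) (fun x => W.polar !₂[q₀ x, q₁ x]) x :=
    (W.contMDiff_polar.comp hq.contMDiff).mdifferentiableAt (by norm_num)
  have hm := mfderiv_comp_pair (W.contMDiff_polar.mdifferentiableAt (by norm_num)) h₀ h₁ (x := x)
  have := W.inner_mfderiv hF (hs.differentiable (by norm_num) x) (EuclideanSpace.single i (1 : ℝ))
    (EuclideanSpace.single j (1 : ℝ))
  rw [gram, Matrix.of_apply]
  refine this.trans ?_
  rw [hm, hm, W.inner_polar hx, exp_logPsi, exp_neg_logPsi]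
  simp [pd]

lemma patch_eq {k : ℕ} {q₀ q₁ s : EuclideanSpace ℝ (Fin k) → ℝ} {x y : EuclideanSpace ℝ (Fin k)}
    (hx : q₀ x ∈ Ioo 0 W.a) (hy : q₀ y ∈ Ioo 0 W.a) (h : W.patch q₀ q₁ s x = W.patch q₀ q₁ s y) :
    q₀ x = q₀ y ∧ (∃ m : ℤ, q₁ x = q₁ y + m * (2 * Real.pi)) ∧
      ∃ m : ℤ, s x = s y + m * (2 * Real.pi) := by
  have h1 := W.Ψ.injective (congrArg Prod.fst h)
  have h2 := congrArg Prod.snd h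
  obtain ⟨e0, e1⟩ := polarMap_eq W.a_pos (x := !₂[q₀ x, q₁ x]) (y := !₂[q₀ y, q₁ y]) hx hy h1
  exact ⟨e0, e1, Circle.exp_eq_exp.1 h2⟩

end WarpedMetric

lemma pd_coord {k : ℕ} (i j : Fin k) (x : EuclideanSpace ℝ (Fin k)) :
    pd i (fun y => y j) x = if i = j then 1 else 0 := by
  have : fderiv ℝ (fun y : EuclideanSpace ℝ (Fin k) => y j) x =
      (EuclideanSpace.proj j : EuclideanSpace ℝ (Fin k) →L[ℝ] ℝ) :=
    (EuclideanSpace.proj j : EuclideanSpace ℝ (Fin k) →L[ℝ] ℝ).fderiv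
  rw [pd, this]
  simp [eq_comm]

lemma pd_const {k : ℕ} (i : Fin k) (c : ℝ) (x : EuclideanSpace ℝ (Fin k)) :
    pd i (fun _ => c) x = 0 := by
  simp [pd]

lemma pd_const_add {k : ℕ} (i : Fin k) (c : ℝ) (f : EuclideanSpace ℝ (Fin k) → ℝ)
    (x : EuclideanSpace ℝ (Fin k)) : pd i (fun y => c + f y) x = pd i f x := by
  simp [pd]

/-! ### The curvature inequality -/

lemma two_le_infty : (2 : ℕ∞ω) ≤ ((⊤ : ℕ∞) : ℕ∞ω) := by
  exact WithTop.coe_le_coe.2 (le_top : (2 : ℕ∞) ≤ ⊤)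

lemma pd_comp_coord {k : ℕ} {g : ℝ → ℝ} {x : EuclideanSpace ℝ (Fin k)} {j : Fin k}
    (hg : DifferentiableAt ℝ g (x j)) (i : Fin k) :
    pd i (fun y => g (y j)) x = if i = j then deriv g (x j) else 0 := by
  have h1 : HasFDerivAt (fun y : EuclideanSpace ℝ (Fin k) => y j)
      (EuclideanSpace.proj j : EuclideanSpace ℝ (Fin k) →L[ℝ] ℝ) x :=
    (EuclideanSpace.proj j : EuclideanSpace ℝ (Fin k) →L[ℝ] ℝ).hasFDerivAt
  have h2 : HasFDerivAt (fun y : EuclideanSpace ℝ (Fin k) => g (y j)) _ x :=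
    hg.hasDerivAt.comp_hasFDerivAt x h1
  rw [pd, h2.fderiv]
  simp [eq_comm]

lemma pd_eq_deriv {k : ℕ} {f : EuclideanSpace ℝ (Fin k) → ℝ} {x : EuclideanSpace ℝ (Fin k)}
    (hf : DifferentiableAt ℝ f x) (i : Fin k) :
    pd i f x = deriv (fun s : ℝ => f (x + s • EuclideanSpace.single i 1)) 0 := by
  rw [pd, ← hf.lineDeriv_eq_fderiv, lineDeriv]

namespace RotSymMetric

variable (R : RotSymMetric)

lemma contDiffAt_u {r : ℝ} (hr : r ∈ Ioo 0 R.a) : ContDiffAt ℝ ∞ R.u r :=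
  R.u_smooth.contDiffAt (Icc_mem_nhds hr.1 hr.2)

lemma hasDerivAt_u {r : ℝ} (hr : r ∈ Ioo 0 R.a) : HasDerivAt R.u (deriv R.u r) r :=
  ((R.contDiffAt_u hr).differentiableAt (by norm_num)).hasDerivAt

lemma hasDerivAt_deriv_u {r : ℝ} (hr : r ∈ Ioo 0 R.a) :
    HasDerivAt (deriv R.u) (deriv (deriv R.u) r) r := by
  have : ContDiffAt ℝ 1 (fun r => fderiv ℝ R.u r 1) r :=
    ((R.contDiffAt_u hr).fderiv_right (m := 1) (one_add_one_eq_two.trans_le two_le_infty)).clm_apply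
      contDiffAt_const
  exact (this.differentiableAt (by norm_num)).hasDerivAt

/-- A concave function lies below its tangent lines; the one-sided derivatives 1 and -1 at the end
points give u ≤ r and u ≤ a - r. -/
lemma isProfile (h : ∀ r ∈ Ioo 0 R.a, deriv (deriv R.u) r ≤ 0) :
    IsProfile R.a R.u (deriv R.u) (deriv (deriv R.u)) := by
  have hcont : ContinuousOn R.u (Icc 0 R.a) := R.u_smooth.continuousOn
  have hconc : ConcaveOn ℝ (Icc 0 R.a) R.u := by
    refine concaveOn_of_hasDerivWithinAt2_nonpos (convex_Icc 0 R.a) hcont (f' := deriv R.u)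
      (f'' := deriv (deriv R.u)) ?_ ?_ ?_ <;> rw [interior_Icc]
    · exact fun r hr => (R.hasDerivAt_u hr).hasDerivWithinAt
    · exact fun r hr => (R.hasDerivAt_deriv_u hr).hasDerivWithinAt
    · exact h
  have hd : DifferentiableOn ℝ R.u (Icc 0 R.a) := R.u_smooth.differentiableOn (by norm_num)
  have m0 : (0 : ℝ) ∈ Icc 0 R.a := ⟨le_rfl, R.a_pos.le⟩
  have ma : R.a ∈ Icc 0 R.a := ⟨R.a_pos.le, le_rfl⟩
  refine ⟨R.a_pos, hcont, R.u_zero, R.u_a, R.u_pos, fun r hr => R.hasDerivAt_u hr,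
    fun r hr => R.hasDerivAt_deriv_u hr, h, fun r hr => ?_, fun r hr => ?_⟩
  · rcases hr.1.eq_or_lt with rfl | h0
    · rw [R.u_zero]
    have := hconc.slope_le_of_hasDerivWithinAt m0 hr h0
      (R.deriv_u_zero ▸ (hd 0 m0).hasDerivWithinAt)
    rw [slope_def_field, R.u_zero, sub_zero, sub_zero, div_le_one h0] at this
    exact this
  · rcases hr.2.eq_or_lt with rfl | h0
    · rw [R.u_a, sub_self]
    have := hconc.le_slope_of_hasDerivWithinAt hr ma h0
      (R.deriv_u_a ▸ (hd R.a ma).hasDerivWithinAt)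
    rw [slope_def_field, R.u_a, le_div_iff₀ (by linarith)] at this
    linarith

end RotSymMetric

namespace WarpedMetric

variable (W : WarpedMetric)

/-- The coordinates `(r, θ, ξ)`. -/
def coords : EuclideanSpace ℝ (Fin 3) → S2 × Circle :=
  W.patch (fun x => x 0) (fun x => x 1) fun x => x 2

lemma gram_coords {x : EuclideanSpace ℝ (Fin 3)} (hx : x 0 ∈ Ioo 0 W.a) :
    gram W.g W.coords x = Matrix.diagonal ![Real.exp (2 * W.logPsi (x 0) (x 1)),
      Real.exp (2 * (W.logPsi (x 0) (x 1) + Real.log (W.u (x 0)))),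
      Real.exp (2 * -W.logPsi (x 0) (x 1))] := by
  have hu := W.u_pos _ hx
  ext i j
  rw [coords, W.gram_patch (by fun_prop) (by fun_prop) (by fun_prop) hx]
  have e : Real.exp (2 * (W.logPsi (x 0) (x 1) + Real.log (W.u (x 0)))) =
      Real.exp (2 * W.logPsi (x 0) (x 1)) * W.u (x 0) ^ 2 := by
    rw [mul_add, Real.exp_add, mul_comm 2 (Real.log _), Real.exp_mul (Real.log _),
      Real.exp_log hu]
    norm_num
  simp only [pd_coord]
  rw [e]
  fin_cases i <;> fin_cases j <;> simp

/-- Angular windows of length 2π keep the coordinates injective. Their centres are free, so every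
angle is interior to some window. -/
lemma isLocalParam_coords (c d : ℝ) : IsLocalParam ((𝓡 2).prod (𝓡 1))
    {x | x 0 ∈ Ioo 0 W.a ∧ x 1 ∈ Ioo (c - Real.pi) (c + Real.pi) ∧
      x 2 ∈ Ioo (d - Real.pi) (d + Real.pi)} W.coords where
  isOpen := ((isOpen_Ioo.preimage (by fun_prop)).inter ((isOpen_Ioo.preimage (by fun_prop)).inter
    (isOpen_Ioo.preimage (by fun_prop))))
  contMDiffOn := (W.contMDiff_patch (by fun_prop) (by fun_prop) (by fun_prop)).contMDiffOn
  immersion x hx := by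
    refine injective_of_gram_det_ne_zero W.g ?_
    rw [W.gram_coords hx.1, Matrix.det_diagonal, Fin.prod_univ_three]
    simp [Real.exp_ne_zero]
  injOn x hx y hy h := by
    obtain ⟨h0, h1, h2⟩ := W.patch_eq hx.1 hy.1 h
    refine PiLp.ext fun i => ?_
    fin_cases i
    · exact h0
    · exact eq_of_mem_Ioo_of_eq_add hx.2.1 hy.2.1 h1
    · exact eq_of_mem_Ioo_of_eq_add hx.2.2 hy.2.2 h2

lemma hasDerivAt_logPsi_left (r t : ℝ) :
    HasDerivAt (fun r => W.logPsi r t) (deriv (fun r => W.logPsi r t) r) r := by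
  have h := W.contDiff_logPsi (V := ℝ) contDiff_id (contDiff_const (c := t))
  exact (h.differentiable (by norm_num) r).hasDerivAt

lemma hasDerivAt_logPsi_right (r t : ℝ) :
    HasDerivAt (fun t => W.logPsi r t) (deriv (fun t => W.logPsi r t) t) t := by
  have h := W.contDiff_logPsi (V := ℝ) (contDiff_const (c := r)) contDiff_id
  exact (h.differentiable (by norm_num) t).hasDerivAt

/-- With l = log u one has l'' + (l')² = u''/u. The formula of `scalarCurv_warped`, freed of its
positive factor and multiplied by u², is the claim. -/
lemma curvature_inequality (h : ScalarNonneg 3 W.g) {r : ℝ} (hr : r ∈ Ioo 0 W.a) (t : ℝ) :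
    deriv (fun r => W.logPsi r t) r ^ 2 * W.u r ^ 2 + deriv (fun t => W.logPsi r t) t ^ 2 ≤
      -W.u r * deriv (deriv W.u) r := by
  set x : EuclideanSpace ℝ (Fin 3) := !₂[r, t, 0] with hx
  have hpi := Real.pi_pos
  have hS := h _ _ (W.isLocalParam_coords t 0) x
    ⟨hr, by constructor <;> simp [hx, hpi], by constructor <;> simp [hx, hpi]⟩
  set f : EuclideanSpace ℝ (Fin 3) → ℝ := fun y => W.logPsi (y 0) (y 1) with hf
  set l : EuclideanSpace ℝ (Fin 3) → ℝ := fun y => Real.log (W.u (y 0)) with hl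
  have hfc : ContDiff ℝ ∞ f := W.contDiff_logPsi (by fun_prop) (by fun_prop)
  have hnear : ∀ᶠ y : EuclideanSpace ℝ (Fin 3) in 𝓝 x, y 0 ∈ Ioo 0 W.a :=
    (isOpen_Ioo.preimage (by fun_prop : Continuous fun y : EuclideanSpace ℝ (Fin 3) => y 0)).mem_nhds
      hr
  have hlog : ∀ r ∈ Ioo 0 W.a, HasDerivAt (fun r => Real.log (W.u r)) (deriv W.u r / W.u r) r :=
    fun r hr => (W.hasDerivAt_u hr).log (W.u_pos r hr).ne'
  have hlpd : ∀ i, ∀ᶠ y in 𝓝 x, pd i l y = if i = 0 then deriv W.u (y 0) / W.u (y 0) else 0 :=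
    fun i => by
      filter_upwards [hnear] with y hy
      rw [hl, pd_comp_coord (hlog _ hy).differentiableAt, (hlog _ hy).deriv]
  have hlc : ContDiffAt ℝ 2 l x := by
    have h1 : ContDiffAt ℝ ∞ (fun r => Real.log (W.u r)) (x 0) :=
      (W.contDiffAt_u hr).log (W.u_pos r hr).ne'
    exact (h1.comp x (by fun_prop : ContDiffAt ℝ ∞ (fun y : EuclideanSpace ℝ (Fin 3) => y 0) x)).of_le two_le_infty
  have hfd : ∀ y, DifferentiableAt ℝ f y := fun y => hfc.differentiable (by norm_num) y
  have hf2 : ∀ y, pd 2 f y = 0 := fun y => by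
    rw [pd_eq_deriv (hfd y)]
    simp [hf]
  rw [scalarCurv_warped (hnear.mono fun y hy => W.gram_coords hy)
    (hfc.contDiffAt.of_le two_le_infty) hlc (Filter.Eventually.of_forall hf2)
    ((hlpd 2).mono fun y hy => by simpa using hy)
    ((hlpd 1).mono fun y hy => by simpa using hy)] at hS
  have d0 : pd 0 f x = deriv (fun r => W.logPsi r t) r := by
    rw [pd_eq_deriv (hfd x)]
    have := deriv_comp_const_add (f := fun r => W.logPsi r t) r 0
    simpa [hf, hx] using this
  have d1 : pd 1 f x = deriv (fun t => W.logPsi r t) t := by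
    rw [pd_eq_deriv (hfd x)]
    have := deriv_comp_const_add (f := fun t => W.logPsi r t) t 0
    simpa [hf, hx] using this
  have hu := W.u_pos r hr
  have l0 : pd 0 l x = deriv W.u r / W.u r := by simpa [hx] using (hlpd 0).self_of_nhds
  have l00 : pd 0 (pd 0 l) x =
      (deriv (deriv W.u) r * W.u r - deriv W.u r * deriv W.u r) / W.u r ^ 2 := by
    have e : pd 0 l =ᶠ[𝓝 x] fun y => deriv W.u (y 0) / W.u (y 0) :=
      (hlpd 0).mono fun y hy => by simpa using hy
    have hq := (W.hasDerivAt_deriv_u hr).div (W.hasDerivAt_u hr) hu.ne'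
    rw [pd_congr e, pd_comp_coord (g := fun r => deriv W.u r / W.u r) hq.differentiableAt]
    exact hq.deriv
  have el : Real.exp (-(2 * l x)) = (W.u r ^ 2)⁻¹ := by
    rw [Real.exp_neg, mul_comm, Real.exp_mul, hl, hx]
    simp [Real.exp_log hu]
  rw [d0, d1, l0, l00, el] at hS
  have h2 : 0 ≤ -((deriv (deriv W.u) r * W.u r - deriv W.u r * deriv W.u r) / W.u r ^ 2 +
      (deriv W.u r / W.u r) ^ 2) - deriv (fun r => W.logPsi r t) r ^ 2 -
      deriv (fun t => W.logPsi r t) t ^ 2 * (W.u r ^ 2)⁻¹ :=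
    nonneg_of_mul_nonneg_right hS (by positivity)
  have h3 := mul_nonneg h2 (sq_nonneg (W.u r))
  have h4 : (-((deriv (deriv W.u) r * W.u r - deriv W.u r * deriv W.u r) / W.u r ^ 2 +
      (deriv W.u r / W.u r) ^ 2) - deriv (fun r => W.logPsi r t) r ^ 2 -
      deriv (fun t => W.logPsi r t) t ^ 2 * (W.u r ^ 2)⁻¹) * W.u r ^ 2 =
      -(W.u r * deriv (deriv W.u) r) - deriv (fun r => W.logPsi r t) r ^ 2 * W.u r ^ 2 -
      deriv (fun t => W.logPsi r t) t ^ 2 := by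
    field_simp
    ring
  linarith

lemma isProfile_of_scalarNonneg (h : ScalarNonneg 3 W.g) :
    IsProfile W.a W.u (deriv W.u) (deriv (deriv W.u)) :=
  W.toRotSymMetric.isProfile fun r hr => by
    have h1 := W.curvature_inequality h hr 0
    have hu := W.u_pos r hr
    by_contra! h2
    have h3 := mul_pos hu h2
    nlinarith [sq_nonneg (deriv (fun r => W.logPsi r 0) r * W.u r),
      sq_nonneg (deriv (fun t => W.logPsi r t) 0)]

end WarpedMetric

/-! ### Upper bounds for Riemannian volumes -/

section Pieces

variable {E H : Type} [NormedAddCommGroup E] [NormedSpace ℝ E] [TopologicalSpace H]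
  {I : ModelWithCorners ℝ E H} {M : Type} [TopologicalSpace M] [ChartedSpace H M]
  [IsManifold I ∞ M]

/-- Covers in `riemVol` are sequences, so a finite family is padded by copies of its first piece
with empty carrier; this is why the index type is `Fin (n + 1)`. -/
lemma riemVol_le_sum {k n : ℕ} (g : SmoothMetric I M) {S : Set M} (P : Fin (n + 1) → Piece I M k)
    (hS : S ⊆ ⋃ i, (P i).toFun '' (P i).carrier) : riemVol k g S ≤ ∑ i, (P i).vol g := by
  let Q : ℕ → Piece I M k := fun i => if h : i < n + 1 then P ⟨i, h⟩ else
    { P 0 with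
      carrier := ∅
      measurableSet_carrier := MeasurableSet.empty
      carrier_subset := empty_subset _
      injOn := injOn_empty _ }
  have hQ : ∀ i : Fin (n + 1), Q i = P i := fun i => dif_pos i.2
  have hS' : S ⊆ ⋃ i, (Q i).toFun '' (Q i).carrier := hS.trans <| iUnion_subset fun i => by
    rw [← hQ i]
    exact subset_iUnion (fun i => (Q i).toFun '' (Q i).carrier) (i : ℕ)
  refine (iInf₂_le Q hS').trans ?_
  rw [tsum_eq_sum (s := Finset.range (n + 1)), Finset.sum_range]
  · simp [hQ]
  · intro i hi
    have : ¬ i < n + 1 := by simpa using hi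
    simp only [Q, dif_neg this, Piece.vol, Measure.restrict_empty, lintegral_zero_measure]

lemma volume_box {k : ℕ} (s : Fin k → Set ℝ) :
    volume {x : EuclideanSpace ℝ (Fin k) | ∀ i, x i ∈ s i} = ∏ i, volume (s i) := by
  rw [← volume_pi_pi, ← (EuclideanSpace.volume_preserving_symm_measurableEquiv_toLp
    (Fin k)).measure_preimage_equiv]
  congr 1
  ext x
  simp

lemma measurableSet_box {k : ℕ} {s : Fin k → Set ℝ} (hs : ∀ i, MeasurableSet (s i)) :
    MeasurableSet {x : EuclideanSpace ℝ (Fin k) | ∀ i, x i ∈ s i} := by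
  have : {x : EuclideanSpace ℝ (Fin k) | ∀ i, x i ∈ s i} = ⋂ i, (fun x => x i) ⁻¹' s i := by
    ext x; simp
  rw [this]
  exact MeasurableSet.iInter fun i => (by fun_prop : Measurable fun x : EuclideanSpace ℝ (Fin k) =>
    x i) (hs i)

end Pieces

lemma exists_mem_Ioc_angle (t : ℝ) :
    ∃ t' ∈ Ioc (-Real.pi) Real.pi, ∃ m : ℤ, t' = t + m * (2 * Real.pi) := by
  obtain ⟨m, hm, -⟩ := existsUnique_add_zsmul_mem_Ioc Real.two_pi_pos t (-Real.pi)
  refine ⟨_, ⟨hm.1, hm.2.trans_eq (by ring)⟩, m, by rw [zsmul_eq_mul]⟩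

lemma polarMap_periodic (a r t : ℝ) (m : ℤ) :
    polarMap a !₂[r, t + m * (2 * Real.pi)] = polarMap a !₂[r, t] := by
  apply Subtype.ext
  simp [polarMap]

lemma RotSymMetric.polar_periodic (R : RotSymMetric) (r t : ℝ) (m : ℤ) :
    R.polar !₂[r, t + m * (2 * Real.pi)] = R.polar !₂[r, t] := by
  rw [RotSymMetric.polar, polarMap_periodic, RotSymMetric.polar]

lemma RotSymMetric.exists_mem_Ioc_polar (R : RotSymMetric) (r t : ℝ) :
    ∃ t' ∈ Ioc (-Real.pi) Real.pi, R.polar !₂[r, t'] = R.polar !₂[r, t] := by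
  obtain ⟨t', ht', m, rfl⟩ := exists_mem_Ioc_angle t
  exact ⟨_, ht', R.polar_periodic r t m⟩

lemma exists_mem_Ioc_circle (c : Circle) : ∃ t ∈ Ioc (-Real.pi) Real.pi, Circle.exp t = c :=
  ⟨Complex.arg c, Complex.arg_mem_Ioc c, Circle.exp_arg c⟩

/-! ### Minimal tori over critical latitudes -/

namespace WarpedMetric

variable (W : WarpedMetric)

/-- The torus over the circle of latitude `r = r₀`. -/
def torus (r₀ : ℝ) : Set (S2 × Circle) :=
  ((fun t : ℝ => W.polar !₂[r₀, t]) '' Icc (-Real.pi) Real.pi) ×ˢ univ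

lemma mem_torus (r₀ t : ℝ) (c : Circle) : (W.polar !₂[r₀, t], c) ∈ W.torus r₀ := by
  obtain ⟨t', ht', e⟩ := W.exists_mem_Ioc_polar r₀ t
  exact ⟨⟨t', Ioc_subset_Icc_self ht', e⟩, trivial⟩

/-- The coordinates `(θ, ξ, r - r₀)` around a circle of latitude. -/
def torusCoords (r₀ : ℝ) : EuclideanSpace ℝ (Fin 3) → S2 × Circle :=
  W.patch (fun x => r₀ + x 2) (fun x => x 0) fun x => x 1

lemma exp_two_mul_add_log (f : ℝ) {u : ℝ} (hu : 0 < u) :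
    Real.exp (2 * (f + Real.log u)) = Real.exp (2 * f) * u ^ 2 := by
  rw [mul_add, Real.exp_add, mul_comm 2 (Real.log _), Real.exp_mul (Real.log _), Real.exp_log hu]
  norm_num

/-- Half the logarithms of the metric coefficients in the coordinates `(θ, ξ, r - r₀)`. -/
def torusLog (r₀ : ℝ) : Fin 3 → EuclideanSpace ℝ (Fin 3) → ℝ :=
  ![fun x => W.logPsi (r₀ + x 2) (x 0) + Real.log (W.u (r₀ + x 2)),
    fun x => -W.logPsi (r₀ + x 2) (x 0), fun x => W.logPsi (r₀ + x 2) (x 0)]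

lemma gram_torusCoords (r₀ : ℝ) {x : EuclideanSpace ℝ (Fin 3)} (hx : r₀ + x 2 ∈ Ioo 0 W.a) :
    gram W.g (W.torusCoords r₀) x = Matrix.diagonal fun i => Real.exp (2 * W.torusLog r₀ i x) := by
  have hu := W.u_pos _ hx
  ext i j
  rw [torusCoords, W.gram_patch (by fun_prop) (by fun_prop) (by fun_prop) hx]
  simp only [pd_const_add, pd_coord]
  fin_cases i <;> fin_cases j <;> simp [torusLog, exp_two_mul_add_log, hu]

lemma isLocalParam_torusCoords (r₀ c d : ℝ) : IsLocalParam ((𝓡 2).prod (𝓡 1))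
    {x | r₀ + x 2 ∈ Ioo 0 W.a ∧ x 0 ∈ Ioo (c - Real.pi) (c + Real.pi) ∧
      x 1 ∈ Ioo (d - Real.pi) (d + Real.pi)} (W.torusCoords r₀) where
  isOpen := ((isOpen_Ioo.preimage (by fun_prop)).inter ((isOpen_Ioo.preimage (by fun_prop)).inter
    (isOpen_Ioo.preimage (by fun_prop))))
  contMDiffOn := (W.contMDiff_patch (by fun_prop) (by fun_prop) (by fun_prop)).contMDiffOn
  immersion x hx := by
    refine injective_of_gram_det_ne_zero W.g ?_
    rw [W.gram_torusCoords r₀ hx.1, Matrix.det_diagonal, Fin.prod_univ_three]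
    simp [Real.exp_ne_zero]
  injOn x hx y hy h := by
    obtain ⟨h0, h1, h2⟩ := W.patch_eq hx.1 hy.1 h
    refine PiLp.ext fun i => ?_
    fin_cases i
    · exact eq_of_mem_Ioo_of_eq_add hx.2.1 hy.2.1 h1
    · exact eq_of_mem_Ioo_of_eq_add hx.2.2 hy.2.2 h2
    · exact add_left_cancel h0

/-- The torus over a closed geodesic of latitude is minimal. -/
lemma isClosedMinimalSurface_torus {r₀ : ℝ} (hr : r₀ ∈ Ioo 0 W.a) (hd : deriv W.u r₀ = 0) :
    IsClosedMinimalSurface W.g (W.torus r₀) where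
  nonempty := ⟨_, W.mem_torus r₀ 0 1⟩
  isCompact := by
    refine (isCompact_Icc.image ?_).prod isCompact_univ
    exact W.contMDiff_polar.continuous.comp
      (contDiff_pair (V := ℝ) contDiff_const contDiff_id (n := 0)).continuous
  minimal := by
    rintro ⟨p, c⟩ ⟨⟨t, -, rfl⟩, -⟩
    obtain ⟨d, -, rfl⟩ := exists_mem_Ioc_circle c
    have hpi := Real.pi_pos
    refine ⟨_, _, W.isLocalParam_torusCoords r₀ t d, ⟨!₂[t, d, 0], ?_, ?_⟩, fun x hx => ⟨?_, ?_⟩⟩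
    · simp [hpi, hr.1, hr.2]
    · simp [torusCoords, patch]
    · constructor
      -- Polar coordinates determine the radius, so a point of the torus has r = r₀ whatever its
      -- angle.
      · rintro ⟨⟨t', -, e⟩, -⟩
        have e' : polarMap W.a !₂[r₀, t'] = polarMap W.a !₂[r₀ + x 2, x 0] := W.Ψ.injective e
        have := (polarMap_eq W.a_pos (by simpa using hr) (by simpa using hx.1) e').1
        simpa using this.symm
      · intro h
        have := W.mem_torus r₀ (x 0) (Circle.exp (x 1))
        simpa [torusCoords, patch, h] using this
    · intro h
      have hnear : ∀ᶠ y : EuclideanSpace ℝ (Fin 3) in 𝓝 x, r₀ + y 2 ∈ Ioo 0 W.a :=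
        (isOpen_Ioo.preimage
          (by fun_prop : Continuous fun y : EuclideanSpace ℝ (Fin 3) => r₀ + y 2)).mem_nhds hx.1
      have hf : ContDiff ℝ ∞ fun y : EuclideanSpace ℝ (Fin 3) => W.logPsi (r₀ + y 2) (y 0) :=
        W.contDiff_logPsi (by fun_prop) (by fun_prop)
      have hfd := hf.differentiable (by norm_num) x
      have hl : HasDerivAt (fun z => Real.log (W.u (r₀ + z)))
          (deriv W.u (r₀ + x 2) / W.u (r₀ + x 2)) (x 2) :=
        ((W.hasDerivAt_u hx.1).comp_const_add r₀ (x 2)).log (W.u_pos _ hx.1).ne'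
      have hld : DifferentiableAt ℝ (fun y : EuclideanSpace ℝ (Fin 3) =>
          Real.log (W.u (r₀ + y 2))) x :=
        DifferentiableAt.comp (g := fun z => Real.log (W.u (r₀ + z))) x hl.differentiableAt
          (by fun_prop : DifferentiableAt ℝ (fun y : EuclideanSpace ℝ (Fin 3) => y 2) x)
      refine sliceMeanCurv_of_diagonal (hnear.mono fun y hy => W.gram_torusCoords r₀ hy)
        (fun i => ?_) ?_
      · fin_cases i
        · exact hfd.add hld
        · exact hfd.neg
        · exact hfd
      -- The contributions p from the θ direction and -p from the ξ direction cancel. What remains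
      -- is u'/u, which vanishes at r₀.
      · have e0 : pd 2 (W.torusLog r₀ 0) x = pd 2 (fun y => W.logPsi (r₀ + y 2) (y 0)) x + 0 := by
          refine (pd_add hfd hld 2).trans ?_
          rw [pd_comp_coord (g := fun z => Real.log (W.u (r₀ + z))) hl.differentiableAt, hl.deriv, h]
          simp [hd]
        have e1 : pd 2 (W.torusLog r₀ 1) x = -pd 2 (fun y => W.logPsi (r₀ + y 2) (y 0)) x :=
          pd_neg 2
        rw [e0, e1]
        ring

lemma gram_torus {r₀ : ℝ} (hr : r₀ ∈ Ioo 0 W.a) (x : EuclideanSpace ℝ (Fin 2)) :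
    gram W.g (W.patch (fun _ => r₀) (fun x => x 0) fun x => x 1) x =
      !![Real.exp (2 * W.logPsi r₀ (x 0)) * W.u r₀ ^ 2, 0;
        0, Real.exp (2 * -W.logPsi r₀ (x 0))] := by
  ext i j
  rw [W.gram_patch (by fun_prop) (by fun_prop) (by fun_prop) hr]
  simp only [pd_const, pd_coord]
  fin_cases i <;> fin_cases j <;> simp

/-- The factors φ^{-2} and φ² cancel, so the area of the torus does not depend on φ. -/
lemma det_gram_torus {r₀ : ℝ} (hr : r₀ ∈ Ioo 0 W.a) (x : EuclideanSpace ℝ (Fin 2)) :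
    (gram W.g (W.patch (fun _ => r₀) (fun x => x 0) fun x => x 1) x).det = W.u r₀ ^ 2 := by
  rw [W.gram_torus hr, Matrix.det_fin_two_of, mul_neg, Real.exp_neg]
  field_simp
  ring

/-- A parametrization of the torus over a circle of latitude. -/
def torusPiece {r₀ : ℝ} (hr : r₀ ∈ Ioo 0 W.a) : Piece ((𝓡 2).prod (𝓡 1)) (S2 × Circle) 2 where
  dom := univ
  -- Half-open intervals: the parametrization is injective and still covers the whole torus.
  carrier := {x | ∀ i, x i ∈ Ioc (-Real.pi) Real.pi}
  toFun := W.patch (fun _ => r₀) (fun x => x 0) fun x => x 1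
  isImmersedPatch :=
    { isOpen := isOpen_univ
      contMDiffOn := (W.contMDiff_patch (by fun_prop) (by fun_prop) (by fun_prop)).contMDiffOn
      immersion := fun x _ => injective_of_gram_det_ne_zero W.g <| by
        rw [W.det_gram_torus hr]
        exact pow_ne_zero 2 (W.u_pos _ hr).ne' }
  measurableSet_carrier := measurableSet_box fun _ => measurableSet_Ioc
  carrier_subset := subset_univ _
  injOn x hx y hy h := by
    obtain ⟨-, h1, h2⟩ := W.patch_eq hr hr h
    refine PiLp.ext fun i => ?_
    fin_cases i
    · exact eq_of_mem_Ioc_of_eq_add (hx 0) (hy 0) h1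
    · exact eq_of_mem_Ioc_of_eq_add (hx 1) (hy 1) h2

lemma riemVol_torus_le {r₀ : ℝ} (hr : r₀ ∈ Ioo 0 W.a) :
    riemVol 2 W.g (W.torus r₀) ≤ ENNReal.ofReal (4 * Real.pi ^ 2 * W.u r₀) := by
  have hu := W.u_pos _ hr
  refine (riemVol_le_sum W.g (fun _ : Fin 1 => W.torusPiece hr) ?_).trans ?_
  · rintro ⟨p, c⟩ ⟨⟨t, -, rfl⟩, -⟩
    obtain ⟨t', ht', e⟩ := W.exists_mem_Ioc_polar r₀ t
    obtain ⟨d, hd, rfl⟩ := exists_mem_Ioc_circle c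
    refine mem_iUnion.2 ⟨0, !₂[t', d], fun i => ?_, ?_⟩
    · fin_cases i
      · exact ht'
      · exact hd
    · exact Prod.ext e rfl
  · have hpi := Real.pi_pos
    have e : (W.torusPiece hr).vol W.g = ∫⁻ _ in {x : EuclideanSpace ℝ (Fin 2) | ∀ i, x i ∈
        Ioc (-Real.pi) Real.pi}, ENNReal.ofReal (W.u r₀) := by
      refine lintegral_congr fun x => ?_
      congr 1
      exact (congrArg Real.sqrt (W.det_gram_torus hr x)).trans (Real.sqrt_sq hu.le)
    rw [Fin.sum_univ_one, e, setLIntegral_const, volume_box (k := 2) fun _ => Ioc (-Real.pi) Real.pi]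
    simp only [Real.volume_Ioc, Finset.prod_const, Finset.card_univ, Fintype.card_fin]
    rw [← ENNReal.ofReal_pow (by linarith), ← ENNReal.ofReal_mul hu.le]
    exact ENNReal.ofReal_le_ofReal (le_of_eq (by ring))

/-- A critical point of `u` gives a minimal torus, of area `4π²u`. -/
lemma minA_le_torus {r₀ : ℝ} (hr : r₀ ∈ Ioo 0 W.a) (hd : deriv W.u r₀ = 0) :
    minA W.g ≤ ENNReal.ofReal (4 * Real.pi ^ 2 * W.u r₀) :=
  (iInf₂_le _ (W.isClosedMinimalSurface_torus hr hd)).trans (W.riemVol_torus_le hr)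

end WarpedMetric

/-! ### The spheres `S² × {ξ}` -/

/-- Polar coordinates degenerate at the poles; arguments there use the charts of the manifold. -/
lemma exists_isLocalParam (q : S2) : ∃ (V : Set (EuclideanSpace ℝ (Fin 2)))
    (G : EuclideanSpace ℝ (Fin 2) → S2), IsLocalParam (𝓡 2) V G ∧ q ∈ G '' V := by
  let c := chartAt (EuclideanSpace ℝ (Fin 2)) q
  refine ⟨c.target, c.symm, ⟨⟨c.open_target, contMDiffOn_chart_symm, fun x hx => ?_⟩,
    c.symm.injOn⟩, c q, c.map_source (mem_chart_source _ q), c.left_inv (mem_chart_source _ q)⟩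
  have h1 : MDifferentiableAt (𝓡 2) (𝓡 2) c.symm x :=
    ((contMDiffOn_chart_symm (I := 𝓡 2) (n := ∞) (x := q)).contMDiffAt
      (c.open_target.mem_nhds hx)).mdifferentiableAt (by norm_num)
  have h2 : MDifferentiableAt (𝓡 2) (𝓡 2) c (c.symm x) :=
    ((contMDiffOn_chart (I := 𝓡 2) (n := ∞) (x := q)).contMDiffAt
      (c.open_source.mem_nhds (c.map_target hx))).mdifferentiableAt (by norm_num)
  have h3 : mfderiv (𝓡 2) (𝓡 2) (c ∘ c.symm) x = ContinuousLinearMap.id ℝ _ := by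
    rw [← mfderiv_id]
    refine Filter.EventuallyEq.mfderiv_eq ?_
    filter_upwards [c.open_target.mem_nhds hx] with y hy using c.right_inv hy
  rw [mfderiv_comp x h2 h1] at h3
  refine Function.LeftInverse.injective (g := mfderiv (𝓡 2) (𝓡 2) c (c.symm x)) fun v => ?_
  exact DFunLike.congr_fun h3 v

namespace WarpedMetric

variable (W : WarpedMetric)

/-- The product of a patch of `S²` with the angular coordinate of the circle. -/
def prodCoords (G : EuclideanSpace ℝ (Fin 2) → S2) (x : EuclideanSpace ℝ (Fin 3)) : S2 × Circle :=
  (G !₂[x 0, x 1], Circle.exp (x 2))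

lemma contDiff_coord {k : ℕ} (i : Fin k) :
    ContDiff ℝ ∞ fun x : EuclideanSpace ℝ (Fin k) => x i := by fun_prop

lemma fderiv_coord {k : ℕ} (i : Fin k) (x v : EuclideanSpace ℝ (Fin k)) :
    fderiv ℝ (fun y : EuclideanSpace ℝ (Fin k) => y i) x v = v i := by
  have : fderiv ℝ (fun y : EuclideanSpace ℝ (Fin k) => y i) x =
      (EuclideanSpace.proj i : EuclideanSpace ℝ (Fin k) →L[ℝ] ℝ) :=
    (EuclideanSpace.proj i : EuclideanSpace ℝ (Fin k) →L[ℝ] ℝ).fderiv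
  rw [this]
  rfl

lemma inner_prodCoords {G : EuclideanSpace ℝ (Fin 2) → S2} {x : EuclideanSpace ℝ (Fin 3)}
    (hG : MDifferentiableAt (𝓡 2) (𝓡 2) G !₂[x 0, x 1]) (v w : EuclideanSpace ℝ (Fin 3)) :
    W.g.inner (prodCoords G x)
      (mfderiv (𝓡 3) ((𝓡 2).prod (𝓡 1)) (prodCoords G) x v)
      (mfderiv (𝓡 3) ((𝓡 2).prod (𝓡 1)) (prodCoords G) x w) =
    (W.φ (G !₂[x 0, x 1]) ^ 2)⁻¹ * W.h.inner (G !₂[x 0, x 1])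
        (mfderiv (𝓡 2) (𝓡 2) G !₂[x 0, x 1] (!₂[v 0, v 1] : EuclideanSpace ℝ (Fin 2)))
        (mfderiv (𝓡 2) (𝓡 2) G !₂[x 0, x 1] (!₂[w 0, w 1] : EuclideanSpace ℝ (Fin 2))) +
      W.φ (G !₂[x 0, x 1]) ^ 2 * (v 2 * w 2) := by
  have hq : DifferentiableAt ℝ (fun x : EuclideanSpace ℝ (Fin 3) =>
      (!₂[x 0, x 1] : EuclideanSpace ℝ (Fin 2))) x :=
    (contDiff_pair (contDiff_coord 0) (contDiff_coord 1)).differentiable (by norm_num) x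
  have hF : MDifferentiableAt (𝓡 3) (𝓡 2) (fun x : EuclideanSpace ℝ (Fin 3) => G !₂[x 0, x 1]) x :=
    hG.comp x hq.mdifferentiableAt
  have := W.inner_mfderiv hF ((contDiff_coord 2).differentiable (by norm_num) x) v w
  rw [mfderiv_comp_pair hG (contDiff_coord 0) (contDiff_coord 1),
    mfderiv_comp_pair hG (contDiff_coord 0) (contDiff_coord 1)] at this
  simp only [fderiv_coord] at this
  exact this

lemma isLocalParam_prodCoords (W : WarpedMetric) {V : Set (EuclideanSpace ℝ (Fin 2))}
    {G : EuclideanSpace ℝ (Fin 2) → S2} (hG : IsLocalParam (𝓡 2) V G) :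
    IsLocalParam ((𝓡 2).prod (𝓡 1)) {x : EuclideanSpace ℝ (Fin 3) |
      (!₂[x 0, x 1] : EuclideanSpace ℝ (Fin 2)) ∈ V ∧ x 2 ∈ Ioo (-Real.pi) Real.pi}
      (prodCoords G) where
  isOpen := (hG.isOpen.preimage
    (contDiff_pair (contDiff_coord 0) (contDiff_coord 1)).continuous).inter
      (isOpen_Ioo.preimage (by fun_prop))
  contMDiffOn := by
    refine ContMDiffOn.prodMk ?_ ?_
    · exact hG.contMDiffOn.comp
        (contDiff_pair (contDiff_coord 0) (contDiff_coord 1)).contMDiff.contMDiffOn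
        fun x hx => hx.1
    · exact (contMDiff_circleExp.comp (contDiff_coord 2).contMDiff).contMDiffOn
  immersion x hx := by
    have hGd : MDifferentiableAt (𝓡 2) (𝓡 2) G !₂[x 0, x 1] :=
      (hG.contMDiffOn.contMDiffAt (hG.isOpen.mem_nhds hx.1)).mdifferentiableAt (by norm_num)
    refine (injective_iff_map_eq_zero
      (mfderiv (𝓡 3) ((𝓡 2).prod (𝓡 1)) (prodCoords G) x)).2
      fun (v : EuclideanSpace ℝ (Fin 3)) hv => ?_
    -- The squared length of the image of `v` is a sum of two nonnegative terms, so both vanish when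
    -- the image does.
    have h := W.inner_prodCoords hGd v v
    rw [hv, map_zero] at h
    have hφ := W.φ_pos (G !₂[x 0, x 1])
    set w := mfderiv (𝓡 2) (𝓡 2) G !₂[x 0, x 1] (!₂[v 0, v 1] : EuclideanSpace ℝ (Fin 2)) with hw
    have hz : w = 0 := by
      by_contra hne
      have h1 := W.h.pos _ w hne
      have h2 : 0 < (W.φ (G !₂[x 0, x 1]) ^ 2)⁻¹ * W.h.inner (G !₂[x 0, x 1]) w w +
        W.φ (G !₂[x 0, x 1]) ^ 2 * (v 2 * v 2) :=
        add_pos_of_pos_of_nonneg (by positivity)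
          (mul_nonneg (by positivity) (mul_self_nonneg _))
      exact h2.ne h
    have h3 : v 2 = 0 := by
      rw [hz, map_zero, mul_zero, zero_add] at h
      simpa [hφ.ne'] using h
    have h4 : (!₂[v 0, v 1] : EuclideanSpace ℝ (Fin 2)) = 0 :=
      hG.immersion _ hx.1 (hz.trans (map_zero _).symm)
    refine PiLp.ext fun i => ?_
    fin_cases i
    · exact congrArg (fun z : EuclideanSpace ℝ (Fin 2) => z 0) h4
    · exact congrArg (fun z : EuclideanSpace ℝ (Fin 2) => z 1) h4
    · exact h3
  injOn x hx y hy h := by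
    have h4 := hG.injOn hx.1 hy.1 (congrArg Prod.fst h)
    have h5 := Circle.exp_eq_exp.1 (congrArg Prod.snd h)
    refine PiLp.ext fun i => ?_
    fin_cases i
    · exact congrArg (fun z : EuclideanSpace ℝ (Fin 2) => z 0) h4
    · exact congrArg (fun z : EuclideanSpace ℝ (Fin 2) => z 1) h4
    · exact eq_of_mem_Ioc_of_eq_add (Ioo_subset_Ioc_self hx.2) (Ioo_subset_Ioc_self hy.2) h5

/-- No differentiability is assumed: where it fails, `fderiv` takes the value 0. This spares a proof
that the Gram entries in a general chart are smooth. -/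
lemma pd_eq_zero_of_const {k : ℕ} {f : EuclideanSpace ℝ (Fin k) → ℝ} {i : Fin k}
    {x : EuclideanSpace ℝ (Fin k)}
    (h : ∀ᶠ s : ℝ in 𝓝 0, f (x + s • EuclideanSpace.single i 1) = f x) : pd i f x = 0 := by
  by_cases hf : DifferentiableAt ℝ f x
  · rw [pd_eq_deriv hf, Filter.EventuallyEq.deriv_eq (f := fun _ => f x) h, deriv_const]
  · rw [pd, fderiv_zero_of_not_differentiableAt hf]
    rfl

lemma gram_prodCoords_castSucc {G : EuclideanSpace ℝ (Fin 2) → S2} {x : EuclideanSpace ℝ (Fin 3)}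
    (hG : MDifferentiableAt (𝓡 2) (𝓡 2) G !₂[x 0, x 1]) (i j : Fin 2) :
    gram W.g (prodCoords G) x (Fin.castSucc i) (Fin.castSucc j) =
      (W.φ (G !₂[x 0, x 1]) ^ 2)⁻¹ * gram W.h G !₂[x 0, x 1] i j := by
  have e : ∀ i : Fin 2, (!₂[(EuclideanSpace.single (Fin.castSucc i) (1 : ℝ) :
      EuclideanSpace ℝ (Fin 3)) 0, (EuclideanSpace.single (Fin.castSucc i) (1 : ℝ) :
      EuclideanSpace ℝ (Fin 3)) 1] : EuclideanSpace ℝ (Fin 2)) = EuclideanSpace.single i 1 :=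
    fun i => by ext j; fin_cases i <;> fin_cases j <;> simp
  have h := W.inner_prodCoords hG (EuclideanSpace.single (Fin.castSucc i) 1)
    (EuclideanSpace.single (Fin.castSucc j) 1)
  rw [e, e] at h
  refine h.trans ?_
  have : (EuclideanSpace.single (Fin.castSucc i) (1 : ℝ) : EuclideanSpace ℝ (Fin 3)) 2 = 0 := by
    fin_cases i <;> simp
  rw [this, zero_mul, mul_zero, add_zero]
  rfl

lemma gram_prodCoords_last {G : EuclideanSpace ℝ (Fin 2) → S2} {x : EuclideanSpace ℝ (Fin 3)}
    (hG : MDifferentiableAt (𝓡 2) (𝓡 2) G !₂[x 0, x 1]) (i : Fin 2) :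
    gram W.g (prodCoords G) x (Fin.castSucc i) 2 = 0 ∧
      gram W.g (prodCoords G) x 2 (Fin.castSucc i) = 0 := by
  have e : mfderiv (𝓡 2) (𝓡 2) G !₂[x 0, x 1] (!₂[(EuclideanSpace.single 2 (1 : ℝ) :
      EuclideanSpace ℝ (Fin 3)) 0, (EuclideanSpace.single 2 (1 : ℝ) :
      EuclideanSpace ℝ (Fin 3)) 1] : EuclideanSpace ℝ (Fin 2)) = 0 := by
    have : (!₂[(EuclideanSpace.single 2 (1 : ℝ) : EuclideanSpace ℝ (Fin 3)) 0,
        (EuclideanSpace.single 2 (1 : ℝ) : EuclideanSpace ℝ (Fin 3)) 1] :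
        EuclideanSpace ℝ (Fin 2)) = 0 := by
      ext j; fin_cases j <;> simp
    rw [this]
    exact map_zero (mfderiv (𝓡 2) (𝓡 2) G !₂[x 0, x 1])
  have h2 : (EuclideanSpace.single (Fin.castSucc i) (1 : ℝ) : EuclideanSpace ℝ (Fin 3)) 2 = 0 := by
    fin_cases i <;> simp
  constructor
  · refine (W.inner_prodCoords hG _ _).trans ?_
    rw [e, map_zero, h2, zero_mul, mul_zero, mul_zero, add_zero]
  · refine (W.inner_prodCoords hG _ _).trans ?_
    rw [e, map_zero, zero_apply, h2, mul_zero, mul_zero, mul_zero, add_zero]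

/-- The spheres `S² × {ξ}` are minimal. -/
lemma isClosedMinimalSurface_sphere : IsClosedMinimalSurface W.g (univ ×ˢ {1}) where
  nonempty := ⟨(W.polar 0, 1), trivial, rfl⟩
  isCompact := isCompact_univ.prod isCompact_singleton
  minimal := by
    rintro ⟨q, c⟩ ⟨-, rfl⟩
    obtain ⟨V, G, hG, y, hy, rfl⟩ := exists_isLocalParam q
    have hpi := Real.pi_pos
    have hP := W.isLocalParam_prodCoords hG
    have hy' : (!₂[y 0, y 1] : EuclideanSpace ℝ (Fin 2)) = y := by
      ext i; fin_cases i <;> rfl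
    refine ⟨_, _, hP, ⟨!₂[y 0, y 1, 0], ?_, ?_⟩, fun x hx => ⟨⟨fun h => ?_, fun h => ?_⟩, fun h => ?_⟩⟩
    · simpa [hpi, hy'] using hy
    · simp [prodCoords, hy']
    · have h1 : Circle.exp (x 2) = Circle.exp 0 := by rw [Circle.exp_zero]; exact h.2
      exact eq_of_mem_Ioc_of_eq_add (Ioo_subset_Ioc_self hx.2)
        ⟨by linarith, hpi.le⟩ (Circle.exp_eq_exp.1 h1)
    · exact ⟨trivial, by simp [prodCoords, h]⟩
    · have hGd : ∀ z ∈ {x : EuclideanSpace ℝ (Fin 3) |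
          (!₂[x 0, x 1] : EuclideanSpace ℝ (Fin 2)) ∈ V ∧ x 2 ∈ Ioo (-Real.pi) Real.pi},
          MDifferentiableAt (𝓡 2) (𝓡 2) G !₂[z 0, z 1] := fun z hz =>
        (hG.contMDiffOn.contMDiffAt (hG.isOpen.mem_nhds hz.1)).mdifferentiableAt (by norm_num)
      refine sliceMeanCurv_of_product (fun i => ?_) fun i j => ?_
      · filter_upwards [hP.isOpen.mem_nhds hx] with z hz
        exact W.gram_prodCoords_last (hGd z hz) i
      · have hev : ∀ᶠ s : ℝ in 𝓝 0, x + s • EuclideanSpace.single 2 (1 : ℝ) ∈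
            {x : EuclideanSpace ℝ (Fin 3) |
          (!₂[x 0, x 1] : EuclideanSpace ℝ (Fin 2)) ∈ V ∧ x 2 ∈ Ioo (-Real.pi) Real.pi} :=
          (hP.isOpen.preimage (by fun_prop : Continuous fun s : ℝ =>
            x + s • EuclideanSpace.single 2 (1 : ℝ))).mem_nhds (by simpa using hx)
        refine pd_eq_zero_of_const ?_
        filter_upwards [hev] with s hs
        have e : (!₂[(x + s • EuclideanSpace.single 2 (1 : ℝ) : EuclideanSpace ℝ (Fin 3)) 0,
            (x + s • EuclideanSpace.single 2 (1 : ℝ) : EuclideanSpace ℝ (Fin 3)) 1] :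
            EuclideanSpace ℝ (Fin 2)) = !₂[x 0, x 1] := by
          simp
        rw [W.gram_prodCoords_castSucc (hGd _ hs), W.gram_prodCoords_castSucc (hGd _ hx), e]

end WarpedMetric

/-! ### The area of the spheres `S² × {ξ}` -/

lemma setLIntegral_box {A B : Set ℝ} (hA : MeasurableSet A) (hB : MeasurableSet B) {g : ℝ → ℝ≥0∞}
    (hg : Measurable g) :
    ∫⁻ x in {x : EuclideanSpace ℝ (Fin 2) | x 0 ∈ A ∧ x 1 ∈ B}, g (x 0) =
      (∫⁻ r in A, g r) * volume B := by
  have h1 : MeasurePreserving (fun x : EuclideanSpace ℝ (Fin 2) => (x 0, x 1)) volume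
      (volume.prod volume) :=
    (volume_preserving_finTwoArrow ℝ).comp (PiLp.volume_preserving_ofLp (Fin 2))
  have h2 : ∫⁻ x in {x : EuclideanSpace ℝ (Fin 2) | x 0 ∈ A ∧ x 1 ∈ B}, g (x 0) =
      ∫⁻ z in A ×ˢ B, g z.1 ∂(volume.prod volume) :=
    h1.setLIntegral_comp_preimage (hA.prod hB) (hg.comp measurable_fst)
  have h3 := lintegral_prod_mul (μ := volume.restrict A) (ν := volume.restrict B) hg.aemeasurable
    (aemeasurable_const (b := (1 : ℝ≥0∞)))
  simp only [mul_one, lintegral_const, Measure.restrict_apply_univ, one_mul] at h3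
  rw [h2, ← Measure.prod_restrict, h3]

/-- As 5/8 < 1, each summand is integrable and contributes a^{5/8} · (8/3) a^{3/8} = (8/3) a. -/
lemma lintegral_weight_le {a : ℝ} (ha : 0 < a) :
    ∫⁻ r in Ioo 0 a, ENNReal.ofReal ((a / r) ^ (5 / 8 : ℝ) + (a / (a - r)) ^ (5 / 8 : ℝ)) ≤
      ENNReal.ofReal (16 / 3 * a) := by
  have h1 : IntervalIntegrable (fun r : ℝ => r ^ (-(5 / 8) : ℝ)) volume 0 a :=
    intervalIntegral.intervalIntegrable_rpow' (by norm_num)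
  have h2 : IntervalIntegrable (fun r : ℝ => (a - r) ^ (-(5 / 8) : ℝ)) volume 0 a := by
    simpa using (h1.comp_sub_left a).symm
  have v1 : ∫ r in (0 : ℝ)..a, r ^ (-(5 / 8) : ℝ) = 8 / 3 * a ^ (3 / 8 : ℝ) := by
    rw [integral_rpow (Or.inl (by norm_num))]
    norm_num
    ring
  have v2 : ∫ r in (0 : ℝ)..a, (a - r) ^ (-(5 / 8) : ℝ) = 8 / 3 * a ^ (3 / 8 : ℝ) := by
    rw [intervalIntegral.integral_comp_sub_left (fun r : ℝ => r ^ (-(5 / 8) : ℝ)) a]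
    simpa using v1
  have h3 := (h1.add h2).const_mul (a ^ (5 / 8 : ℝ))
  have v3 : ∫ r in (0 : ℝ)..a, a ^ (5 / 8 : ℝ) * (r ^ (-(5 / 8) : ℝ) + (a - r) ^ (-(5 / 8) : ℝ)) =
      16 / 3 * a := by
    rw [intervalIntegral.integral_const_mul, intervalIntegral.integral_add h1 h2, v1, v2]
    have : a ^ (5 / 8 : ℝ) * a ^ (3 / 8 : ℝ) = a := by
      rw [← Real.rpow_add ha]; norm_num
    linear_combination (16 / 3) * this
  have e : ∀ r ∈ Ioo 0 a, (a / r) ^ (5 / 8 : ℝ) + (a / (a - r)) ^ (5 / 8 : ℝ) =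
      a ^ (5 / 8 : ℝ) * (r ^ (-(5 / 8) : ℝ) + (a - r) ^ (-(5 / 8) : ℝ)) := fun r hr => by
    have h0 : 0 < r := hr.1
    have h0' : 0 < a - r := by linarith [hr.2]
    rw [Real.div_rpow ha.le h0.le, Real.div_rpow ha.le h0'.le, Real.rpow_neg h0.le,
      Real.rpow_neg h0'.le]
    ring
  rw [setLIntegral_congr_fun measurableSet_Ioo fun r hr => congrArg ENNReal.ofReal (e r hr),
    ← ofReal_integral_eq_lintegral_ofReal, ← integral_Ioc_eq_integral_Ioo,
    ← intervalIntegral.integral_of_le ha.le, v3]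
  · exact ((intervalIntegrable_iff_integrableOn_Ioc_of_le ha.le).1 h3).mono_set Ioo_subset_Ioc_self
  · filter_upwards [ae_restrict_mem measurableSet_Ioo] with r hr
    have h0 : 0 < r := hr.1
    have h0' : 0 < a - r := by linarith [hr.2]
    positivity

/-- The horizontal coordinate of a point of the round sphere as a complex number. -/
def horiz (q : S2) : ℂ := ⟨(q : EuclideanSpace ℝ (Fin 3)) 0, (q : EuclideanSpace ℝ (Fin 3)) 1⟩

lemma norm_horiz (q : S2) : ‖horiz q‖ ^ 2 = 1 - (q : EuclideanSpace ℝ (Fin 3)) 2 ^ 2 := by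
  have h := q.2
  simp only [mem_sphere_iff_norm, sub_zero, EuclideanSpace.norm_eq, Real.sqrt_eq_one,
    Real.norm_eq_abs, sq_abs, Fin.sum_univ_three] at h
  rw [Complex.sq_norm, Complex.normSq_apply, horiz]
  linarith

/-- An explicit right inverse of the polar map. It is valid at the poles too, where the sine
vanishes and the value of `Complex.arg` is irrelevant. -/
lemma polarMap_arccos_arg {a : ℝ} (ha : 0 < a) (q : S2) :
    polarMap a !₂[a / Real.pi * Real.arccos ((q : EuclideanSpace ℝ (Fin 3)) 2),
      Complex.arg (horiz q)] = q := by
  have hn := norm_horiz q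
  have hpi := Real.pi_pos
  have h1 : -1 ≤ (q : EuclideanSpace ℝ (Fin 3)) 2 := by nlinarith [sq_nonneg ‖horiz q‖]
  have h2 : (q : EuclideanSpace ℝ (Fin 3)) 2 ≤ 1 := by nlinarith [sq_nonneg ‖horiz q‖]
  have e : Real.pi * (a / Real.pi * Real.arccos ((q : EuclideanSpace ℝ (Fin 3)) 2)) / a =
      Real.arccos ((q : EuclideanSpace ℝ (Fin 3)) 2) := by
    field_simp
  have hs : Real.sin (Real.arccos ((q : EuclideanSpace ℝ (Fin 3)) 2)) = ‖horiz q‖ := by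
    rw [Real.sin_arccos, ← hn, Real.sqrt_sq (norm_nonneg _)]
  apply Subtype.ext
  ext i
  fin_cases i
  · simp only [polarMap]
    simp only [Fin.zero_eta, Matrix.cons_val, e, hs, Complex.norm_mul_cos_arg]
    rfl
  · simp only [polarMap]
    simp only [Fin.mk_one, Matrix.cons_val, e, hs, Complex.norm_mul_sin_arg]
    rfl
  · simp only [polarMap]
    simp [e, Real.cos_arccos h1 h2]

lemma exists_polarMap_eq {a : ℝ} (ha : 0 < a) (q : S2) :
    ∃ r ∈ Icc 0 a, ∃ t, polarMap a !₂[r, t] = q := by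
  have hpi := Real.pi_pos
  refine ⟨_, ⟨?_, ?_⟩, _, polarMap_arccos_arg ha q⟩
  · have := Real.arccos_nonneg ((q : EuclideanSpace ℝ (Fin 3)) 2)
    positivity
  · calc a / Real.pi * Real.arccos ((q : EuclideanSpace ℝ (Fin 3)) 2) ≤ a / Real.pi * Real.pi := by
          gcongr; exact Real.arccos_le_pi _
      _ = a := by field_simp

lemma polarMap_zero {a : ℝ} (t s : ℝ) : polarMap a !₂[0, t] = polarMap a !₂[0, s] := by
  apply Subtype.ext
  simp [polarMap]

lemma polarMap_right {a : ℝ} (ha : 0 < a) (t s : ℝ) :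
    polarMap a !₂[a, t] = polarMap a !₂[a, s] := by
  apply Subtype.ext
  simp [polarMap, ha.ne']

namespace WarpedMetric

variable (W : WarpedMetric)

lemma gram_sphere {x : EuclideanSpace ℝ (Fin 2)} (hx : x 0 ∈ Ioo 0 W.a) :
    gram W.g (W.patch (fun x => x 0) (fun x => x 1) fun _ => 0) x =
      !![Real.exp (2 * W.logPsi (x 0) (x 1)), 0;
        0, Real.exp (2 * W.logPsi (x 0) (x 1)) * W.u (x 0) ^ 2] := by
  ext i j
  rw [W.gram_patch (by fun_prop) (by fun_prop) (by fun_prop) hx]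
  simp only [pd_const, pd_coord]
  fin_cases i <;> fin_cases j <;> simp

lemma det_gram_sphere {x : EuclideanSpace ℝ (Fin 2)} (hx : x 0 ∈ Ioo 0 W.a) :
    (gram W.g (W.patch (fun x => x 0) (fun x => x 1) fun _ => 0) x).det =
      (Real.exp (2 * W.logPsi (x 0) (x 1)) * W.u (x 0)) ^ 2 := by
  rw [W.gram_sphere hx, Matrix.det_fin_two_of]
  ring

/-- The parametrization of the complement of the poles by polar coordinates. -/
def spherePiece : Piece ((𝓡 2).prod (𝓡 1)) (S2 × Circle) 2 where
  dom := {x | x 0 ∈ Ioo 0 W.a}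
  carrier := {x | x 0 ∈ Ioo 0 W.a ∧ x 1 ∈ Ioc (-Real.pi) Real.pi}
  toFun := W.patch (fun x => x 0) (fun x => x 1) fun _ => 0
  isImmersedPatch :=
    { isOpen := isOpen_Ioo.preimage (by fun_prop)
      contMDiffOn := (W.contMDiff_patch (by fun_prop) (by fun_prop) (by fun_prop)).contMDiffOn
      immersion := fun x hx => injective_of_gram_det_ne_zero W.g <| by
        rw [W.det_gram_sphere hx]
        exact pow_ne_zero 2 (mul_pos (Real.exp_pos _) (W.u_pos _ hx)).ne' }
  measurableSet_carrier :=
    (measurableSet_Ioo.preimage (by fun_prop)).inter (measurableSet_Ioc.preimage (by fun_prop))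
  carrier_subset := fun x hx => hx.1
  injOn x hx y hy h := by
    obtain ⟨h0, h1, -⟩ := W.patch_eq hx.1 hy.1 h
    refine PiLp.ext fun i => ?_
    fin_cases i
    · exact h0
    · exact eq_of_mem_Ioc_of_eq_add hx.2 hy.2 h1

lemma vol_spherePiece : W.spherePiece.vol W.g =
    ∫⁻ x in {x : EuclideanSpace ℝ (Fin 2) | x 0 ∈ Ioo 0 W.a ∧ x 1 ∈ Ioc (-Real.pi) Real.pi},
      ENNReal.ofReal (Real.exp (2 * W.logPsi (x 0) (x 1)) * W.u (x 0)) := by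
  refine setLIntegral_congr_fun W.spherePiece.measurableSet_carrier fun x hx => ?_
  refine congrArg ENNReal.ofReal ?_
  exact (congrArg Real.sqrt (W.det_gram_sphere hx.1)).trans
    (Real.sqrt_sq (mul_pos (Real.exp_pos _) (W.u_pos _ hx.1)).le)

/-- Points are covered by pieces of area zero. -/
lemma exists_pointPiece (q : S2) : ∃ P : Piece ((𝓡 2).prod (𝓡 1)) (S2 × Circle) 2,
    ((q, 1) : S2 × Circle) ∈ P.toFun '' P.carrier ∧ P.vol W.g = 0 := by
  obtain ⟨V, G, hG, y, hy, rfl⟩ := exists_isLocalParam q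
  refine ⟨{ dom := V
            carrier := {y}
            toFun := fun x => (G x, Circle.exp 0)
            isImmersedPatch := ⟨hG.isOpen, hG.contMDiffOn.prodMk contMDiffOn_const, fun x hx => ?_⟩
            measurableSet_carrier := measurableSet_singleton y
            carrier_subset := singleton_subset_iff.2 hy
            injOn := injOn_singleton _ _ }, ⟨y, rfl, by simp⟩, ?_⟩
  · have hGd : MDifferentiableAt (𝓡 2) (𝓡 2) G x :=
      (hG.contMDiffOn.contMDiffAt (hG.isOpen.mem_nhds hx)).mdifferentiableAt (by norm_num)
    refine (injective_iff_map_eq_zero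
      (mfderiv (𝓡 2) ((𝓡 2).prod (𝓡 1)) (fun x => (G x, Circle.exp 0)) x)).2
      fun (v : EuclideanSpace ℝ (Fin 2)) hv => ?_
    have h := W.inner_mfderiv hGd (differentiableAt_const (0 : ℝ)) v v
    rw [hv, map_zero, fderiv_fun_const] at h
    have hz : mfderiv (𝓡 2) (𝓡 2) G x v = 0 := by
      by_contra hne
      have h1 := W.h.pos _ _ hne
      have hφ := W.φ_pos (G x)
      have h2 := mul_pos (inv_pos.2 (pow_pos hφ 2)) h1
      refine h2.ne ?_
      simpa using h
    exact hG.immersion _ hx (hz.trans (map_zero _).symm)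
  · exact setLIntegral_measure_zero _ _ (measure_singleton y)

/-- The sphere over ξ = 0 is covered by the polar piece and by two one-point pieces of area zero at
the poles. -/
lemma minA_le_sphere : minA W.g ≤
    ∫⁻ x in {x : EuclideanSpace ℝ (Fin 2) | x 0 ∈ Ioo 0 W.a ∧ x 1 ∈ Ioc (-Real.pi) Real.pi},
      ENNReal.ofReal (Real.exp (2 * W.logPsi (x 0) (x 1)) * W.u (x 0)) := by
  refine (iInf₂_le _ W.isClosedMinimalSurface_sphere).trans ?_
  obtain ⟨P₁, h₁, v₁⟩ := W.exists_pointPiece (W.polar !₂[0, 0])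
  obtain ⟨P₂, h₂, v₂⟩ := W.exists_pointPiece (W.polar !₂[W.a, 0])
  refine (riemVol_le_sum W.g ![W.spherePiece, P₁, P₂] ?_).trans ?_
  · rintro ⟨q, c⟩ ⟨-, rfl⟩
    obtain ⟨r, hr, t, e⟩ := exists_polarMap_eq W.a_pos (W.Ψ.symm q)
    have e' : W.polar !₂[r, t] = q := by rw [RotSymMetric.polar, e]; simp
    rcases hr.1.eq_or_lt with rfl | h0
    · have : W.polar !₂[0, 0] = q := by
        rw [← e', RotSymMetric.polar, polarMap_zero 0 t]; rfl
      exact mem_iUnion.2 ⟨1, this ▸ h₁⟩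
    rcases hr.2.eq_or_lt with rfl | h1
    · have : W.polar !₂[W.a, 0] = q := by
        rw [← e', RotSymMetric.polar, polarMap_right W.a_pos 0 t]; rfl
      exact mem_iUnion.2 ⟨2, this ▸ h₂⟩
    · obtain ⟨t', ht', e''⟩ := W.exists_mem_Ioc_polar r t
      refine mem_iUnion.2 ⟨0, !₂[r, t'], ⟨⟨h0, h1⟩, ht'⟩, ?_⟩
      exact Prod.ext (e''.trans e') Circle.exp_zero
  · rw [Fin.sum_univ_three]
    change W.spherePiece.vol W.g + P₁.vol W.g + P₂.vol W.g ≤ _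
    rw [v₁, v₂, add_zero, add_zero, vol_spherePiece]

end WarpedMetric

/-! ### Change of variables and lower bounds for the Riemannian volume -/

section General

variable {E H : Type} [NormedAddCommGroup E] [NormedSpace ℝ E] [TopologicalSpace H]
  {I : ModelWithCorners ℝ E H} {M : Type} [TopologicalSpace M] [ChartedSpace H M]
  [IsManifold I ∞ M]

/-- The tangent spaces at equal points are different types until the equality is substituted.
Stating the maps with values in the model space `E` makes both equalities substitutable. -/
lemma inner_congr {k : ℕ} (g : SmoothMetric I M) {p q : M} (hpq : p = q)
    {A B : EuclideanSpace ℝ (Fin k) →L[ℝ] E} (hAB : A = B) (v w : EuclideanSpace ℝ (Fin k)) :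
    g.inner p (A v : TangentSpace I p) (A w : TangentSpace I p) =
      g.inner q (B v : TangentSpace I q) (B w : TangentSpace I q) := by
  subst hpq hAB
  rfl

lemma gram_congr {k : ℕ} (g : SmoothMetric I M) {F F' : EuclideanSpace ℝ (Fin k) → M}
    {x : EuclideanSpace ℝ (Fin k)} (h : F =ᶠ[𝓝 x] F') : gram g F x = gram g F' x := by
  ext i j
  exact inner_congr g h.eq_of_nhds h.mfderiv_eq _ _

lemma gram_comp {k n : ℕ} (g : SmoothMetric I M) {G : EuclideanSpace ℝ (Fin n) → M}
    {T : EuclideanSpace ℝ (Fin k) → EuclideanSpace ℝ (Fin n)} {x : EuclideanSpace ℝ (Fin k)}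
    (hG : MDifferentiableAt (𝓡 n) I G (T x)) (hT : DifferentiableAt ℝ T x) :
    gram g (G ∘ T) x =
      (Matrix.of fun i j => fderiv ℝ T x (EuclideanSpace.single j 1) i).transpose *
        gram g G (T x) * Matrix.of fun i j => fderiv ℝ T x (EuclideanSpace.single j 1) i := by
  ext i j
  have e : ∀ v : EuclideanSpace ℝ (Fin k), mfderiv (𝓡 k) I (G ∘ T) x v =
      mfderiv (𝓡 n) I G (T x) (fderiv ℝ T x v) := fun v => by
    refine (mfderiv_comp_apply x hG hT.mdifferentiableAt v).trans ?_
    rw [mfderiv_eq_fderiv]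
    rfl
  rw [gram, Matrix.of_apply, e, e]
  refine (gram_apply g G (T x) _ _).trans ?_
  simp only [Matrix.mul_apply, Matrix.transpose_apply, Matrix.of_apply, Finset.sum_mul]
  rw [Finset.sum_comm]
  exact Finset.sum_congr rfl fun a _ => Finset.sum_congr rfl fun b _ => by ring

lemma det_fderiv_eq {n : ℕ} {T : EuclideanSpace ℝ (Fin n) → EuclideanSpace ℝ (Fin n)}
    {x : EuclideanSpace ℝ (Fin n)} :
    (Matrix.of fun i j => fderiv ℝ T x (EuclideanSpace.single j 1) i).det =
      (fderiv ℝ T x).det := by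
  rw [ContinuousLinearMap.det,
    ← LinearMap.det_toMatrix (EuclideanSpace.basisFun (Fin n) ℝ).toBasis]
  congr 1

/-- The Gram matrix transforms as JᵀGJ, so the volume element is multiplied by |det J|. -/
lemma sqrt_det_gram_comp {n : ℕ} (g : SmoothMetric I M) {F G : EuclideanSpace ℝ (Fin n) → M}
    {T : EuclideanSpace ℝ (Fin n) → EuclideanSpace ℝ (Fin n)} {x : EuclideanSpace ℝ (Fin n)}
    (hF : F =ᶠ[𝓝 x] G ∘ T) (hG : MDifferentiableAt (𝓡 n) I G (T x))
    (hT : DifferentiableAt ℝ T x) :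
    √(gram g F x).det = |(fderiv ℝ T x).det| * √(gram g G (T x)).det := by
  rw [gram_congr g hF, gram_comp g hG hT, Matrix.det_mul, Matrix.det_mul, Matrix.det_transpose,
    det_fderiv_eq, mul_right_comm, Real.sqrt_mul (mul_self_nonneg _), Real.sqrt_mul_self_eq_abs]

/-- If `G` parametrizes an open set diffeomorphically with smooth inverse `Q`, then the Riemannian
volume of any set containing the image is at least the volume computed in the parametrization. -/
lemma setLIntegral_le_riemVol {n : ℕ} (g : SmoothMetric I M) {G : EuclideanSpace ℝ (Fin n) → M}
    {Q : M → EuclideanSpace ℝ (Fin n)} {D : Set (EuclideanSpace ℝ (Fin n))} {O S : Set M}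
    (hO : IsOpen O) (hG : ∀ x ∈ D, MDifferentiableAt (𝓡 n) I G x)
    (hQ : ∀ p ∈ O, MDifferentiableAt I (𝓡 n) Q p) (hQD : MapsTo Q O D) (hGO : MapsTo G D O)
    (hGQ : ∀ p ∈ O, G (Q p) = p) (hQG : ∀ x ∈ D, Q (G x) = x) (hS : O ⊆ S) :
    ∫⁻ x in D, ENNReal.ofReal √(gram g G x).det ≤ riemVol n g S := by
  refine le_iInf₂ fun P hP => ?_
  set C : ℕ → Set (EuclideanSpace ℝ (Fin n)) := fun i =>
    (P i).carrier ∩ ((P i).dom ∩ (P i).toFun ⁻¹' O) with hC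
  have hopen : ∀ i, IsOpen ((P i).dom ∩ (P i).toFun ⁻¹' O) := fun i =>
    (P i).isImmersedPatch.contMDiffOn.continuousOn.isOpen_inter_preimage
      (P i).isImmersedPatch.isOpen hO
  have hdiff : ∀ i, ∀ x ∈ (P i).dom ∩ (P i).toFun ⁻¹' O,
      DifferentiableAt ℝ (Q ∘ (P i).toFun) x := fun i x hx => by
    rw [← mdifferentiableAt_iff_differentiableAt]
    exact (hQ _ hx.2).comp x (((P i).isImmersedPatch.contMDiffOn.contMDiffAt
      ((P i).isImmersedPatch.isOpen.mem_nhds hx.1)).mdifferentiableAt (by norm_num))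
  -- Read through the inverse `Q`, any cover of `S` by pieces covers `D`; countable subadditivity
  -- then reduces the bound to a single piece.
  have hcov : D ⊆ ⋃ i, (Q ∘ (P i).toFun) '' C i := fun x hx => by
    obtain ⟨i, y, hy, e⟩ := mem_iUnion.1 (hP (hS (hGO hx)))
    refine mem_iUnion.2 ⟨i, y, ⟨hy, (P i).carrier_subset hy, ?_⟩, ?_⟩
    · change (P i).toFun y ∈ O
      rw [e]
      exact hGO hx
    · change Q ((P i).toFun y) = x
      rw [e, hQG x hx]
  calc ∫⁻ x in D, ENNReal.ofReal √(gram g G x).det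
      ≤ ∫⁻ x in ⋃ i, (Q ∘ (P i).toFun) '' C i, ENNReal.ofReal √(gram g G x).det :=
        lintegral_mono_set hcov
    _ ≤ ∑' i, ∫⁻ x in (Q ∘ (P i).toFun) '' C i, ENNReal.ofReal √(gram g G x).det :=
        lintegral_iUnion_le _ _
    _ ≤ ∑' i, (P i).vol g := ENNReal.tsum_le_tsum fun i => ?_
  have hinj : InjOn (Q ∘ (P i).toFun) (C i) := fun x hx y hy h => by
    refine (P i).injOn hx.1 hy.1 ?_
    rw [← hGQ _ hx.2.2, ← hGQ _ hy.2.2]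
    exact congrArg G h
  -- The piece equals `G` composed with `Q ∘ (P i).toFun` locally, so the Jacobian in the change of
  -- variables turns the integrand into the volume element of the piece.
  rw [lintegral_image_eq_lintegral_abs_det_fderiv_mul volume
    ((P i).measurableSet_carrier.inter (hopen i).measurableSet)
    (fun x hx => (hdiff i x hx.2).hasFDerivAt.hasFDerivWithinAt) hinj]
  refine le_trans (le_of_eq (setLIntegral_congr_fun
    ((P i).measurableSet_carrier.inter (hopen i).measurableSet) fun x hx => ?_))
    (lintegral_mono_set (s := C i) inter_subset_left)
  have hev : (P i).toFun =ᶠ[𝓝 x] G ∘ (Q ∘ (P i).toFun) := by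
    filter_upwards [(hopen i).mem_nhds hx.2] with y hy using (hGQ _ hy.2).symm
  rw [sqrt_det_gram_comp g hev (hG _ (hQD hx.2.2)) (hdiff i x hx.2),
    ENNReal.ofReal_mul (abs_nonneg _)]

end General

/-! ### Inverse polar coordinates and the volume of the warped product -/

namespace WarpedMetric

variable (W : WarpedMetric)

/-- The inverse of the polar coordinates. -/
def coordsInv (p : S2 × Circle) : EuclideanSpace ℝ (Fin 3) :=
  !₂[W.a / Real.pi * Real.arccos ((W.Ψ.symm p.1 : EuclideanSpace ℝ (Fin 3)) 2),
    Complex.arg (horiz (W.Ψ.symm p.1)), Complex.arg p.2]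

/-- The image of the polar coordinates. -/
def coordsRange : Set (S2 × Circle) :=
  {p | horiz (W.Ψ.symm p.1) ∈ Complex.slitPlane ∧ (p.2 : ℂ) ∈ Complex.slitPlane}

/-- The domain of the polar coordinates. -/
def coordsDom : Set (EuclideanSpace ℝ (Fin 3)) :=
  {x | x 0 ∈ Ioo 0 W.a ∧ x 1 ∈ Ioo (-Real.pi) Real.pi ∧ x 2 ∈ Ioo (-Real.pi) Real.pi}

lemma contMDiff_coe_S2 : ContMDiff (𝓡 2) 𝓘(ℝ, EuclideanSpace ℝ (Fin 3)) ∞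
    (fun q : S2 => (q : EuclideanSpace ℝ (Fin 3))) :=
  contMDiff_coe_sphere

lemma contMDiff_coe_S2_apply (i : Fin 3) : ContMDiff (𝓡 2) 𝓘(ℝ, ℝ) ∞
    (fun q : S2 => (q : EuclideanSpace ℝ (Fin 3)) i) :=
  (contDiff_coord i).contMDiff.comp contMDiff_coe_S2

lemma contMDiff_horiz : ContMDiff (𝓡 2) 𝓘(ℝ, ℂ) ∞ horiz := by
  have h : ContDiff ℝ ∞ fun v : EuclideanSpace ℝ (Fin 3) => (v 0 : ℂ) + v 1 * Complex.I :=
    (Complex.ofRealCLM.contDiff.comp (contDiff_coord 0)).add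
      ((Complex.ofRealCLM.contDiff.comp (contDiff_coord 1)).mul contDiff_const)
  have e : horiz = (fun v : EuclideanSpace ℝ (Fin 3) => (v 0 : ℂ) + v 1 * Complex.I) ∘
      fun q : S2 => (q : EuclideanSpace ℝ (Fin 3)) := by
    funext q
    exact Complex.mk_eq_add_mul_I _ _
  rw [e]
  exact h.contMDiff.comp contMDiff_coe_S2

lemma isOpen_coordsRange : IsOpen W.coordsRange := by
  refine IsOpen.inter ?_ ?_
  · exact Complex.isOpen_slitPlane.preimage
      ((contMDiff_horiz.continuous.comp W.Ψ.symm.contMDiff.continuous).comp continuous_fst)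
  · exact Complex.isOpen_slitPlane.preimage (continuous_subtype_val.comp continuous_snd)

lemma differentiableAt_arg {z : ℂ} (hz : z ∈ Complex.slitPlane) :
    DifferentiableAt ℝ Complex.arg z := by
  have h : DifferentiableAt ℝ (fun z => (Complex.log z).im) z :=
    Complex.imCLM.differentiableAt.comp z
      ((Complex.differentiableAt_log hz).restrictScalars ℝ)
  simpa only [Complex.log_im] using h

lemma height_mem_Ioo {q : S2} (hq : horiz q ≠ 0) :
    (q : EuclideanSpace ℝ (Fin 3)) 2 ∈ Ioo (-1 : ℝ) 1 := by
  have h1 := norm_horiz q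
  have h2 : 0 < ‖horiz q‖ ^ 2 := by positivity
  constructor <;> nlinarith

lemma mdifferentiableAt_coordsInv {p : S2 × Circle} (hp : p ∈ W.coordsRange) :
    MDifferentiableAt ((𝓡 2).prod (𝓡 1)) (𝓡 3) W.coordsInv p := by
  have hΨ : MDifferentiableAt ((𝓡 2).prod (𝓡 1)) (𝓡 2) (fun p : S2 × Circle => W.Ψ.symm p.1) p :=
    ((W.Ψ.symm.contMDiff.mdifferentiableAt (by norm_num)).comp p mdifferentiableAt_fst)
  have hz := height_mem_Ioo (Complex.slitPlane_ne_zero hp.1)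
  have h0 : MDifferentiableAt ((𝓡 2).prod (𝓡 1)) 𝓘(ℝ, ℝ) (fun p : S2 × Circle =>
      W.a / Real.pi * Real.arccos ((W.Ψ.symm p.1 : EuclideanSpace ℝ (Fin 3)) 2)) p := by
    have h : DifferentiableAt ℝ (fun z => W.a / Real.pi * Real.arccos z)
        ((W.Ψ.symm p.1 : EuclideanSpace ℝ (Fin 3)) 2) :=
      (Real.differentiableAt_arccos.2 ⟨hz.1.ne', hz.2.ne⟩).const_mul _
    exact MDifferentiableAt.comp (g := fun z => W.a / Real.pi * Real.arccos z) p
      h.mdifferentiableAt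
      (((contMDiff_coe_S2_apply 2).mdifferentiableAt (by norm_num)).comp p hΨ)
  have h1 : MDifferentiableAt ((𝓡 2).prod (𝓡 1)) 𝓘(ℝ, ℝ) (fun p : S2 × Circle =>
      Complex.arg (horiz (W.Ψ.symm p.1))) p :=
    (differentiableAt_arg hp.1).mdifferentiableAt.comp p
      ((contMDiff_horiz.mdifferentiableAt (by norm_num)).comp p hΨ)
  have h2 : MDifferentiableAt ((𝓡 2).prod (𝓡 1)) 𝓘(ℝ, ℝ) (fun p : S2 × Circle =>
      Complex.arg p.2) p :=
    (differentiableAt_arg hp.2).mdifferentiableAt.comp p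
      ((contMDiff_coe_circle.mdifferentiableAt (by norm_num)).comp p mdifferentiableAt_snd)
  have hm : ContDiff ℝ ∞ fun v : ℝ × ℝ × ℝ =>
      (!₂[v.1, v.2.1, v.2.2] : EuclideanSpace ℝ (Fin 3)) := by
    rw [contDiff_euclidean]
    intro i
    fin_cases i
    · exact contDiff_fst
    · exact contDiff_fst.comp contDiff_snd
    · exact contDiff_snd.comp contDiff_snd
  exact MDifferentiableAt.comp (I' := 𝓘(ℝ, ℝ × ℝ × ℝ)) (g := fun v : ℝ × ℝ × ℝ =>
      (!₂[v.1, v.2.1, v.2.2] : EuclideanSpace ℝ (Fin 3))) p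
    (hm.contMDiff.mdifferentiableAt (by norm_num)) (h0.prodMk_space (h1.prodMk_space h2))

/-- This holds at every point, poles and cuts included; only the smoothness of the inverse requires
`coordsRange`. -/
lemma coords_coordsInv (p : S2 × Circle) : W.coords (W.coordsInv p) = p := by
  refine Prod.ext ?_ (Circle.exp_arg p.2)
  have h := congrArg W.Ψ (polarMap_arccos_arg W.a_pos (W.Ψ.symm p.1))
  rw [W.Ψ.apply_symm_apply] at h
  exact h

lemma coordsInv_mem {p : S2 × Circle} (hp : p ∈ W.coordsRange) : W.coordsInv p ∈ W.coordsDom := by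
  have hz := height_mem_Ioo (Complex.slitPlane_ne_zero hp.1)
  have hpi := Real.pi_pos
  have ha := W.a_pos
  have h1 : 0 < Real.arccos ((W.Ψ.symm p.1 : EuclideanSpace ℝ (Fin 3)) 2) :=
    Real.arccos_pos.2 hz.2
  have h2 : Real.arccos ((W.Ψ.symm p.1 : EuclideanSpace ℝ (Fin 3)) 2) < Real.pi :=
    lt_of_le_of_ne (Real.arccos_le_pi _) fun h => by
      rw [Real.arccos_eq_pi] at h; linarith [hz.1]
  have harg : ∀ z ∈ Complex.slitPlane, Complex.arg z ∈ Ioo (-Real.pi) Real.pi := fun z hz =>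
    ⟨Complex.neg_pi_lt_arg z,
      lt_of_le_of_ne (Complex.arg_le_pi z) (Complex.mem_slitPlane_iff_arg.1 hz).1⟩
  refine ⟨⟨?_, ?_⟩, harg _ hp.1, harg _ hp.2⟩
  · change 0 < W.a / Real.pi * _
    positivity
  · change W.a / Real.pi * _ < W.a
    calc W.a / Real.pi * Real.arccos ((W.Ψ.symm p.1 : EuclideanSpace ℝ (Fin 3)) 2)
        < W.a / Real.pi * Real.pi := by gcongr
      _ = W.a := by field_simp

lemma horiz_polarMap {r t : ℝ} : horiz (polarMap W.a !₂[r, t]) =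
    (Real.sin (Real.pi * r / W.a) : ℝ) * (Complex.cos t + Complex.sin t * Complex.I) := by
  rw [← Complex.ofReal_cos, ← Complex.ofReal_sin]
  apply Complex.ext
  · simp only [horiz, polarMap, Complex.mul_re, Complex.mul_im, Complex.add_re, Complex.add_im,
      Complex.ofReal_re, Complex.ofReal_im, Complex.I_re, Complex.I_im, PiLp.toLp_apply,
      Matrix.cons_val]
    ring
  · simp only [horiz, polarMap, Complex.mul_re, Complex.mul_im, Complex.add_re, Complex.add_im,
      Complex.ofReal_re, Complex.ofReal_im, Complex.I_re, Complex.I_im, PiLp.toLp_apply,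
      Matrix.cons_val]
    ring

lemma symm_coords_fst (x : EuclideanSpace ℝ (Fin 3)) :
    W.Ψ.symm (W.coords x).1 = polarMap W.a !₂[x 0, x 1] :=
  W.Ψ.symm_apply_apply _

lemma arg_horiz_polarMap {r t : ℝ} (hr : r ∈ Ioo 0 W.a) (ht : t ∈ Ioo (-Real.pi) Real.pi) :
    Complex.arg (horiz (polarMap W.a !₂[r, t])) = t := by
  rw [horiz_polarMap, Complex.arg_mul_cos_add_sin_mul_I (sin_pos_of_mem W.a_pos hr)
    (Ioo_subset_Ioc_self ht)]

lemma coordsInv_coords {x : EuclideanSpace ℝ (Fin 3)} (hx : x ∈ W.coordsDom) :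
    W.coordsInv (W.coords x) = x := by
  have ha := W.a_pos
  have hpi := Real.pi_pos
  have hr := hx.1
  refine PiLp.ext fun i => ?_
  rw [coordsInv, symm_coords_fst]
  fin_cases i
  · change W.a / Real.pi * Real.arccos (Real.cos (Real.pi * x 0 / W.a)) = x 0
    rw [Real.arccos_cos]
    · field_simp
    · have := hr.1; positivity
    · rw [div_le_iff₀ ha]; have := hr.2.le; gcongr
  · exact W.arg_horiz_polarMap hx.1 hx.2.1
  · exact Circle.arg_exp hx.2.2.1 hx.2.2.2.le

lemma coords_mem {x : EuclideanSpace ℝ (Fin 3)} (hx : x ∈ W.coordsDom) :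
    W.coords x ∈ W.coordsRange := by
  constructor
  · rw [symm_coords_fst, Complex.mem_slitPlane_iff_arg, W.arg_horiz_polarMap hx.1 hx.2.1]
    refine ⟨hx.2.1.2.ne, fun h => ?_⟩
    have h1 := norm_horiz (polarMap W.a !₂[x 0, x 1])
    have h2 : ((polarMap W.a !₂[x 0, x 1] : S2) : EuclideanSpace ℝ (Fin 3)) 2 =
      Real.cos (Real.pi * x 0 / W.a) := rfl
    rw [h, h2, ← Real.sin_sq, norm_zero] at h1
    have h3 := sin_pos_of_mem W.a_pos hx.1
    nlinarith
  · rw [Complex.mem_slitPlane_iff_arg]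
    refine ⟨?_, Circle.coe_ne_zero _⟩
    have : Complex.arg (W.coords x).2 = x 2 := Circle.arg_exp hx.2.2.1 hx.2.2.2.le
    rw [this]
    exact hx.2.2.2.ne

lemma sqrt_det_gram_coords {x : EuclideanSpace ℝ (Fin 3)} (hx : x 0 ∈ Ioo 0 W.a) :
    √(gram W.g W.coords x).det = Real.exp (W.logPsi (x 0) (x 1)) * W.u (x 0) := by
  have hu := W.u_pos _ hx
  rw [W.gram_coords hx, Matrix.det_diagonal, Fin.prod_univ_three]
  have e : Real.exp (2 * W.logPsi (x 0) (x 1)) *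
      Real.exp (2 * (W.logPsi (x 0) (x 1) + Real.log (W.u (x 0)))) *
      Real.exp (2 * -W.logPsi (x 0) (x 1)) =
      (Real.exp (W.logPsi (x 0) (x 1)) * W.u (x 0)) ^ 2 := by
    rw [exp_two_mul_add_log _ hu, mul_pow, ← Real.exp_nat_mul, mul_neg, Real.exp_neg]
    push_cast
    field_simp
  exact (congrArg Real.sqrt e).trans (Real.sqrt_sq (mul_pos (Real.exp_pos _) hu).le)

/-- A lower bound only needs an open subset, so the poles and the cuts of the two angles can be
ignored. -/
lemma setLIntegral_le_riemVol_univ :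
    ∫⁻ x in W.coordsDom, ENNReal.ofReal (Real.exp (W.logPsi (x 0) (x 1)) * W.u (x 0)) ≤
      riemVol 3 W.g univ := by
  have hD : MeasurableSet W.coordsDom :=
    (measurableSet_Ioo.preimage (by fun_prop)).inter
      ((measurableSet_Ioo.preimage (by fun_prop)).inter (measurableSet_Ioo.preimage (by fun_prop)))
  rw [← setLIntegral_congr_fun hD fun x hx => congrArg ENNReal.ofReal (W.sqrt_det_gram_coords hx.1)]
  exact setLIntegral_le_riemVol W.g W.isOpen_coordsRange
    (fun x _ => (W.contMDiff_patch (by fun_prop) (by fun_prop) (by fun_prop)).mdifferentiableAt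
      (by norm_num))
    (fun p hp => W.mdifferentiableAt_coordsInv hp) (fun p hp => W.coordsInv_mem hp)
    (fun x hx => W.coords_mem hx) (fun p _ => W.coords_coordsInv p)
    (fun x hx => W.coordsInv_coords hx) (subset_univ _)

end WarpedMetric

/-! ### The diameter -/

section General

variable {E H : Type} [NormedAddCommGroup E] [NormedSpace ℝ E] [TopologicalSpace H]
  {I : ModelWithCorners ℝ E H} {M : Type} [TopologicalSpace M] [ChartedSpace H M]
  [IsManifold I ∞ M]

/-- The Riemannian distance of a smooth metric. -/
def metricDist (g : SmoothMetric I M) (x y : M) : ℝ≥0∞ :=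
  letI : RiemannianBundle (fun x : M => TangentSpace I x) := ⟨g.toRiemannianMetric⟩
  riemannianEDist I x y

lemma metricDist_comm (g : SmoothMetric I M) (x y : M) : metricDist g x y = metricDist g y x :=
  letI : RiemannianBundle (fun x : M => TangentSpace I x) := ⟨g.toRiemannianMetric⟩
  riemannianEDist_comm

lemma metricDist_triangle (g : SmoothMetric I M) (x y z : M) :
    metricDist g x z ≤ metricDist g x y + metricDist g y z :=
  letI : RiemannianBundle (fun x : M => TangentSpace I x) := ⟨g.toRiemannianMetric⟩
  riemannianEDist_triangle

lemma enorm_tangentSpace (g : SmoothMetric I M) (x : M) (v : TangentSpace I x) :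
    letI : RiemannianBundle (fun x : M => TangentSpace I x) := ⟨g.toRiemannianMetric⟩
    ‖v‖ₑ = ENNReal.ofReal √(g.inner x v v) := by
  let : RiemannianBundle (fun x : M => TangentSpace I x) := ⟨g.toRiemannianMetric⟩
  rw [← ofReal_norm, norm_eq_sqrt_real_inner]
  rfl

lemma metricDist_le_of_curve (g : SmoothMetric I M) {γ : ℝ → M} {a b : ℝ} (hab : a ≤ b)
    (hγ : ContMDiffOn 𝓘(ℝ, ℝ) I 1 γ (Icc a b))
    (h : ∀ t ∈ Ioo a b, g.inner (γ t) (mfderiv 𝓘(ℝ, ℝ) I γ t (1 : ℝ))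
      (mfderiv 𝓘(ℝ, ℝ) I γ t (1 : ℝ)) = 1) :
    metricDist g (γ a) (γ b) ≤ ENNReal.ofReal (b - a) := by
  let : RiemannianBundle (fun x : M => TangentSpace I x) := ⟨g.toRiemannianMetric⟩
  refine (riemannianEDist_le_pathELength hγ rfl rfl hab).trans ?_
  rw [pathELength_eq_lintegral_mfderiv_Ioo]
  refine (le_of_eq (setLIntegral_congr_fun (g := fun _ => 1) measurableSet_Ioo
    fun t ht => ?_)).trans (by simp)
  refine (enorm_tangentSpace g (γ t) _).trans ?_
  refine (congrArg (fun z => ENNReal.ofReal √z) (h t ht)).trans (by simp)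

/-- A function with gradient at most 1 maps each curve to a curve in ℝ that is no longer, and in ℝ
length dominates distance. -/
lemma ofReal_sub_le_metricDist (g : SmoothMetric I M) {f : M → ℝ} (hf : ContMDiff I 𝓘(ℝ, ℝ) 1 f)
    (h : ∀ p (v : TangentSpace I p), abs (α := ℝ) (mfderiv I 𝓘(ℝ, ℝ) f p v) ≤ √(g.inner p v v)) (x y : M) :
    ENNReal.ofReal (f y - f x) ≤ metricDist g x y := by
  let : RiemannianBundle (fun x : M => TangentSpace I x) := ⟨g.toRiemannianMetric⟩
  by_contra! hlt
  obtain ⟨γ, h0, h1, hγ, hl⟩ := exists_lt_of_riemannianEDist_lt hlt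
  have hF : ContMDiffOn 𝓘(ℝ, ℝ) 𝓘(ℝ, ℝ) 1 (f ∘ γ) (Icc 0 1) := hf.comp_contMDiffOn hγ
  have h2 : edist (f x) (f y) ≤ pathELength 𝓘(ℝ, ℝ) (f ∘ γ) 0 1 := by
    rw [IsRiemannianManifold.out (I := 𝓘(ℝ, ℝ)) (f x) (f y)]
    exact riemannianEDist_le_pathELength hF (by simp [h0]) (by simp [h1]) zero_le_one
  have h3 : pathELength 𝓘(ℝ, ℝ) (f ∘ γ) 0 1 ≤ pathELength I γ 0 1 := by
    rw [pathELength_eq_lintegral_mfderiv_Ioo, pathELength_eq_lintegral_mfderiv_Ioo]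
    refine setLIntegral_mono' measurableSet_Ioo fun t ht => ?_
    have hγt : MDifferentiableAt 𝓘(ℝ, ℝ) I γ t :=
      (hγ.contMDiffAt (Icc_mem_nhds ht.1 ht.2)).mdifferentiableAt (by norm_num)
    have hc := mfderiv_comp_apply t (hf.mdifferentiableAt (by norm_num)) hγt (1 : ℝ)
    refine (enorm_tangentSpace_vectorSpace.trans (congrArg (fun z : ℝ => ‖z‖ₑ) hc)).trans_le ?_
    refine le_trans ?_ (enorm_tangentSpace g (γ t) _).ge
    exact (Real.enorm_eq_ofReal_abs _).trans_le (ENNReal.ofReal_le_ofReal (h (γ t) _))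
  have h4 : ENNReal.ofReal (f y - f x) ≤ edist (f x) (f y) := by
    rw [edist_dist, dist_comm, Real.dist_eq]
    exact ENNReal.ofReal_le_ofReal (le_abs_self _)
  exact absurd hl (not_lt.2 (h4.trans (h2.trans h3)))

lemma diam_eq (g : SmoothMetric I M) : diam g = ⨆ (x : M) (y : M), metricDist g x y := rfl

end General

namespace RotSymMetric

variable (R : RotSymMetric)

lemma exists_polar_eq (p : S2) : ∃ r ∈ Icc 0 R.a, ∃ t, R.polar !₂[r, t] = p := by
  obtain ⟨r, hr, t, e⟩ := exists_polarMap_eq R.a_pos (R.Ψ.symm p)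
  exact ⟨r, hr, t, by rw [polar, e, R.Ψ.apply_symm_apply]⟩

/-- Meridians have unit speed. The speed is needed on the open interval only, so the end points may
be poles. -/
lemma metricDist_meridian_le {r s : ℝ} (hr : 0 ≤ r) (hrs : r ≤ s) (hs : s ≤ R.a) (t : ℝ) :
    metricDist R.h (R.polar !₂[r, t]) (R.polar !₂[s, t]) ≤ ENNReal.ofReal (s - r) := by
  have hl : ContDiff ℝ ∞ fun z : ℝ => (!₂[z, t] : EuclideanSpace ℝ (Fin 2)) := by
    rw [contDiff_euclidean]
    intro i
    fin_cases i
    · exact contDiff_id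
    · exact contDiff_const
  refine metricDist_le_of_curve R.h (γ := fun z => R.polar !₂[z, t]) hrs
    ((R.contMDiff_polar.comp hl.contMDiff).of_le (by exact_mod_cast le_top)).contMDiffOn
    fun z hz => ?_
  have hd : HasDerivAt (fun z : ℝ => (!₂[z, t] : EuclideanSpace ℝ (Fin 2)))
      (EuclideanSpace.single 0 1) z := by
    have h0 := hl.differentiable (by norm_num) z
    have e : deriv (fun z : ℝ => (!₂[z, t] : EuclideanSpace ℝ (Fin 2))) z =
        EuclideanSpace.single 0 1 := by
      ext i
      have h1 : HasDerivAt (fun z : ℝ => (!₂[z, t] : EuclideanSpace ℝ (Fin 2)) i) _ z :=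
        (EuclideanSpace.proj i : EuclideanSpace ℝ (Fin 2) →L[ℝ] ℝ).hasFDerivAt.comp_hasDerivAt z
          h0.hasDerivAt
      refine h1.unique ?_
      fin_cases i
      · simpa using hasDerivAt_id' z
      · simpa using hasDerivAt_const z t
    exact e ▸ h0.hasDerivAt
  have e : mfderiv 𝓘(ℝ, ℝ) (𝓡 2) (fun z => R.polar !₂[z, t]) z (1 : ℝ) =
      mfderiv (𝓡 2) (𝓡 2) R.polar !₂[z, t]
        (EuclideanSpace.single 0 1 : EuclideanSpace ℝ (Fin 2)) := by
    refine (mfderiv_comp_apply z (R.contMDiff_polar.mdifferentiableAt (by norm_num))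
      hd.differentiableAt.mdifferentiableAt (1 : ℝ)).trans ?_
    rw [mfderiv_eq_fderiv]
    exact congrArg (mfderiv (𝓡 2) (𝓡 2) R.polar !₂[z, t]) hd.deriv
  rw [e]
  refine (R.inner_polar (x := !₂[z, t]) ⟨hr.trans_lt hz.1, hz.2.trans_le hs⟩ _ _).trans ?_
  simp

lemma polar_zero (t : ℝ) : R.polar !₂[0, t] = R.polar !₂[0, 0] := by
  rw [polar, polarMap_zero t 0, polar]

lemma polar_right (t : ℝ) : R.polar !₂[R.a, t] = R.polar !₂[R.a, 0] := by
  rw [polar, polarMap_right R.a_pos t 0, polar]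

/-- Two points are joined by meridians through a pole: the paths through the two poles have total
lengths r + s and 2a - r - s, and one of these is at most a. -/
lemma diam_le : diam R.h ≤ ENNReal.ofReal R.a := by
  rw [diam_eq]
  refine iSup₂_le fun p q => ?_
  obtain ⟨r, hr, t, rfl⟩ := R.exists_polar_eq p
  obtain ⟨s, hs, t', rfl⟩ := R.exists_polar_eq q
  rcases le_total (r + s) R.a with h | h
  · have h1 := R.metricDist_meridian_le le_rfl hr.1 hr.2 t
    have h2 := R.metricDist_meridian_le le_rfl hs.1 hs.2 t'
    rw [R.polar_zero, sub_zero] at h1 h2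
    rw [metricDist_comm] at h1
    refine (metricDist_triangle R.h _ _ _).trans ((add_le_add h1 h2).trans ?_)
    rw [← ENNReal.ofReal_add hr.1 hs.1]
    exact ENNReal.ofReal_le_ofReal h
  · have h1 := R.metricDist_meridian_le hr.1 hr.2 le_rfl t
    have h2 := R.metricDist_meridian_le hs.1 hs.2 le_rfl t'
    rw [R.polar_right] at h1 h2
    rw [metricDist_comm] at h2
    refine (metricDist_triangle R.h _ _ _).trans ((add_le_add h1 h2).trans ?_)
    rw [← ENNReal.ofReal_add (by linarith [hr.2]) (by linarith [hs.2])]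
    exact ENNReal.ofReal_le_ofReal (by linarith)

/-- A smooth approximation of the distance from a pole. -/
def heightFun (c : ℝ) (p : S2) : ℝ :=
  -- For c = 1 this would be r - a/2, which is not smooth at the poles. For 0 < c < 1 the argument
  -- of arcsin stays away from ±1.
  -(R.a / Real.pi * Real.arcsin (c * (R.Ψ.symm p : EuclideanSpace ℝ (Fin 3)) 2))

lemma abs_height_le (q : S2) : |(q : EuclideanSpace ℝ (Fin 3)) 2| ≤ 1 := by
  have := norm_horiz q
  exact abs_le_of_sq_le_sq (by nlinarith [sq_nonneg ‖horiz q‖]) zero_le_one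

lemma contMDiff_heightFun {c : ℝ} (hc : c ∈ Ioo (0 : ℝ) 1) :
    ContMDiff (𝓡 2) 𝓘(ℝ, ℝ) ∞ (R.heightFun c) := by
  intro p
  have hz := abs_le.1 (abs_height_le (R.Ψ.symm p))
  have h : ContDiffAt ℝ ∞ (fun z => -(R.a / Real.pi * Real.arcsin (c * z)))
      ((R.Ψ.symm p : EuclideanSpace ℝ (Fin 3)) 2) :=
    (contDiffAt_const.mul (ContDiffAt.comp (g := Real.arcsin) _
      (Real.contDiffAt_arcsin (fun e => by simp only [id] at e; nlinarith [hc.1, hc.2])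
        (fun e => by simp only [id] at e; nlinarith [hc.1, hc.2]))
      (contDiffAt_const.mul contDiffAt_id))).neg
  exact ContMDiffAt.comp (g := fun z => -(R.a / Real.pi * Real.arcsin (c * z))) p h.contMDiffAt
    (((WarpedMetric.contMDiff_coe_S2_apply 2).comp R.Ψ.symm.contMDiff) p)

lemma heightFun_polar (c : ℝ) (x : EuclideanSpace ℝ (Fin 2)) : R.heightFun c (R.polar x) =
    -(R.a / Real.pi * Real.arcsin (c * Real.cos (Real.pi * x 0 / R.a))) := by
  rw [heightFun, polar, R.Ψ.symm_apply_apply]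
  rfl

lemma surjective_of_injective {n : ℕ}
    {A : EuclideanSpace ℝ (Fin n) →L[ℝ] EuclideanSpace ℝ (Fin n)} (h : Function.Injective A) :
    Function.Surjective A :=
  (LinearMap.injective_iff_surjective (f := A.toLinearMap)).1 h

/-- With s and k the sine and cosine of πr/a, the derivative is cs/√(1 - c²k²), and c²s² + c²k² = c²
< 1. -/
lemma hasDerivAt_height {c : ℝ} (hc : c ∈ Ioo (0 : ℝ) 1) (r : ℝ) :
    ∃ d, |d| ≤ 1 ∧
      HasDerivAt (fun r => -(R.a / Real.pi * Real.arcsin (c * Real.cos (Real.pi * r / R.a)))) d r := by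
  have ha := R.a_pos
  have hpi := Real.pi_pos
  set s := Real.sin (Real.pi * r / R.a) with hs
  set k := Real.cos (Real.pi * r / R.a) with hk
  have hsk : s ^ 2 + k ^ 2 = 1 := Real.sin_sq_add_cos_sq _
  have hc2 : c ^ 2 < 1 := by nlinarith [hc.1, hc.2]
  have hsum : (c * s) ^ 2 + (c * k) ^ 2 = c ^ 2 := by
    rw [mul_pow, mul_pow, ← mul_add, hsk, mul_one]
  have hck : (c * k) ^ 2 < 1 := by linarith [sq_nonneg (c * s)]
  obtain ⟨hk1, hk2⟩ := abs_lt.1 ((sq_lt_one_iff_abs_lt_one _).1 hck)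
  have h1 : HasDerivAt (fun r => Real.pi * r / R.a) (Real.pi / R.a) r := by
    simpa using ((hasDerivAt_id r).const_mul Real.pi).div_const R.a
  have h2 := (((Real.hasDerivAt_arcsin hk1.ne' hk2.ne).comp r (h1.cos.const_mul c)).const_mul
    (R.a / Real.pi)).neg
  refine ⟨_, ?_, h2⟩
  have hpos : 0 < √(1 - (c * k) ^ 2) := Real.sqrt_pos.2 (by linarith)
  have e : -(R.a / Real.pi * (1 / √(1 - (c * k) ^ 2) * (c * (-s * (Real.pi / R.a))))) =
      c * s / √(1 - (c * k) ^ 2) := by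
    field_simp
  rw [e, abs_div, abs_of_pos hpos, div_le_one hpos]
  refine Real.le_sqrt_of_sq_le ?_
  rw [sq_abs]
  linarith

lemma mfderiv_comp_real {f : S2 → ℝ} (hf : ContMDiff (𝓡 2) 𝓘(ℝ, ℝ) ∞ f)
    {G : EuclideanSpace ℝ (Fin 2) → S2} {x : EuclideanSpace ℝ (Fin 2)}
    (hG : MDifferentiableAt (𝓡 2) (𝓡 2) G x) (w : EuclideanSpace ℝ (Fin 2)) :
    fderiv ℝ (f ∘ G) x w = mfderiv (𝓡 2) 𝓘(ℝ, ℝ) f (G x) (mfderiv (𝓡 2) (𝓡 2) G x w) := by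
  rw [← mfderiv_eq_fderiv]
  exact mfderiv_comp_apply x (hf.mdifferentiableAt (by norm_num)) hG w

/-- Serves at the poles, where polar coordinates do not span the tangent space but the height is
extremal. -/
lemma mfderiv_eq_zero_of_extr {f : S2 → ℝ} (hf : ContMDiff (𝓡 2) 𝓘(ℝ, ℝ) ∞ f) {p : S2}
    (h : (∀ q, f p ≤ f q) ∨ ∀ q, f q ≤ f p) (v : TangentSpace (𝓡 2) p) :
    mfderiv (𝓡 2) 𝓘(ℝ, ℝ) f p v = (0 : ℝ) := by
  obtain ⟨V, G, hG, y, hy, rfl⟩ := exists_isLocalParam p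
  obtain ⟨w, rfl⟩ := surjective_of_injective (hG.immersion y hy) v
  have hGd : MDifferentiableAt (𝓡 2) (𝓡 2) G y :=
    (hG.contMDiffOn.contMDiffAt (hG.isOpen.mem_nhds hy)).mdifferentiableAt (by norm_num)
  refine (mfderiv_comp_real hf hGd w).symm.trans ?_
  have : IsLocalExtr (f ∘ G) y := by
    rcases h with h | h
    · exact Or.inl (Filter.Eventually.of_forall fun z => h (G z))
    · exact Or.inr (Filter.Eventually.of_forall fun z => h (G z))
  rw [this.fderiv_eq_zero]
  rfl

/-- Off the poles the height depends on r alone, with slope at most 1, and dr² ≤ h. At the poles its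
differential is zero. -/
lemma abs_mfderiv_heightFun_le {c : ℝ} (hc : c ∈ Ioo (0 : ℝ) 1) (p : S2)
    (v : TangentSpace (𝓡 2) p) :
    abs (α := ℝ) (mfderiv (𝓡 2) 𝓘(ℝ, ℝ) (R.heightFun c) p v) ≤ √(R.h.inner p v v) := by
  have ha := R.a_pos
  have hpi := Real.pi_pos
  have hf := R.contMDiff_heightFun hc
  obtain ⟨r, hr, t, rfl⟩ := R.exists_polar_eq p
  have hpole : ((∀ q, R.heightFun c (R.polar !₂[r, t]) ≤ R.heightFun c q) ∨
      ∀ q, R.heightFun c q ≤ R.heightFun c (R.polar !₂[r, t])) →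
      abs (α := ℝ) (mfderiv (𝓡 2) 𝓘(ℝ, ℝ) (R.heightFun c) (R.polar !₂[r, t]) v) ≤
        √(R.h.inner (R.polar !₂[r, t]) v v) := fun h =>
    ((congrArg (abs (α := ℝ)) (mfderiv_eq_zero_of_extr hf h v)).trans abs_zero).trans_le
      (Real.sqrt_nonneg _)
  rcases hr.1.eq_or_lt with rfl | h0
  · refine hpole (Or.inl fun q => ?_)
    rw [heightFun_polar, heightFun]
    have := (abs_le.1 (abs_height_le (R.Ψ.symm q))).2
    refine neg_le_neg (mul_le_mul_of_nonneg_left (Real.monotone_arcsin ?_) (by positivity))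
    simpa using mul_le_mul_of_nonneg_left this hc.1.le
  rcases hr.2.eq_or_lt with rfl | h1
  · refine hpole (Or.inr fun q => ?_)
    rw [heightFun_polar, heightFun]
    have := (abs_le.1 (abs_height_le (R.Ψ.symm q))).1
    refine neg_le_neg (mul_le_mul_of_nonneg_left (Real.monotone_arcsin ?_) (by positivity))
    have e : Real.pi * (!₂[R.a, t] : EuclideanSpace ℝ (Fin 2)) 0 / R.a = Real.pi := by
      simp [ha.ne']
    rw [e, Real.cos_pi]
    exact mul_le_mul_of_nonneg_left this hc.1.le
  · have hx : (!₂[r, t] : EuclideanSpace ℝ (Fin 2)) 0 ∈ Ioo 0 R.a := ⟨h0, h1⟩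
    have hinj : Function.Injective (mfderiv (𝓡 2) (𝓡 2) R.polar !₂[r, t]) := by
      refine injective_of_gram_det_ne_zero R.h ?_
      rw [R.gram_polar hx, Matrix.det_fin_two_of]
      have := (R.u_pos _ hx).ne'
      simpa using this
    obtain ⟨w, rfl⟩ := surjective_of_injective hinj v
    obtain ⟨d, hd1, hd⟩ := R.hasDerivAt_height hc r
    have hcomp : HasFDerivAt (R.heightFun c ∘ R.polar) (d •
        (EuclideanSpace.proj 0 : EuclideanSpace ℝ (Fin 2) →L[ℝ] ℝ)) !₂[r, t] := by
      have e : R.heightFun c ∘ R.polar =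
          (fun r => -(R.a / Real.pi * Real.arcsin (c * Real.cos (Real.pi * r / R.a)))) ∘
            fun y : EuclideanSpace ℝ (Fin 2) => y 0 := funext fun y => R.heightFun_polar c y
      rw [e]
      exact HasDerivAt.comp_hasFDerivAt _ hd
        (EuclideanSpace.proj 0 : EuclideanSpace ℝ (Fin 2) →L[ℝ] ℝ).hasFDerivAt
    have e1 := mfderiv_comp_real hf (R.contMDiff_polar.mdifferentiableAt (by norm_num)
      (x := !₂[r, t])) w
    rw [hcomp.fderiv] at e1
    refine ((congrArg (abs (α := ℝ)) e1.symm)).trans_le ?_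
    change |d * w 0| ≤ _
    refine le_trans ?_ (Real.sqrt_le_sqrt (R.inner_polar hx w w).ge)
    refine Real.le_sqrt_of_sq_le ?_
    rw [sq_abs, mul_pow]
    have h2 : d ^ 2 ≤ 1 := by rw [← sq_abs]; nlinarith [abs_nonneg d]
    nlinarith [sq_nonneg (w 0), mul_nonneg (sq_nonneg (R.u ((!₂[r, t] : EuclideanSpace ℝ (Fin 2)) 0)))
      (mul_self_nonneg (w 1))]

/-- The heights of the two poles differ by (2a/π) arcsin c, which tends to a as c tends to 1. -/
lemma le_diam : ENNReal.ofReal R.a ≤ diam R.h := by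
  have ha := R.a_pos
  have hpi := Real.pi_pos
  have key : ∀ c ∈ Ioo (0 : ℝ) 1, ENNReal.ofReal (2 * R.a / Real.pi * Real.arcsin c) ≤
      diam R.h := fun c hc => by
    rw [diam_eq]
    refine le_trans ?_ (le_iSup₂ (f := fun x y => metricDist R.h x y) (R.polar !₂[0, 0])
      (R.polar !₂[R.a, 0]))
    refine le_trans (le_of_eq ?_) (ofReal_sub_le_metricDist R.h
      ((R.contMDiff_heightFun hc).of_le (by exact_mod_cast le_top))
      (R.abs_mfderiv_heightFun_le hc) _ _)
    rw [heightFun_polar, heightFun_polar]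
    have e : Real.pi * (!₂[R.a, 0] : EuclideanSpace ℝ (Fin 2)) 0 / R.a = Real.pi := by
      simp [ha.ne']
    rw [e, Real.cos_pi]
    simp only [mul_neg, mul_one, Real.arcsin_neg, Matrix.cons_val, mul_zero,
      zero_div, Real.cos_zero]
    congr 1
    ring
  have hlim : Filter.Tendsto (fun c : ℝ => ENNReal.ofReal (2 * R.a / Real.pi * Real.arcsin c))
      (𝓝[<] 1) (𝓝 (ENNReal.ofReal R.a)) := by
    have h1 : ContinuousAt (fun c : ℝ => ENNReal.ofReal (2 * R.a / Real.pi * Real.arcsin c)) 1 :=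
      (ENNReal.continuous_ofReal.comp (continuous_const.mul Real.continuous_arcsin)).continuousAt
    have h2 : 2 * R.a / Real.pi * Real.arcsin 1 = R.a := by
      rw [Real.arcsin_one]; field_simp
    have h3 := h1.tendsto.mono_left (nhdsWithin_le_nhds (s := Iio 1))
    simp only [h2] at h3
    exact h3
  refine le_of_tendsto hlim ?_
  filter_upwards [Ioo_mem_nhdsLT (zero_lt_one' ℝ)] with c hc using key c hc

theorem diam_eq_ofReal : diam R.h = ENNReal.ofReal R.a :=
  le_antisymm R.diam_le R.le_diam

end RotSymMetric

/-! ### Area and volume estimates combined -/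

namespace WarpedMetric

variable (W : WarpedMetric)

lemma exists_deriv_u_eq_zero : ∃ r ∈ Ioo 0 W.a, deriv W.u r = 0 :=
  exists_deriv_eq_zero W.a_pos W.u_smooth.continuousOn (W.u_zero.trans W.u_a.symm)

lemma minA_le_of_bound {B : ℝ} (hB : 0 ≤ B)
    (h : ∀ r ∈ Ioo 0 W.a, ∀ t ∈ Icc (-Real.pi) Real.pi, Real.exp (2 * W.logPsi r t) * W.u r ≤
      B * ((W.a / r) ^ (5 / 8 : ℝ) + (W.a / (W.a - r)) ^ (5 / 8 : ℝ))) :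
    minA W.g ≤ ENNReal.ofReal (B * (16 / 3 * W.a) * (2 * Real.pi)) := by
  have hm : MeasurableSet {x : EuclideanSpace ℝ (Fin 2) |
      x 0 ∈ Ioo 0 W.a ∧ x 1 ∈ Ioc (-Real.pi) Real.pi} := by
    refine MeasurableSet.inter (s₁ := {x : EuclideanSpace ℝ (Fin 2) | x 0 ∈ Ioo 0 W.a}) ?_ ?_
    · exact (EuclideanSpace.proj (𝕜 := ℝ) (0 : Fin 2)).measurable measurableSet_Ioo
    · exact (EuclideanSpace.proj (𝕜 := ℝ) (1 : Fin 2)).measurable measurableSet_Ioc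
  have hw : Measurable fun r : ℝ => ENNReal.ofReal
      ((W.a / r) ^ (5 / 8 : ℝ) + (W.a / (W.a - r)) ^ (5 / 8 : ℝ)) := by fun_prop
  have hle := setLIntegral_mono' (μ := volume) hm fun x hx =>
    ENNReal.ofReal_le_ofReal (h (x 0) hx.1 (x 1) ⟨hx.2.1.le, hx.2.2⟩)
  refine W.minA_le_sphere.trans (hle.trans ?_)
  simp only [ENNReal.ofReal_mul hB]
  refine (setLIntegral_box measurableSet_Ioo measurableSet_Ioc (hw.const_mul _)).le.trans ?_
  · rw [lintegral_const_mul _ hw, Real.volume_Ioc, mul_assoc B, ENNReal.ofReal_mul hB,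
      ENNReal.ofReal_mul, ← mul_assoc]
    · gcongr
      · exact lintegral_weight_le W.a_pos
      · linarith
    · have := W.a_pos
      positivity

lemma ofReal_le_riemVol_univ {s b : ℝ} (hs : Ioo s (s + W.a / 4) ⊆ Ioo 0 W.a)
    (h : ∀ r ∈ Icc s (s + W.a / 4), ∀ t ∈ Icc (-Real.pi) Real.pi,
      b ≤ Real.exp (W.logPsi r t) * W.u r) :
    ENNReal.ofReal b * ENNReal.ofReal (W.a / 4 * (2 * Real.pi) * (2 * Real.pi)) ≤
      riemVol 3 W.g univ := by
  have ha := W.a_pos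
  have hpi := Real.pi_pos
  set J : Fin 3 → Set ℝ := ![Ioo s (s + W.a / 4), Ioo (-Real.pi) Real.pi, Ioo (-Real.pi) Real.pi]
  have hJ : ∀ i, MeasurableSet (J i) := fun i => by
    fin_cases i <;> exact measurableSet_Ioo
  have hsub : {x : EuclideanSpace ℝ (Fin 3) | ∀ i, x i ∈ J i} ⊆ W.coordsDom :=
    fun x hx => ⟨hs (hx 0), hx 1, hx 2⟩
  refine le_trans ?_ ((lintegral_mono_set hsub).trans W.setLIntegral_le_riemVol_univ)
  refine le_trans (le_of_eq ?_) (setLIntegral_mono' (f := fun _ => ENNReal.ofReal b)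
    (measurableSet_box hJ) fun x hx => ENNReal.ofReal_le_ofReal
      (h _ (Ioo_subset_Icc_self (hx 0)) _ (Ioo_subset_Icc_self (hx 1))))
  rw [setLIntegral_const, volume_box, Fin.prod_univ_three]
  simp only [J, Matrix.cons_val, Real.volume_Ioo]
  rw [ENNReal.ofReal_mul (by positivity), ENNReal.ofReal_mul (by positivity)]
  congr 3 <;> ring_nf

end WarpedMetric

/-- A bound for the diameter under the condition `Λ`. -/
def diamBound (V₀ A₀ : ℝ) : ℝ :=
  -- The first summand is the upper bound for a; the second is the reciprocal of the lower bound
  -- A₀/(4π²). Their sum serves both sides. The factor (32/3)π is (16/3) · 2π from the sphere, and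
  -- π² is (1/4)(2π)² from the volume of the box.
  16 * Real.pi ^ 2 * (Real.exp 22 * (32 / 3 * Real.pi)) * V₀ ^ 2 /
    ((Real.exp (-12) * Real.pi ^ 2) ^ 2 * A₀ ^ 2) + 4 * Real.pi ^ 2 / A₀

lemma diamBound_pos (V₀ : ℝ) {A₀ : ℝ} (hA : 0 < A₀) : 0 < diamBound V₀ A₀ := by
  have := Real.pi_pos
  exact add_pos_of_nonneg_of_pos (by positivity) (by positivity)

/-- The product of the torus bound and the sphere bound contains E²v²a, which is the square of the
volume bound divided by a; thus v and E are eliminated together. -/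
lemma le_of_area_volume_bounds {a v E A V K k : ℝ} (hk : 0 < k) (hA : 0 < A) (ha : 0 < a)
    (hv : 0 < v) (hE : 0 < E) (h1 : A ≤ 16 * Real.pi ^ 2 * v) (h2 : A ≤ K * (E ^ 2 * v * a))
    (h3 : k * (a * v * E) ≤ V) (hK : 0 < K) :
    a ≤ 16 * Real.pi ^ 2 * K * V ^ 2 / (k ^ 2 * A ^ 2) := by
  rw [le_div_iff₀ (by positivity)]
  have e3 : (k * (a * v * E)) ^ 2 ≤ V ^ 2 := pow_le_pow_left₀ (by positivity) h3 2
  calc a * (k ^ 2 * A ^ 2) = a * k ^ 2 * (A * A) := by ring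
    _ ≤ a * k ^ 2 * (16 * Real.pi ^ 2 * v * (K * (E ^ 2 * v * a))) := by gcongr
    _ = 16 * Real.pi ^ 2 * K * (k * (a * v * E)) ^ 2 := by ring
    _ ≤ 16 * Real.pi ^ 2 * K * V ^ 2 := by gcongr

namespace ConditionΛ

variable {V₀ A₀ : ℝ} {W : WarpedMetric}

lemma le_u (hW : ConditionΛ V₀ A₀ W) (hA : 0 < A₀) :
    ∃ r ∈ Ioo 0 W.a, A₀ ≤ 4 * Real.pi ^ 2 * W.u r := by
  -- Rolle's theorem for u provides the minimal torus.
  obtain ⟨r, hr, hd⟩ := W.exists_deriv_u_eq_zero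
  refine ⟨r, hr, (ENNReal.ofReal_le_ofReal_iff' .. |>.1
    (hW.le_minA.trans (W.minA_le_torus hr hd))).resolve_right hA.not_ge⟩

lemma le_a (hW : ConditionΛ V₀ A₀ W) (hA : 0 < A₀) : A₀ ≤ 4 * Real.pi ^ 2 * W.a := by
  obtain ⟨r, hr, h⟩ := hW.le_u hA
  have hu := (W.isProfile_of_scalarNonneg hW.scalar_nonneg).le_left _ (Ioo_subset_Icc_self hr)
  exact h.trans (by gcongr; exact hu.trans hr.2.le)

lemma a_le (hW : ConditionΛ V₀ A₀ W) (hA : 0 < A₀) : W.a ≤ 16 * Real.pi ^ 2 *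
    (Real.exp 22 * (32 / 3 * Real.pi)) * V₀ ^ 2 /
      ((Real.exp (-12) * Real.pi ^ 2) ^ 2 * A₀ ^ 2) := by
  have ha := W.a_pos
  have hpi := Real.pi_pos
  have hS := hW.scalar_nonneg
  obtain ⟨s, hs, L, hu, hup, hlow⟩ := (W.isProfile_of_scalarNonneg hS).exists_circle
    (p := W.logPsi) (fun r _ t => W.hasDerivAt_logPsi_left r t)
    (fun r _ t => W.hasDerivAt_logPsi_right r t) (fun r hr t => W.curvature_inequality hS hr t)
  have hs0 : 0 < s := by linarith [hs.1]
  have hv : 0 < W.u s := W.u_pos s ⟨hs0, by linarith [hs.2]⟩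
  obtain ⟨r, hr, hAr⟩ := hW.le_u hA
  have hE : Real.exp (2 * L) = Real.exp L ^ 2 := by rw [← Real.exp_nat_mul]; norm_num
  refine le_of_area_volume_bounds (v := W.u s) (E := Real.exp L) (by positivity) hA ha hv
    (Real.exp_pos L) ?_ ?_ ?_ (by positivity)
  · have := hu r (Ioo_subset_Icc_self hr)
    calc A₀ ≤ 4 * Real.pi ^ 2 * W.u r := hAr
      _ ≤ 4 * Real.pi ^ 2 * (4 * W.u s) := by gcongr
      _ = 16 * Real.pi ^ 2 * W.u s := by ring
  · have h := (ENNReal.ofReal_le_ofReal_iff' .. |>.1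
      (hW.le_minA.trans (W.minA_le_of_bound (by positivity) hup))).resolve_right hA.not_ge
    rw [hE] at h
    refine h.trans (le_of_eq (by ring))
  · have h := (W.ofReal_le_riemVol_univ
      (fun x hx => ⟨hs0.trans hx.1, hx.2.trans (by linarith [hs.2])⟩) hlow).trans hW.vol_le
    rw [← ENNReal.ofReal_mul (by positivity)] at h
    -- The left side is positive, so the truncation in `ENNReal.ofReal` is harmless, whatever the
    -- sign of `V₀`.
    have h' := (ENNReal.ofReal_le_ofReal_iff' .. |>.1 h).resolve_right (not_le.2 (by positivity))
    refine (le_of_eq (by ring)).trans h'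

end ConditionΛ

lemma ConditionΛ.diam_bounds {V₀ A₀ : ℝ} (hA : 0 < A₀) {W : WarpedMetric}
    (hW : ConditionΛ V₀ A₀ W) :
    diam W.h = ENNReal.ofReal W.a ∧ (diamBound V₀ A₀)⁻¹ ≤ W.a ∧ W.a ≤ diamBound V₀ A₀ := by
  have hpi := Real.pi_pos
  refine ⟨W.diam_eq_ofReal, ?_, (hW.a_le hA).trans (le_add_of_nonneg_right (by positivity))⟩
  rw [inv_le_comm₀ (diamBound_pos V₀ hA) W.a_pos]
  refine le_trans ?_ (le_add_of_nonneg_left (by positivity))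
  rw [inv_le_iff_one_le_mul₀ W.a_pos, div_mul_eq_mul_div, one_le_div₀ hA]
  exact hW.le_a hA

end WarpedMinA

end

theorem theorem1p1 (V₀ A₀ : ℝ) (hA₀ : 0 < A₀) :
    ∃ C : ℝ, 0 < C ∧ ∀ W : ℕ → WarpedMinA.WarpedMetric,
      (∀ i, WarpedMinA.ConditionΛ V₀ A₀ (W i)) →
        ∀ i, WarpedMinA.diam (W i).h = ENNReal.ofReal (W i).a ∧ C⁻¹ ≤ (W i).a ∧ (W i).a ≤ C :=
  ⟨WarpedMinA.diamBound V₀ A₀, WarpedMinA.diamBound_pos V₀ hA₀, fun _ hW i =>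
    (hW i).diam_bounds hA₀⟩
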